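/- **Setting.** Let $f\colon[a,b]\to[a,b]$ be a unimodal map: $f$ is continuous, there is a turning point $c\in(a,b)$ such that $f$ is strictly increasing on $[a,c]$ and strictly decreasing on $[c,b]$, and $f(c)=b$, $f(b)=a$. An itinerary of $x\in[a,b]$ is a sequence $s\in\{0,1\}^{\mathbb N}$ such that, for all $r\ge0$, $s_r=0$ implies $f^r(x)\in[a,c]$ and $s_r=1$ implies $f^r(x)\in[c,b]$. The unimodal order on $\{0,1\}^{\mathbb N}$ is defined by: $s\prec t$ iff $s\ne t$ and $\sum_{i=0}^r s_i$ is even, where $r$ is least with $s_r\neq t_r$. The kneading sequence $\kappa(f)$ is the $\prec$-smallest itinerary of $b$. For a word $W$, write $\overline W=WWW\cdots$, and let $\sigma$ be the shift map. Assume throughout that 1. $10\overline{1}\prec\kappa(f)$; 2. if $\kappa(f)$ is not a periodic sequence, then distinct points of $[a,b]$ do not share a common itinerary; 3. for each $n>0$ and $\mu\in\{0,1\}^{\mathbb N}$ there are at most two fixed points of $f^n$ with itinerary $\mu$, and if there are two then $\kappa(f)=\sigma^r(\mu)$ for some $r$. **Height.** For a rational $q=m/n\in(0,1/2]$ in lowest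 terms and $1\le i\le m$, let $\kappa_i(q)$ be two less than the number of integers $j$ with $i-1\le qj\le i$, and put $c_q=1\,0^{\kappa_1(q)}\,11\,0^{\kappa_2(q)}\,11\cdots11\,0^{\kappa_m(q)}\,1$. The height of a sequence $\mu$ is $q(\mu)=\inf\left(\{q\in(0,1/2]\cap\mathbb Q:\overline{c_q0}\prec\mu\}\cup\{1/2\}\right)$. For $q\in(0,1/2)\cap\mathbb Q$ let $w_q$ be $c_q$ with its last two symbols deleted, $\hat w_q$ its reverse, $\mathrm{lhe}(q)=\overline{w_q1}$ and $\mathrm{rhe}(q)=10\,\overline{\hat w_q1}$. Also let $\mathrm{lhe}(0)=1\overline0$, while $\mathrm{rhe}(0)$ is undefined (so no sequence equals it). **Types.** Suppose that $q(\kappa(f))=m/n$ is rational (in lowest terms). If $m/n>0$, then $f$ is of *right endpoint type* if $\kappa(f)=\mathrm{rhe}(m/n)$; of *early left endpoint type* if $\kappa(f)=\mathrm{lhe}(m/n)$ and $f^n(a)\ne a$; and of *strict left endpoint type* if $\kappa(f)=\mathrm{lhe}(m/n)$ and $f^n(a)=a$. In the strict case $f$ is *tent-like* if $b$ is the only period $n$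 point of $f$ with itinerary $\mathrm{lhe}(m/n)$, and *quadratic-like* otherwise. If $m/n=0$, then $f$ is declared to be of tent-like strict left endpoint type. *Normal endpoint type* means right endpoint type or tent-like strict left endpoint type. **Outside map.** Let $S$ be the circle obtained by gluing two copies of $[a,b]$ (lower points $x_\ell$ and upper points $x_u$) at their endpoints, so that $a_\ell=a_u=a$ and $b_\ell=b_u=b$. Let $\hat a$ be the unique point of $(c,b]$ with $f(\hat a)=f(a)$, and let $\gamma=\{x_u: a\le x\le\hat a\}\subset S$. The outside map $B\colon S\to S$ is given by $B(x_\ell)=f(x)_\ell$ for $x\in[a,c]$, $B(x_\ell)=f(x)_u$ for $x\in[c,b]$, $B(x_u)=f(x)_\ell$ for $x\in[\hat a,b]$, and $B(x_u)=f(a)_\ell$ for $x\in[a,\hat a]$. Orient $S$ from $a$ to $b$ along the lower points and back to $a$ along the upper points. Let $N(f)\in\mathbb N\cup\{\infty\}$ be the least $r\ge1$ with $B^r(a)\in\gamma$, or $\infty$ if there is none. **Theorem (Dynamics of the outside map).** (a) $B$ is a (continuous) monotone degree one circle map, and its Poincaré rotation number is $\rho(B)=q(\kappa(f))\in[0,1)$.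 (b) If $q(\kappa(f))=m/n$ is rational and $f$ is not of early left endpoint type, then (i) $N(f)=n$; (ii) $B^n(a)=a$ if and only if $\kappa(f)=\mathrm{lhe}(m/n)$, and $B^n(a)=\hat a_u$ if and only if $\kappa(f)=\mathrm{rhe}(m/n)$; (iii) the set $S\setminus\bigcup_{r\ge0}B^{-r}(\gamma)$ is empty if $f$ is of normal endpoint type; is a union of $n$ (pairwise disjoint) half-open intervals, each with open endpoint at a point of the period $n$ orbit of $B(a)$ and closed endpoint at a point of a second period $n$ orbit of $B$, if $f$ is of quadratic-like strict left endpoint type; and is a single period $n$ orbit of $B$ otherwise. (c) If $q(\kappa(f))=m/n$ is rational and $f$ is of early left endpoint type, then $N(f)=\infty$, and $B$ has a period $n$ orbit $Q$, disjoint from $\gamma$, which attracts the orbit of $B(a)$: the distance from $B^r(a)$ to $Q$ tends to $0$ as $r\to\infty$. (d) If $q(\kappa(f))$ is irrational, then $N(f)=\infty$; the set $\bigcup_{r\ge0}B^{-r}(\gamma)$ is dense in $S$; and the orbit $\{B^r(a):r\ge1\}$ is contained and dense in $S\setminus\bigcup_{r\ge0}B^{-r}(\gamma)$. -/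

import Mathlib

open Set Filter Topology Function

noncomputable section

/-! ### Sequences and words in the symbols 0 and 1 -/

/-- Elements of `{0,1}^ℕ`. -/
abbrev BinSeq : Type := ℕ → Fin 2

namespace BinSeq

/-- The unimodal order: if `r` is the first place where `s` and `t` differ, then `s ≺ t` iff
`s 0 + ⋯ + s r` is even. -/
def Lt (s t : BinSeq) : Prop :=
  ∃ r : ℕ, (∀ i < r, s i = t i) ∧ s r ≠ t r ∧ Even (∑ i ∈ Finset.range (r + 1), (s i : ℕ))

/-- The non-strict unimodal order. -/
def Le (s t : BinSeq) : Prop := s = t ∨ Lt s t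

/-- The shift map `σ`, iterated `r` times. -/
def shift (r : ℕ) (s : BinSeq) : BinSeq := fun i => s (i + r)

/-- `s` is a (purely) periodic sequence. -/
def IsPeriodic (s : BinSeq) : Prop := ∃ p : ℕ, 0 < p ∧ shift p s = s

/-- The sequence `W W W ⋯` (used for non-empty words `W`). -/
def rep (W : List (Fin 2)) : BinSeq := fun i => W.getD (i % W.length) 0

/-- The sequence `V s`. -/
def prepend (V : List (Fin 2)) (s : BinSeq) : BinSeq :=
  fun i => if i < V.length then V.getD i 0 else s (i - V.length)

end BinSeq

/-- `κ_i(q)`: two less than the number of integers `j` for which the point of abscissa `j` on the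
line `y = q x` has `i - 1 ≤ y ≤ i`, i.e. `(i - 1) / q ≤ j ≤ i / q`. (For `0 < q ≤ 1/2` there are
at least two such integers.) -/
def kappaInt (q : ℚ) (i : ℕ) : ℕ :=
  (Finset.Icc ⌈((i : ℚ) - 1) / q⌉ ⌊(i : ℚ) / q⌋).card - 2

/-- The word `c_q = 1 0^{κ_1} 11 0^{κ_2} 11 ⋯ 11 0^{κ_m} 1` for `q = m / n ∈ (0, 1/2]`. -/
def cWord (q : ℚ) : List (Fin 2) :=
  [1] ++ List.intercalate [1, 1]
      ((List.range q.num.toNat).map fun i => List.replicate (kappaInt q (i + 1)) 0) ++ [1]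

/-- The word `w_q`: delete the last two symbols of `c_q`. -/
def wWord (q : ℚ) : List (Fin 2) := (cWord q).dropLast.dropLast

/-- The height of a sequence: the infimum of the set of rationals `q ∈ (0, 1/2]` for which
`(c_q 0)^∞ ≺ s`, together with `1/2`. -/
def heightOf (s : BinSeq) : ℝ :=
  sInf ({x : ℝ | ∃ q : ℚ, 0 < q ∧ q ≤ 1 / 2 ∧ BinSeq.Lt (BinSeq.rep (cWord q ++ [0])) s ∧
    x = (q : ℝ)} ∪ {1 / 2})

/-- `lhe(q) = (w_q 1)^∞` for rational `q ∈ (0, 1/2)`, and `lhe(0) = 1 0^∞`. -/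
def lhe (q : ℚ) : BinSeq :=
  if q = 0 then BinSeq.prepend [1] (BinSeq.rep [0]) else BinSeq.rep (wWord q ++ [1])

/-- `rhe(q) = 10 (ŵ_q 1)^∞` for rational `q ∈ (0, 1/2)`, where `ŵ_q` is the reverse of `w_q`. -/
def rhe (q : ℚ) : BinSeq :=
  BinSeq.prepend [1, 0] (BinSeq.rep ((wWord q).reverse ++ [1]))

/-! ### Unimodal maps -/

/-- A unimodal map `f : [a, b] → [a, b]` with turning point `c ∈ (a, b)`, `f(c) = b` and
`f(b) = a`. Values of `toFun` outside `[a, b]` are irrelevant. -/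
structure UnimodalMap where
  a : ℝ
  b : ℝ
  c : ℝ
  toFun : ℝ → ℝ
  a_lt_c : a < c
  c_lt_b : c < b
  mapsTo : MapsTo toFun (Icc a b) (Icc a b)
  continuousOn : ContinuousOn toFun (Icc a b)
  strictMonoOn : StrictMonoOn toFun (Icc a c)
  strictAntiOn : StrictAntiOn toFun (Icc c b)
  map_c : toFun c = b
  map_b : toFun b = a

namespace UnimodalMap

instance : CoeFun UnimodalMap (fun _ => ℝ → ℝ) := ⟨UnimodalMap.toFun⟩

variable (f : UnimodalMap)

/-- `s` is an itinerary of `x`. -/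
def IsItinerary (x : ℝ) (s : BinSeq) : Prop :=
  ∀ r : ℕ, (s r = 0 → f^[r] x ∈ Icc f.a f.c) ∧ (s r = 1 → f^[r] x ∈ Icc f.c f.b)

theorem a_lt_b : f.a < f.b := f.a_lt_c.trans f.c_lt_b

theorem iterate_mem {x : ℝ} (hx : x ∈ Icc f.a f.b) (r : ℕ) : f^[r] x ∈ Icc f.a f.b :=
  f.mapsTo.iterate r hx

/-- There is a smallest itinerary of `b` with respect to the unimodal order. -/
theorem exists_least_itinerary :
    ∃ s : BinSeq, f.IsItinerary f.b s ∧ ∀ t, f.IsItinerary f.b t → BinSeq.Le s t := by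
  let sym : Fin 2 → ℝ → Fin 2 := fun p y => if y < f.c then 0 else if f.c < y then 1 else p
  let P : ℕ → Fin 2 := fun n => Nat.rec 0 (fun k p => p + sym p (f^[k] f.b)) n
  have hP : ∀ n, P (n + 1) = P n + sym (P n) (f^[n] f.b) := fun _ => rfl
  let s : BinSeq := fun n => sym (P n) (f^[n] f.b)
  have hsum : ∀ n, (P n).val = (∑ i ∈ Finset.range n, (s i : ℕ)) % 2 := by
    intro n
    induction n with
    | zero => rfl
    | succ k ih =>
      rw [Finset.sum_range_succ, hP, Fin.val_add, ih]
      simp [s]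
  have hmem : ∀ r, f^[r] f.b ∈ Icc f.a f.b :=
    f.iterate_mem ⟨f.a_lt_b.le, le_rfl⟩
  refine ⟨s, fun r => ⟨fun h => ⟨(hmem r).1, ?_⟩, fun h => ⟨?_, (hmem r).2⟩⟩, fun t ht => ?_⟩
  · by_contra hc
    push Not at hc
    simp [s, sym, hc, hc.le.not_gt] at h
  · by_contra hc
    push Not at hc
    simp [s, sym, hc] at h
  · by_cases hst : s = t
    · exact Or.inl hst
    · right
      have hex : ∃ r, s r ≠ t r := by
        by_contra hcon
        push Not at hcon
        exact hst (funext hcon)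
      classical
      refine ⟨Nat.find hex, fun i hi => not_not.mp (Nat.find_min hex hi), Nat.find_spec hex, ?_⟩
      have hr := Nat.find_spec hex
      generalize Nat.find hex = r at hr
      have hc : f^[r] f.b = f.c := by
        rcases lt_trichotomy (f^[r] f.b) f.c with h | h | h
        · have h0 : s r = 0 := by simp [s, sym, h]
          have h1 : t r = 1 := by
            have := hr; rw [h0] at this; omega
          exact absurd ((ht r).2 h1).1 h.not_ge
        · exact h
        · have h0 : s r = 1 := by simp [s, sym, h, h.le.not_gt]
          have h1 : t r = 0 := by
            have := hr; rw [h0] at this; omega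
          exact absurd ((ht r).1 h1).2 h.not_ge
      have hs : s r = P r := by simp [s, sym, hc]
      rw [Nat.even_iff, ← hsum, hP]
      change ((P r + s r : Fin 2) : ℕ) = 0
      rw [hs, Fin.val_add]
      omega

/-- The kneading sequence `κ(f)`: the smallest itinerary of `b`. -/
def kneading : BinSeq := Classical.choose f.exists_least_itinerary

/-- The height `q(κ(f))`. -/
def height : ℝ := heightOf f.kneading

/-- The standing assumptions on unimodal maps. -/
structure Standing : Prop where
  not_renormalizable : BinSeq.Lt (BinSeq.prepend [1, 0] (BinSeq.rep [1])) f.kneading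
  itinerary_injective : ¬ BinSeq.IsPeriodic f.kneading →
    ∀ x ∈ Icc f.a f.b, ∀ y ∈ Icc f.a f.b, ∀ s : BinSeq,
      f.IsItinerary x s → f.IsItinerary y s → x = y
  periodic_le_two : ∀ n : ℕ, 0 < n → ∀ s : BinSeq,
    {x ∈ Icc f.a f.b | IsPeriodicPt f n x ∧ f.IsItinerary x s}.encard ≤ 2
  periodic_two : ∀ n : ℕ, 0 < n → ∀ s : BinSeq,
    {x ∈ Icc f.a f.b | IsPeriodicPt f n x ∧ f.IsItinerary x s}.encard = 2 →
      ∃ r : ℕ, f.kneading = BinSeq.shift r s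

/-- There is a unique point of `(c, b]` with the same image as `a`. -/
theorem existsUnique_re : ∃! x : ℝ, x ∈ Ioc f.c f.b ∧ f x = f f.a := by
  have ha : f f.a < f.b := by
    have := f.strictMonoOn ⟨le_rfl, f.a_lt_c.le⟩ ⟨f.a_lt_c.le, le_rfl⟩ f.a_lt_c
    rwa [f.map_c] at this
  have ha' : f.a ≤ f f.a := (f.mapsTo ⟨le_rfl, f.a_lt_b.le⟩).1
  have hcont : ContinuousOn f (Icc f.c f.b) :=
    f.continuousOn.mono (Icc_subset_Icc_left f.a_lt_c.le)
  obtain ⟨x, hx, hfx⟩ := intermediate_value_Icc' f.c_lt_b.le hcont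
    (show f f.a ∈ Icc (f f.b) (f f.c) by rw [f.map_b, f.map_c]; exact ⟨ha', ha.le⟩)
  refine ⟨x, ⟨⟨lt_of_le_of_ne hx.1 ?_, hx.2⟩, hfx⟩, ?_⟩
  · rintro rfl
    rw [f.map_c] at hfx
    exact ha.ne hfx.symm
  · rintro y ⟨hy, hfy⟩
    exact f.strictAntiOn.injOn ⟨hy.1.le, hy.2⟩ hx (hfy.trans hfx.symm)

/-- The point `â` of `(c, b]` with `f(â) = f(a)`. -/
def re : ℝ := Classical.choose f.existsUnique_re.exists

/-! ### The circle `S` and the outside map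

`S` is two copies of `[a, b]` glued at their endpoints. It is realised as `ℝ / ℤ`, the lower copy
being mapped affinely onto `[0, 1/2]` (from `a` to `b`) and the upper one onto `[1/2, 1]` (from `b`
to `a`), so that the positive direction is counterclockwise. -/

/-- The point `x_ℓ` of the circle. -/
def lower (x : ℝ) : UnitAddCircle := (((x - f.a) / (2 * (f.b - f.a)) : ℝ) : UnitAddCircle)

/-- The point `x_u` of the circle. -/
def upper (x : ℝ) : UnitAddCircle := ((1 - (x - f.a) / (2 * (f.b - f.a)) : ℝ) : UnitAddCircle)

/-- The coordinate in `[0, 1)` of a point of the circle. -/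
def coord (y : UnitAddCircle) : ℝ := (AddCircle.equivIco (1 : ℝ) 0 y : ℝ)

/-- The projection `τ : S → [a, b]`, `τ(x_ℓ) = τ(x_u) = x`. -/
def proj (y : UnitAddCircle) : ℝ :=
  f.a + 2 * (f.b - f.a) * min (coord y) (1 - coord y)

/-- The outside map `B : S → S`: `B(x_ℓ) = f(x)_ℓ` for `x ∈ [a, c]`, `B(x_ℓ) = f(x)_u` for
`x ∈ [c, b]`, `B(x_u) = f(x)_ℓ` for `x ∈ [â, b]`, and `B(x_u) = f(a)_ℓ` for `x ∈ [a, â]`; see the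
four lemmas below. -/
def outside (y : UnitAddCircle) : UnitAddCircle :=
  if coord y ≤ 1 / 2 then
    if f.proj y ≤ f.c then f.lower (f (f.proj y)) else f.upper (f (f.proj y))
  else
    if f.re ≤ f.proj y then f.lower (f (f.proj y)) else f.lower (f f.a)

theorem re_mem : f.re ∈ Ioc f.c f.b := (Classical.choose_spec f.existsUnique_re.exists).1

theorem map_re : f f.re = f f.a := (Classical.choose_spec f.existsUnique_re.exists).2

theorem coord_coe {t : ℝ} (h : t ∈ Ico (0 : ℝ) 1) : coord (t : UnitAddCircle) = t := by
  have := AddCircle.equivIco_coe_eq (p := (1 : ℝ)) (a := 0) (x := t) (by simpa using h)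
  simp [coord, this]

theorem scaled_mem {x : ℝ} (hx : x ∈ Icc f.a f.b) :
    (x - f.a) / (2 * (f.b - f.a)) ∈ Icc (0 : ℝ) (1 / 2) := by
  have h := f.a_lt_b
  have hd : 0 < 2 * (f.b - f.a) := by linarith
  refine ⟨div_nonneg (by linarith [hx.1]) hd.le, ?_⟩
  rw [div_le_iff₀ hd]
  linarith [hx.2]

theorem unscale (x : ℝ) : f.a + 2 * (f.b - f.a) * ((x - f.a) / (2 * (f.b - f.a))) = x := by
  have h := f.a_lt_b
  have hd : f.b - f.a ≠ 0 := by linarith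
  field_simp
  ring

theorem coord_lower {x : ℝ} (hx : x ∈ Icc f.a f.b) :
    coord (f.lower x) = (x - f.a) / (2 * (f.b - f.a)) := by
  have h := f.scaled_mem hx
  exact coord_coe ⟨h.1, by linarith [h.2]⟩

theorem proj_lower {x : ℝ} (hx : x ∈ Icc f.a f.b) : f.proj (f.lower x) = x := by
  have h := f.scaled_mem hx
  rw [proj, f.coord_lower hx, min_eq_left (by linarith [h.2]), f.unscale]

theorem coord_upper {x : ℝ} (hx : x ∈ Ioc f.a f.b) :
    coord (f.upper x) = 1 - (x - f.a) / (2 * (f.b - f.a)) := by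
  have h := f.scaled_mem ⟨hx.1.le, hx.2⟩
  have hab := f.a_lt_b
  have h0 : 0 < (x - f.a) / (2 * (f.b - f.a)) :=
    div_pos (by linarith [hx.1]) (by linarith)
  exact coord_coe ⟨by linarith [h.2], by linarith⟩

theorem proj_upper {x : ℝ} (hx : x ∈ Ioc f.a f.b) : f.proj (f.upper x) = x := by
  have h := f.scaled_mem ⟨hx.1.le, hx.2⟩
  rw [proj, f.coord_upper hx, min_eq_right (by linarith [h.2]), sub_sub_cancel, f.unscale]

theorem lower_a : f.lower f.a = 0 := by simp [lower]

theorem upper_a : f.upper f.a = 0 := by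
  simp only [upper, sub_self, zero_div, sub_zero]
  exact AddCircle.coe_period 1

theorem upper_b : f.upper f.b = f.lower f.b := by
  have h : f.b - f.a ≠ 0 := by linarith [f.a_lt_b]
  have h2 : (f.b - f.a) / (2 * (f.b - f.a)) = 1 / 2 := by field_simp
  simp only [upper, lower, h2]
  norm_num

theorem outside_lower_left {x : ℝ} (hx : x ∈ Icc f.a f.c) :
    f.outside (f.lower x) = f.lower (f x) := by
  have hx' : x ∈ Icc f.a f.b := ⟨hx.1, hx.2.trans f.c_lt_b.le⟩
  rw [outside, if_pos (by rw [f.coord_lower hx']; exact (f.scaled_mem hx').2), f.proj_lower hx',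
    if_pos hx.2]

theorem outside_lower_right {x : ℝ} (hx : x ∈ Icc f.c f.b) :
    f.outside (f.lower x) = f.upper (f x) := by
  have hx' : x ∈ Icc f.a f.b := ⟨f.a_lt_c.le.trans hx.1, hx.2⟩
  rw [outside, if_pos (by rw [f.coord_lower hx']; exact (f.scaled_mem hx').2), f.proj_lower hx']
  split_ifs with h
  · rw [le_antisymm h hx.1, f.map_c, f.upper_b]
  · rfl

theorem outside_upper_right {x : ℝ} (hx : x ∈ Icc f.re f.b) :
    f.outside (f.upper x) = f.lower (f x) := by
  have hr := f.re_mem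
  rcases eq_or_lt_of_le hx.2 with rfl | hlt
  · rw [f.upper_b, f.outside_lower_right ⟨f.c_lt_b.le, le_rfl⟩, f.map_b, f.upper_a, f.lower_a]
  · have hx' : x ∈ Ioc f.a f.b := ⟨f.a_lt_c.trans (hr.1.trans_le hx.1), hx.2⟩
    have hd : 0 < 2 * (f.b - f.a) := by linarith [f.a_lt_b]
    have h2 : (x - f.a) / (2 * (f.b - f.a)) < 1 / 2 := by
      rw [div_lt_iff₀ hd]; linarith
    rw [outside, if_neg (by rw [f.coord_upper hx']; linarith), f.proj_upper hx', if_pos hx.1]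

theorem outside_upper_left {x : ℝ} (hx : x ∈ Icc f.a f.re) :
    f.outside (f.upper x) = f.lower (f f.a) := by
  have hr := f.re_mem
  rcases eq_or_lt_of_le hx.2 with rfl | hlt
  · rw [f.outside_upper_right ⟨le_rfl, hr.2⟩, f.map_re]
  rcases eq_or_lt_of_le hx.1 with rfl | hgt
  · rw [f.upper_a, ← f.lower_a, f.outside_lower_left ⟨le_rfl, f.a_lt_c.le⟩]
  · have hx' : x ∈ Ioc f.a f.b := ⟨hgt, hx.2.trans hr.2⟩
    have hd : 0 < 2 * (f.b - f.a) := by linarith [f.a_lt_b]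
    have h2 : (x - f.a) / (2 * (f.b - f.a)) < 1 / 2 := by
      rw [div_lt_iff₀ hd]; linarith [hr.2]
    rw [outside, if_neg (by rw [f.coord_upper hx']; linarith), f.proj_upper hx',
      if_neg (not_le.mpr hlt)]

/-- The point `a = a_ℓ = a_u` of the circle. -/
def aPt : UnitAddCircle := f.lower f.a

/-- The interval `γ = [â_u, a]` of the circle. -/
def gamma : Set UnitAddCircle := f.upper '' Icc f.a f.re

/-- `N(f)`: the least `r ≥ 1` with `B^r(a) ∈ γ`, or `∞` if there is none. -/
def firstEntry : ℕ∞ :=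
  sInf {x : ℕ∞ | ∃ r : ℕ, 1 ≤ r ∧ f.outside^[r] f.aPt ∈ f.gamma ∧ x = (r : ℕ∞)}

/-- The set of points whose orbits fall into `γ`. -/
def falls : Set UnitAddCircle := ⋃ r : ℕ, f.outside^[r] ⁻¹' f.gamma

/-! ### Types of unimodal maps of rational height `q = m / n` (in lowest terms) -/

/-- Right endpoint type: `κ(f) = rhe(q)`, with `q > 0`. -/
def IsRightEndpoint (q : ℚ) : Prop := 0 < q ∧ f.kneading = rhe q

/-- Early left endpoint type. -/
def IsEarly (q : ℚ) : Prop := 0 < q ∧ f.kneading = lhe q ∧ f^[q.den] f.a ≠ f.a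

/-- Tent-like strict left endpoint type: either `q = 0`, or `κ(f) = lhe(q)`, `f^n(a) = a` and `b`
is the only period `n` point with itinerary `lhe(q)`. -/
def IsTentLike (q : ℚ) : Prop :=
  q = 0 ∨ (0 < q ∧ f.kneading = lhe q ∧ f^[q.den] f.a = f.a ∧
    ∀ x ∈ Icc f.a f.b, minimalPeriod f x = q.den → f.IsItinerary x (lhe q) → x = f.b)

/-- Quadratic-like strict left endpoint type: `κ(f) = lhe(q)`, `f^n(a) = a` and there is a period
`n` point other than `b` with itinerary `lhe(q)`. -/
def IsQuadraticLike (q : ℚ) : Prop :=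
  0 < q ∧ f.kneading = lhe q ∧ f^[q.den] f.a = f.a ∧
    ∃ x ∈ Icc f.a f.b, x ≠ f.b ∧ minimalPeriod f x = q.den ∧ f.IsItinerary x (lhe q)

/-- Normal endpoint type. -/
def IsNormal (q : ℚ) : Prop := f.IsRightEndpoint q ∨ f.IsTentLike q

end UnimodalMap

/-! ### Circle maps -/

/-- `F` is a (continuous, monotone, degree one) lift of the circle map `B`. -/
def IsCircleLift (F : CircleDeg1Lift) (B : UnitAddCircle → UnitAddCircle) : Prop :=
  Continuous F ∧ ∀ x : ℝ, ((F x : ℝ) : UnitAddCircle) = B (x : UnitAddCircle)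

/-- `B` is a monotone degree one circle map with Poincaré rotation number `ρ ∈ [0, 1)`: it has a
lift, and every lift has translation number equal to `ρ` modulo `1`. -/
def HasRotationNumber (B : UnitAddCircle → UnitAddCircle) (ρ : ℝ) : Prop :=
  ρ ∈ Ico (0 : ℝ) 1 ∧ (∃ F, IsCircleLift F B) ∧
    ∀ F, IsCircleLift F B → ∃ k : ℤ, F.translationNumber = ρ + k

/-- The forward orbit of `x`. -/
def fwdOrbit {X : Type*} (B : X → X) (x : X) : Set X := range fun r : ℕ => B^[r] x

/-- `A` is a half-open interval of the circle, open at its endpoint `o` and closed at its other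
endpoint `e` (the latter may come after or before `o` in the counterclockwise direction). -/
def IsHalfOpenArc (A : Set UnitAddCircle) (o e : UnitAddCircle) : Prop :=
  ∃ s t : ℝ, (s : UnitAddCircle) = o ∧ (t : UnitAddCircle) = e ∧
    ((s < t ∧ t < s + 1 ∧ A = (fun x : ℝ => (x : UnitAddCircle)) '' Ioc s t) ∨
     (t < s ∧ s < t + 1 ∧ A = (fun x : ℝ => (x : UnitAddCircle)) '' Ico t s))

end

/-!
The outside map `B` has an explicit lift `F` (`UnimodalMap.lift`) to the line. In the coordinate in
which `γ` is `[g, 1]`, it is strictly increasing on `[0, g]` and constant on `[g, 1]`, and off the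
interior of `γ` the projection `τ` of the circle to `[a, b]` semiconjugates `B` to `f` (`tau_lift`).

*Height.* Itineraries can be read off the circle. Let `e j` be the integer part of the `j`-th point
of the orbit of `b` under `F`. The symbol `1` occurs at time `j` exactly when `e` increases between
the times `j` and `j + 2`, and a faster staircase `e` has a smaller code in the unimodal order
(`IsStaircase.code_le_code`). The word `c_q` and the sequences `lhe(q)` and `rhe(q)` are codes of the
staircases of the rotation by `q`, with the two possible conventions at lattice points (`cWord_eq`,
`lhe_eq`, `rhe_eq`). The staircase `e` lies between the two staircases of the rotation by
`ρ = ρ(B)`, and `κ(f)` differs from its code only if `a` returns to the interior of `γ`, where `f`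
and `B` part. Hence `κ(f)` lies between the codes of the two staircases of `ρ`, and its height is `ρ`
(`height_eq_rho`).

*Rational height `q = m / n`.* Let `H = F^n - m` (`ret`) and `w = H 0`. The orbit of `a` can return to
`γ` only at multiples of `n`, and the position of `w` decides the type of `f`: `κ(f) = lhe(q)` iff
`0 ≤ w`, `κ(f) = rhe(q)` iff `w = g - 1`, the type is early iff `0 < w`, and `w < g - 1` is excluded
because it would give `κ(f) = rhe(q)`. If `w ∈ [g - 1, 0]`, the orbit of `B^n(a)` has period `n`, and
a point that does not fall into `γ` lies strictly between two consecutive points of this orbit. The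
proof then rests on two facts. An arc whose images do not overlap the interior of `γ` projects to an
arc whose endpoints have a common itinerary (`ArcAvoids.isItinerary`), so that the standing
assumptions bound the number of such arcs. And `H` moves `â_u` forwards and `a` backwards, so that
the orbit of `B^n(a)` attracts everything up to the nearest fixed points of `H` (`falls_of_right`,
`falls_of_left`). When `w = 0`, a second period `n` orbit of `B` corresponds to a second period `n`
point of `f` with the itinerary of `b` (`exists_periodic_of_fixed`, `exists_fixed_of_periodic`), which
separates the tent-like from the quadratic-like case. When `w > 0`, the points `H^i 0` increase to a
fixed point of `H`.

*Irrational height.* The orbit of `a` never returns to `γ`, since a return would be periodic, and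
`κ(f)` is not periodic, so that distinct points have distinct itineraries. An arc without points
that fall into `γ` would have endpoints with a common itinerary. The orbit of `B(a)` is ordered like
an orbit of the rotation by `ρ`; if it missed a one-sided neighbourhood of a point that does not fall
into `γ`, density of the rotation orbit would again give an arc whose images avoid `γ`
(`exists_iterate_zero_mem_Ioo`).
-/

/-! ### The unimodal order -/

namespace BinSeq

theorem eq_one_of_ne_zero {x : Fin 2} (h : x ≠ 0) : x = 1 := by omega

theorem exists_first_diff {s t : BinSeq} (h : s ≠ t) : ∃ r, (∀ i < r, s i = t i) ∧ s r ≠ t r := by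
  classical
  have hex : ∃ r, s r ≠ t r := by
    by_contra hcon
    push Not at hcon
    exact h (funext hcon)
  exact ⟨Nat.find hex, fun i hi => not_not.mp (Nat.find_min hex hi), Nat.find_spec hex⟩

theorem sum_congr_prefix {s t : BinSeq} {r : ℕ} (h : ∀ i < r, s i = t i) :
    ∑ i ∈ Finset.range r, (s i : ℕ) = ∑ i ∈ Finset.range r, (t i : ℕ) :=
  Finset.sum_congr rfl fun i hi => by rw [h i (Finset.mem_range.mp hi)]

theorem Lt.trans {s t u : BinSeq} (h₁ : Lt s t) (h₂ : Lt t u) : Lt s u := by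
  obtain ⟨r₁, p₁, d₁, e₁⟩ := h₁
  obtain ⟨r₂, p₂, d₂, e₂⟩ := h₂
  rcases lt_trichotomy r₁ r₂ with h | h | h
  · exact ⟨r₁, fun i hi => (p₁ i hi).trans (p₂ i (hi.trans h)), by rwa [← p₂ r₁ h], e₁⟩
  · subst h
    rw [Finset.sum_range_succ] at e₁ e₂
    rw [← sum_congr_prefix p₁] at e₂
    have hs := (s r₁).isLt
    have ht := (t r₁).isLt
    have hd : (s r₁ : ℕ) ≠ (t r₁ : ℕ) := fun h => d₁ (Fin.ext h)
    rw [Nat.even_iff] at e₁ e₂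
    omega
  · refine ⟨r₂, fun i hi => (p₁ i (hi.trans h)).trans (p₂ i hi), by rwa [p₁ r₂ h], ?_⟩
    rwa [sum_congr_prefix fun i hi => p₁ i (lt_of_lt_of_le hi h)]

theorem Lt.irrefl (s : BinSeq) : ¬ Lt s s := fun ⟨_, _, h, _⟩ => h rfl

theorem Lt.trans_le {s t u : BinSeq} (h₁ : Lt s t) (h₂ : Le t u) : Lt s u := by
  rcases h₂ with rfl | h₂
  exacts [h₁, h₁.trans h₂]

theorem Le.trans_lt {s t u : BinSeq} (h₁ : Le s t) (h₂ : Lt t u) : Lt s u := by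
  rcases h₁ with rfl | h₁
  exacts [h₂, h₁.trans h₂]

theorem Le.trans {s t u : BinSeq} (h₁ : Le s t) (h₂ : Le t u) : Le s u := by
  rcases h₁ with rfl | h₁
  exacts [h₂, Or.inr (h₁.trans_le h₂)]

theorem Le.not_lt {s t : BinSeq} (h : Le s t) : ¬ Lt t s := fun h' =>
  Lt.irrefl s (h.trans_lt h')

theorem shift_shift (r s : ℕ) (t : BinSeq) : shift r (shift s t) = shift (r + s) t := by
  funext i
  simp [shift, add_assoc]

end BinSeq

/-! ### Sequences coded by integer staircases -/

/-- The sequence whose `j`-th symbol records whether the integer sequence `e` moves between the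
times `j` and `j + 2`. With `e j` the integer part at time `j` of an orbit of a lift of the outside
map, this is the itinerary read off the circle: each turn around the circle contributes two
consecutive symbols `1`. -/
def code (e : ℕ → ℤ) : BinSeq := fun j => if e (j + 2) = e j then 0 else 1

/-- The integer staircases that are coded faithfully: they start with `-1, 0`, and increase by at
most one in any two consecutive steps. -/
structure IsStaircase (e : ℕ → ℤ) : Prop where
  zero : e 0 = -1
  one : e 1 = 0
  mono : ∀ j, e j ≤ e (j + 1)
  le_add : ∀ j, e (j + 2) ≤ e j + 1

namespace IsStaircase

variable {e e' : ℕ → ℤ}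

theorem cast_code (he : IsStaircase e) (j : ℕ) : ((code e j : ℕ) : ℤ) = e (j + 2) - e j := by
  have h1 := he.mono j
  have h2 := he.mono (j + 1)
  have h3 := he.le_add j
  unfold code
  split_ifs with h
  · simp [h]
  · simp only [Fin.val_one, Nat.cast_one]
    have : j + 1 + 1 = j + 2 := rfl
    rw [this] at h2
    omega

theorem sum_code (he : IsStaircase e) (r : ℕ) :
    ((∑ i ∈ Finset.range r, (code e i : ℕ) : ℕ) : ℤ) = e (r + 1) + e r + 1 := by
  induction r with
  | zero => simp [he.zero, he.one]
  | succ r ih =>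
    rw [Finset.sum_range_succ, Nat.cast_add, ih, he.cast_code]
    ring

theorem eq_of_code_eq (he : IsStaircase e) (he' : IsStaircase e') {r : ℕ}
    (h : ∀ i < r, code e i = code e' i) : ∀ i < r + 2, e i = e' i := by
  intro i
  induction i using Nat.strong_induction_on with
  | _ i ih =>
    intro hi
    match i with
    | 0 => rw [he.zero, he'.zero]
    | 1 => rw [he.one, he'.one]
    | j + 2 =>
      have h1 := he.cast_code j
      have h2 := he'.cast_code j
      rw [h j (by omega)] at h1
      have := ih j (by omega) (by omega)
      omega

/-- A faster staircase is coded by a smaller sequence: at the first difference of the codes the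
faster staircase moves, and the sum of the symbols up to there is even. -/
theorem code_le_code (he : IsStaircase e) (he' : IsStaircase e') (h : ∀ j, e' j ≤ e j) :
    BinSeq.Le (code e) (code e') := by
  by_cases hc : code e = code e'
  · exact Or.inl hc
  obtain ⟨r, hr, hd⟩ := BinSeq.exists_first_diff hc
  refine Or.inr ⟨r, hr, hd, ?_⟩
  have heq := he.eq_of_code_eq he' hr
  have e1 := heq r (by omega)
  have e2 := heq (r + 1) (by omega)
  have h1 := he.cast_code r
  have h2 := he'.cast_code r
  have hne : ((code e r : ℕ) : ℤ) ≠ ((code e' r : ℕ) : ℤ) := fun hh =>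
    hd (Fin.ext (by exact_mod_cast hh))
  have hle := h (r + 2)
  have m1 := he'.mono r
  have m2 := he'.mono (r + 1)
  have b1 := he.le_add r
  have hs := he.sum_code (r + 1)
  have m3 : e' (r + 1 + 1) = e' (r + 2) := rfl
  have m4 : e (r + 1 + 1) = e (r + 2) := rfl
  have m5 := he'.le_add r
  have : ((∑ i ∈ Finset.range (r + 1), (code e i : ℕ) : ℕ) : ℤ) = 2 * (e r + 1) := by omega
  rw [← Int.even_coe_nat, this]
  exact even_two_mul _

end IsStaircase

/-- The staircase of the rotation by `ρ`, with orbit points that are integers counted as lying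
above the integer. -/
noncomputable def upperStair (ρ : ℝ) (j : ℕ) : ℤ := if j = 0 then -1 else ⌊ρ * (j - 1)⌋

/-- The staircase of the rotation by `ρ > 0`, with orbit points that are integers (other than the
initial point) counted as lying below the integer. -/
noncomputable def lowerStair (ρ : ℝ) (j : ℕ) : ℤ :=
  if j = 0 then -1 else if j = 1 then 0 else ⌈ρ * (j - 1)⌉ - 1

theorem upperStair_zero (ρ : ℝ) : upperStair ρ 0 = -1 := rfl

theorem upperStair_succ (ρ : ℝ) (j : ℕ) : upperStair ρ (j + 1) = ⌊ρ * j⌋ := by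
  simp [upperStair]

theorem lowerStair_zero (ρ : ℝ) : lowerStair ρ 0 = -1 := rfl

theorem lowerStair_one (ρ : ℝ) : lowerStair ρ 1 = 0 := rfl

theorem lowerStair_add_two (ρ : ℝ) (j : ℕ) :
    lowerStair ρ (j + 2) = ⌈ρ * ((j : ℝ) + 1)⌉ - 1 := by
  have : ((j + 2 : ℕ) : ℝ) - 1 = (j : ℝ) + 1 := by push_cast; ring
  simp only [lowerStair, this]
  simp

theorem isStaircase_upperStair {ρ : ℝ} (h0 : 0 ≤ ρ) (h1 : ρ ≤ 1 / 2) :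
    IsStaircase (upperStair ρ) where
  zero := rfl
  one := by simp [upperStair]
  mono j := by
    rcases j with _ | j
    · simp [upperStair]
    · rw [upperStair_succ, upperStair_succ]
      apply Int.floor_le_floor
      push_cast
      nlinarith
  le_add j := by
    rcases j with _ | j
    · rw [upperStair_succ, upperStair_zero]
      have : ⌊ρ * ((1 : ℕ) : ℝ)⌋ < 1 := Int.floor_lt.2 (by push_cast; linarith)
      omega
    · rw [upperStair_succ, upperStair_succ, ← Int.floor_add_one]
      apply Int.floor_le_floor
      push_cast
      nlinarith

theorem isStaircase_lowerStair {ρ : ℝ} (h0 : 0 < ρ) (h1 : ρ ≤ 1 / 2) :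
    IsStaircase (lowerStair ρ) where
  zero := rfl
  one := rfl
  mono j := by
    rcases j with _ | _ | j
    · simp [lowerStair]
    · rw [lowerStair_one, lowerStair_add_two]
      have : 0 < ⌈ρ * (((0 : ℕ) : ℝ) + 1)⌉ := Int.ceil_pos.2 (by simpa using h0)
      omega
    · rw [lowerStair_add_two, lowerStair_add_two]
      have : ⌈ρ * ((j : ℝ) + 1)⌉ ≤ ⌈ρ * (((j + 1 : ℕ) : ℝ) + 1)⌉ := by
        apply Int.ceil_le_ceil
        push_cast
        nlinarith
      omega
  le_add j := by
    rcases j with _ | _ | j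
    · rw [lowerStair_zero, lowerStair_add_two]
      have : ⌈ρ * (((0 : ℕ) : ℝ) + 1)⌉ ≤ 1 := Int.ceil_le.2 (by push_cast; linarith)
      omega
    · rw [lowerStair_one, lowerStair_add_two]
      have : ⌈ρ * (((1 : ℕ) : ℝ) + 1)⌉ ≤ 1 := Int.ceil_le.2 (by push_cast; linarith)
      omega
    · rw [lowerStair_add_two, lowerStair_add_two]
      have : ⌈ρ * (((j + 2 : ℕ) : ℝ) + 1)⌉ ≤ ⌈ρ * ((j : ℝ) + 1)⌉ + 1 := by
        rw [← Int.ceil_add_one]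
        apply Int.ceil_le_ceil
        push_cast
        nlinarith
      omega

theorem upperStair_le_lowerStair {ρ p : ℝ} (h : ρ < p) (j : ℕ) :
    upperStair ρ j ≤ lowerStair p j := by
  rcases j with _ | _ | j
  · simp [upperStair, lowerStair]
  · simp [upperStair, lowerStair]
  · rw [upperStair_succ, lowerStair_add_two]
    have h1 : ((⌊ρ * ((j + 1 : ℕ) : ℝ)⌋ : ℤ) : ℝ) ≤ ρ * ((j + 1 : ℕ) : ℝ) := Int.floor_le _
    have : ⌊ρ * ((j + 1 : ℕ) : ℝ)⌋ < ⌈p * ((j : ℝ) + 1)⌉ := by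
      rw [Int.lt_ceil]
      refine h1.trans_lt ?_
      push_cast
      exact mul_lt_mul_of_pos_right h (by positivity)
    omega

/-! ### The words `c_q` -/

theorem le_lowerStair {ρ : ℝ} {j : ℕ} {i : ℤ} (hj : 2 ≤ j) (h : (i : ℝ) < ρ * (j - 1)) :
    i ≤ lowerStair ρ j := by
  obtain ⟨k, rfl⟩ := Nat.exists_eq_add_of_le' hj
  rw [lowerStair_add_two]
  have : i < ⌈ρ * ((k : ℝ) + 1)⌉ := Int.lt_ceil.2 (by push_cast at h; linarith)
  omega

theorem lowerStair_lt {ρ : ℝ} {j : ℕ} {i : ℤ} (hj : 2 ≤ j) (h : ρ * (j - 1) ≤ i) :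
    lowerStair ρ j < i := by
  obtain ⟨k, rfl⟩ := Nat.exists_eq_add_of_le' hj
  rw [lowerStair_add_two]
  have : ⌈ρ * ((k : ℝ) + 1)⌉ ≤ i := Int.ceil_le.2 (by push_cast at h; linarith)
  omega

theorem code_lowerStair_eq_zero {ρ : ℝ} (h0 : 0 < ρ) (h1 : ρ ≤ 1 / 2) {j : ℕ} {i : ℤ}
    (hj : (i : ℝ) < ρ * (j - 1) ∧ 2 ≤ j ∨ i = 0 ∧ j = 1) (hj' : ρ * (j + 1) ≤ i + 1) :
    code (lowerStair ρ) j = 0 := by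
  have hs := isStaircase_lowerStair h0 h1
  have m1 := hs.mono j
  have m2 : lowerStair ρ (j + 1) ≤ lowerStair ρ (j + 2) := hs.mono (j + 1)
  have h2 : lowerStair ρ (j + 2) < i + 1 := by
    apply lowerStair_lt (by omega)
    push_cast
    linarith
  have h3 : i ≤ lowerStair ρ j := by
    rcases hj with ⟨hj, hj2⟩ | ⟨rfl, rfl⟩
    · exact le_lowerStair hj2 hj
    · rw [lowerStair_one]
  rw [code, if_pos (by omega)]

theorem code_lowerStair_eq_one {ρ : ℝ} {j : ℕ} {i : ℤ}
    (hj : 2 ≤ j) (h1 : ρ * (j - 1) ≤ i) (h2 : (i : ℝ) < ρ * (j + 1)) :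
    code (lowerStair ρ) j = 1 := by
  have h3 := lowerStair_lt hj h1
  have h4 : i ≤ lowerStair ρ (j + 2) := by
    apply le_lowerStair (by omega)
    push_cast
    linarith
  rw [code, if_neg (by omega)]

theorem code_lowerStair_zero {ρ : ℝ} (h0 : 0 < ρ) (h1 : ρ ≤ 1 / 2) :
    code (lowerStair ρ) 0 = 1 := by
  have hs := isStaircase_lowerStair h0 h1
  have := hs.mono 1
  rw [code, if_neg]
  rw [hs.zero]
  rw [hs.one] at this
  change 0 ≤ lowerStair ρ (0 + 2) at this
  omega

theorem List.intercalate_concat {α : Type*} (s x : List α) {l : List (List α)} (hl : l ≠ []) :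
    List.intercalate s (l ++ [x]) = List.intercalate s l ++ s ++ x := by
  induction l with
  | nil => exact absurd rfl hl
  | cons a l ih =>
    cases l with
    | nil => simp
    | cons b l =>
      rw [List.cons_append, List.cons_append, List.intercalate_cons_cons,
        List.intercalate_cons_cons, ← List.cons_append, ih (by simp)]
      simp

theorem List.map_range_add {α : Type*} (s : ℕ → α) (a b : ℕ) :
    (List.range (a + b)).map s
      = (List.range a).map s ++ (List.range b).map fun j => s (a + j) := by
  rw [List.range_add, List.map_append, List.map_map]
  rfl

theorem List.replicate_eq_map_range {α : Type*} (s : ℕ → α) (x : α) {b : ℕ}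
    (h : ∀ j < b, s j = x) : List.replicate b x = (List.range b).map s := by
  symm
  rw [List.eq_replicate_iff]
  refine ⟨by simp, fun y hy => ?_⟩
  obtain ⟨j, hj, rfl⟩ := List.mem_map.1 hy
  exact h j (List.mem_range.1 hj)

section Words

variable {q : ℚ}

/-- The integer part of `i / q`, the last abscissa at which the line `y = q x` has height at most
`i`. -/
def lastAbscissa (q : ℚ) (i : ℕ) : ℕ := ⌊(i : ℚ) / q⌋.toNat

theorem cast_lastAbscissa (h0 : 0 < q) (i : ℕ) : (lastAbscissa q i : ℤ) = ⌊(i : ℚ) / q⌋ :=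
  Int.toNat_of_nonneg (Int.floor_nonneg.2 (by positivity))

theorem mul_lastAbscissa_le (h0 : 0 < q) (i : ℕ) : (q : ℝ) * lastAbscissa q i ≤ i := by
  have h : ((lastAbscissa q i : ℤ) : ℚ) ≤ i / q := by
    rw [cast_lastAbscissa h0]; exact Int.floor_le _
  rw [le_div_iff₀ h0] at h
  have h2 : (q : ℚ) * lastAbscissa q i ≤ i := by push_cast at h; linarith
  exact_mod_cast h2

theorem lt_mul_lastAbscissa (h0 : 0 < q) (i : ℕ) : (i : ℝ) < q * (lastAbscissa q i + 1) := by
  have h : (i : ℚ) / q < (lastAbscissa q i : ℤ) + 1 := by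
    rw [cast_lastAbscissa h0]; exact Int.lt_floor_add_one _
  rw [div_lt_iff₀ h0] at h
  have h2 : (i : ℚ) < q * (lastAbscissa q i + 1) := by push_cast at h; linarith
  exact_mod_cast h2

theorem lastAbscissa_add_two_le (h0 : 0 < q) (h1 : q ≤ 1 / 2) (i : ℕ) :
    lastAbscissa q i + 2 ≤ lastAbscissa q (i + 1) := by
  have h : ⌊(i : ℚ) / q⌋ + 2 ≤ ⌊((i + 1 : ℕ) : ℚ) / q⌋ := by
    rw [Int.le_floor]
    have h2 : (2 : ℚ) ≤ 1 / q := by rw [le_div_iff₀ h0]; linarith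
    have h3 : (⌊(i : ℚ) / q⌋ : ℚ) ≤ i / q := Int.floor_le _
    push_cast
    rw [add_div]
    linarith
  rw [← cast_lastAbscissa h0, ← cast_lastAbscissa h0] at h
  omega

/-- The line `y = q x` passes through no lattice point of height strictly between `0` and `m`. -/
theorem ceil_div_eq_floor_add_one (h0 : 0 < q) {i : ℕ} (hi : 0 < i) (him : i < q.num.toNat) :
    ⌈(i : ℚ) / q⌉ = ⌊(i : ℚ) / q⌋ + 1 := by
  have hne : ¬ ∃ k : ℤ, (k : ℚ) = i / q := by
    rintro ⟨k, hk⟩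
    rw [eq_div_iff h0.ne', ← Rat.num_div_den q] at hk
    have hd : (q.den : ℚ) ≠ 0 := by exact_mod_cast q.den_nz
    rw [mul_div_assoc', div_eq_iff hd] at hk
    have hk' : k * q.num = i * q.den := by exact_mod_cast hk
    have hdvd : q.num ∣ (i : ℤ) := by
      have hc : IsCoprime q.num (q.den : ℤ) := by
        rw [Int.isCoprime_iff_nat_coprime]
        simpa using q.reduced
      exact hc.dvd_of_dvd_mul_right ⟨k, by rw [← hk']; ring⟩
    have := Int.le_of_dvd (by omega) hdvd
    omega
  apply le_antisymm
  · exact Int.ceil_le_floor_add_one _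
  · rw [Int.add_one_le_iff, Int.lt_ceil]
    refine lt_of_le_of_ne (Int.floor_le _) fun h => hne ⟨_, h⟩

theorem kappaInt_one (h0 : 0 < q) (h1 : q ≤ 1 / 2) : 1 + kappaInt q 1 = lastAbscissa q 1 := by
  have h2 := lastAbscissa_add_two_le h0 h1 0
  have h3 := cast_lastAbscissa h0 1
  push_cast at h3
  simp only [zero_add] at h2
  simp only [kappaInt, Int.card_Icc, Nat.cast_one, sub_self, zero_div, Int.ceil_zero, ← h3]
  omega

theorem kappaInt_succ (h0 : 0 < q) (h1 : q ≤ 1 / 2) {i : ℕ} (hi : 0 < i)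
    (him : i < q.num.toNat) :
    lastAbscissa q i + (2 + kappaInt q (i + 1)) = lastAbscissa q (i + 1) := by
  have h2 := lastAbscissa_add_two_le h0 h1 i
  have h3 := cast_lastAbscissa h0 (i + 1)
  have h4 := cast_lastAbscissa h0 i
  have h5 := ceil_div_eq_floor_add_one h0 hi him
  simp only [kappaInt, Int.card_Icc]
  have : ((i + 1 : ℕ) : ℚ) - 1 = i := by push_cast; ring
  rw [this, h5]
  omega

theorem cast_pos_half (h0 : 0 < q) (h1 : q ≤ 1 / 2) : (0 : ℝ) < q ∧ (q : ℝ) ≤ 1 / 2 := by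
  refine ⟨by exact_mod_cast h0, ?_⟩
  have : ((q : ℚ) : ℝ) ≤ ((1 / 2 : ℚ) : ℝ) := by exact_mod_cast h1
  simpa using this

/-- The part of `c_q` preceding the `i`-th pair `11` codes the rotation by `q` up to the last
abscissa before the line `y = q x` reaches the height `i`. -/
theorem cWord_prefix (h0 : 0 < q) (h1 : q ≤ 1 / 2) (i : ℕ) (hi : i < q.num.toNat) :
    [1] ++ List.intercalate [1, 1]
      ((List.range (i + 1)).map fun i => List.replicate (kappaInt q (i + 1)) (0 : Fin 2))
      = (List.range (lastAbscissa q (i + 1))).map (code (lowerStair q)) := by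
  obtain ⟨hr0, hr1⟩ := cast_pos_half h0 h1
  induction i with
  | zero =>
    rw [zero_add, ← kappaInt_one h0 h1, List.map_range_add]
    have hone := code_lowerStair_zero hr0 hr1
    have hle := mul_lastAbscissa_le h0 1
    rw [← kappaInt_one h0 h1] at hle
    push_cast at hle
    congr 1
    · simp [hone]
    · simp only [zero_add, List.range_one, List.map_singleton, List.intercalate_singleton]
      apply List.replicate_eq_map_range
      intro j hj
      apply code_lowerStair_eq_zero hr0 hr1 (i := 0)
      · rcases j with _ | j
        · right; simp
        · left
          refine ⟨?_, by omega⟩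
          push_cast
          have : (0 : ℝ) ≤ j := by positivity
          nlinarith
      · have : ((j : ℝ) + 1) ≤ kappaInt q 1 := by exact_mod_cast hj
        push_cast
        nlinarith
  | succ i ih =>
    have hk := kappaInt_succ h0 h1 (i := i + 1) (by omega) hi
    rw [List.range_succ, List.map_append, List.map_singleton,
      List.intercalate_concat _ _ (by simp), ← List.append_assoc, ← List.append_assoc,
      ih (by omega), ← hk, List.map_range_add, List.map_range_add, ← List.append_assoc]
    have hlt := lt_mul_lastAbscissa h0 (i + 1)
    have hle := mul_lastAbscissa_le h0 (i + 1)
    have hle' := mul_lastAbscissa_le h0 (i + 1 + 1)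
    have h2 := lastAbscissa_add_two_le h0 h1 i
    rw [← hk] at hle'
    push_cast at hlt hle hle'
    congr 1
    · congr 1
      have ha : code (lowerStair q) (lastAbscissa q (i + 1)) = 1 := by
        apply code_lowerStair_eq_one (i := i + 1) (by omega)
        · push_cast
          nlinarith
        · push_cast
          linarith
      have hb : code (lowerStair q) (lastAbscissa q (i + 1) + 1) = 1 := by
        apply code_lowerStair_eq_one (i := i + 1) (by omega)
        · push_cast
          nlinarith
        · push_cast
          nlinarith
      simp [List.range_succ, ha, hb]
    · apply List.replicate_eq_map_range
      intro j hj
      apply code_lowerStair_eq_zero hr0 hr1 (i := i + 1)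
      · left
        refine ⟨?_, by omega⟩
        push_cast
        have : (0 : ℝ) ≤ j := by positivity
        nlinarith
      · have : ((j : ℝ) + 1) ≤ kappaInt q (i + 1 + 1) := by exact_mod_cast hj
        push_cast
        nlinarith

theorem num_eq_mul_den (q : ℚ) : (q.num : ℝ) = q * q.den := by
  have : (q.num : ℚ) = q * q.den := (Rat.mul_den_eq_num q).symm
  exact_mod_cast this

theorem lastAbscissa_num (h0 : 0 < q) : lastAbscissa q q.num.toNat = q.den := by
  have hnum : 0 < q.num := Rat.num_pos.2 h0
  have h := cast_lastAbscissa h0 q.num.toNat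
  have h2 : ((q.num.toNat : ℕ) : ℚ) / q = q.den := by
    have h3 : ((q.num.toNat : ℕ) : ℚ) = (q.num : ℚ) := by
      have : ((q.num.toNat : ℕ) : ℤ) = q.num := Int.toNat_of_nonneg hnum.le
      exact_mod_cast this
    rw [h3, div_eq_iff h0.ne', mul_comm]
    exact (Rat.mul_den_eq_num q).symm
  rw [h2] at h
  simp at h
  omega

/-- The word `c_q` is the initial segment of length `n + 1` of the sequence coded by the lower
staircase of the rotation by `q = m / n`. -/
theorem cWord_eq (h0 : 0 < q) (h1 : q ≤ 1 / 2) :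
    cWord q = (List.range (q.den + 1)).map (code (lowerStair q)) := by
  obtain ⟨hr0, hr1⟩ := cast_pos_half h0 h1
  have hnum : 0 < q.num := Rat.num_pos.2 h0
  obtain ⟨i, hi⟩ : ∃ i, q.num.toNat = i + 1 := ⟨q.num.toNat - 1, by omega⟩
  have h := cWord_prefix h0 h1 i (by omega)
  rw [← hi, lastAbscissa_num h0] at h
  rw [cWord, h, List.range_succ, List.map_append, List.map_singleton]
  congr 2
  symm
  have hmn := num_eq_mul_den q
  have hd : 2 ≤ q.den := by
    have := lastAbscissa_add_two_le h0 h1 i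
    rw [← hi, lastAbscissa_num h0] at this
    omega
  apply code_lowerStair_eq_one (i := q.num) hd <;> nlinarith

end Words

/-! ### The endpoint sequences `lhe` and `rhe` -/

section Endpoints

variable {q : ℚ}

theorem den_dvd_of_mul_eq_int {j : ℕ} {k : ℤ} (h : (q : ℝ) * j = k) : q.den ∣ j := by
  have h2 : (j : ℝ) * q.num = k * q.den := by rw [num_eq_mul_den, ← h]; ring
  have h3 : (j : ℤ) * q.num = k * q.den := by exact_mod_cast h2
  have hc : IsCoprime (q.den : ℤ) q.num := by
    rw [Int.isCoprime_iff_nat_coprime]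
    simpa using q.reduced.symm
  have : (q.den : ℤ) ∣ j := hc.dvd_of_dvd_mul_right ⟨k, by rw [h3]; ring⟩
  exact_mod_cast this

/-- The two staircases of a rational rotation differ only at lattice points of the line `y = q x`. -/
theorem upperStair_eq_lowerStair {j : ℕ} (hj : ¬ q.den ∣ j) :
    upperStair q (j + 1) = lowerStair q (j + 1) := by
  rcases j with _ | j
  · simp at hj
  rw [upperStair_succ, lowerStair_add_two]
  have hne : ∀ k : ℤ, (q : ℝ) * ((j + 1 : ℕ) : ℝ) ≠ k := fun k hk =>
    hj (den_dvd_of_mul_eq_int hk)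
  have hlt := lt_of_le_of_ne (Int.floor_le ((q : ℝ) * ((j + 1 : ℕ) : ℝ))) (hne _).symm
  have h1 := Int.lt_ceil.2 hlt
  have h2 := Int.ceil_le_floor_add_one ((q : ℝ) * ((j + 1 : ℕ) : ℝ))
  have h3 : (j : ℝ) + 1 = ((j + 1 : ℕ) : ℝ) := by push_cast; ring
  rw [h3]
  omega

theorem three_le_den (h0 : 0 < q) (h1 : q < 1 / 2) : 3 ≤ q.den := by
  have hnum : 0 < q.num := Rat.num_pos.2 h0
  have h : (q.num : ℚ) = q * q.den := (Rat.mul_den_eq_num q).symm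
  have h2 : (1 : ℚ) ≤ q.num := by exact_mod_cast hnum
  have h3 : (2 : ℚ) < q.den := by
    have : (0 : ℚ) < q.den := by exact_mod_cast q.den_pos
    nlinarith
  exact_mod_cast h3

theorem cast_lt_half (h1 : q < 1 / 2) : (q : ℝ) < 1 / 2 := by
  have : ((q : ℚ) : ℝ) < ((1 / 2 : ℚ) : ℝ) := by exact_mod_cast h1
  simpa using this

theorem upperStair_add_den (j : ℕ) :
    upperStair q (j + 1 + q.den) = upperStair q (j + 1) + q.num := by
  rw [show j + 1 + q.den = (j + q.den) + 1 by ring, upperStair_succ, upperStair_succ,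
    ← Int.floor_add_intCast, num_eq_mul_den]
  congr 1
  push_cast
  ring

theorem lowerStair_add_den (j : ℕ) :
    lowerStair q (j + 2 + q.den) = lowerStair q (j + 2) + q.num := by
  have h : ⌈(q : ℝ) * (((j + q.den : ℕ) : ℝ) + 1)⌉ = ⌈(q : ℝ) * ((j : ℝ) + 1)⌉ + q.num := by
    rw [← Int.ceil_add_intCast, num_eq_mul_den]
    congr 1
    push_cast
    ring
  rw [show j + 2 + q.den = (j + q.den) + 2 by ring, lowerStair_add_two, lowerStair_add_two, h]
  ring

theorem upperStair_den_add_one : upperStair q (q.den + 1) = q.num := by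
  rw [upperStair_succ, ← num_eq_mul_den, Int.floor_intCast]

theorem lowerStair_den_add_one : lowerStair q (q.den + 1) = q.num - 1 := by
  obtain ⟨d, hd⟩ : ∃ d, q.den = d + 1 := ⟨q.den - 1, by have := q.den_pos; omega⟩
  have h : (q : ℝ) * ((d : ℝ) + 1) = q.num := by
    rw [num_eq_mul_den, hd]; push_cast; ring
  rw [hd, lowerStair_add_two, h, Int.ceil_intCast]

theorem lowerStair_den (h0 : 0 < q) (h1 : q < 1 / 2) : lowerStair q q.den = q.num - 1 := by
  have hr0 : (0 : ℝ) < q := by exact_mod_cast h0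
  have hr1 := cast_lt_half h1
  have hd := three_le_den h0 h1
  have hmn := num_eq_mul_den q
  have h2 : lowerStair q q.den < q.num := lowerStair_lt (by omega) (by nlinarith)
  have h3 : q.num - 1 ≤ lowerStair q q.den :=
    le_lowerStair (by omega) (by push_cast; nlinarith)
  omega

theorem lowerStair_den_add_two (h0 : 0 < q) (h1 : q < 1 / 2) :
    lowerStair q (q.den + 2) = q.num := by
  have hr0 : (0 : ℝ) < q := by exact_mod_cast h0
  have hr1 := cast_lt_half h1
  have hd := three_le_den h0 h1
  have hmn := num_eq_mul_den q
  have h2 : lowerStair q (q.den + 2) < q.num + 1 :=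
    lowerStair_lt (by omega) (by push_cast; nlinarith)
  have h3 : q.num ≤ lowerStair q (q.den + 2) := le_lowerStair (by omega) (by push_cast; nlinarith)
  omega

theorem code_upperStair_eq_lowerStair {j : ℕ} (h : j + 2 ≤ q.den) :
    code (upperStair q) j = code (lowerStair q) j := by
  have e1 : upperStair q (j + 2) = lowerStair q (j + 2) :=
    upperStair_eq_lowerStair fun hd => by have := Nat.le_of_dvd (by omega) hd; omega
  have e2 : upperStair q j = lowerStair q j := by
    rcases j with _ | _ | j
    · rfl
    · simp [upperStair, lowerStair]
    · exact upperStair_eq_lowerStair fun hd => by have := Nat.le_of_dvd (by omega) hd; omega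
  rw [code, code, e1, e2]

theorem code_upperStair_den_sub_one (h0 : 0 < q) (h1 : q < 1 / 2) {d : ℕ} (hd : q.den = d + 1) :
    code (upperStair q) d = 1 := by
  have h3 := three_le_den h0 h1
  have h2 := upperStair_den_add_one (q := q)
  have hmn := num_eq_mul_den q
  have hr0 : (0 : ℝ) < q := by exact_mod_cast h0
  rw [code, if_neg]
  rw [show d + 2 = q.den + 1 by omega, h2, show d = (d - 1) + 1 by omega, upperStair_succ]
  have : ⌊(q : ℝ) * ((d - 1 : ℕ) : ℝ)⌋ < q.num := by
    rw [Int.floor_lt, hmn]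
    have : ((d - 1 : ℕ) : ℝ) < q.den := by exact_mod_cast (by omega : d - 1 < q.den)
    nlinarith
  omega

theorem code_lowerStair_den_sub_one (h0 : 0 < q) (h1 : q < 1 / 2) {d : ℕ} (hd : q.den = d + 1) :
    code (lowerStair q) d = 0 := by
  have h3 := three_le_den h0 h1
  have hr := cast_pos_half h0 h1.le
  have hmn := num_eq_mul_den q
  have hr1 := cast_lt_half h1
  have hd' : (q.den : ℝ) = d + 1 := by exact_mod_cast hd
  rw [hd'] at hmn
  apply code_lowerStair_eq_zero hr.1 hr.2 (i := q.num - 1)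
  · left
    refine ⟨?_, by omega⟩
    push_cast
    nlinarith
  · push_cast
    nlinarith

theorem code_lowerStair_den (h0 : 0 < q) (h1 : q < 1 / 2) : code (lowerStair q) q.den = 1 := by
  rw [code, if_neg]
  rw [lowerStair_den h0 h1, lowerStair_den_add_two h0 h1]
  omega

theorem code_lowerStair_den_add_one (h0 : 0 < q) (h1 : q < 1 / 2) :
    code (lowerStair q) (q.den + 1) = 1 := by
  have hs := isStaircase_lowerStair (cast_pos_half h0 h1.le).1 (cast_pos_half h0 h1.le).2
  have h2 : lowerStair q (q.den + 2) ≤ lowerStair q (q.den + 1 + 2) := hs.mono (q.den + 2)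
  rw [lowerStair_den_add_two h0 h1] at h2
  rw [code, if_neg]
  rw [lowerStair_den_add_one]
  omega

theorem code_lowerStair_one (h0 : 0 < q) (h1 : q ≤ 1 / 2) : code (lowerStair q) 1 = 0 := by
  have hr := cast_pos_half h0 h1
  apply code_lowerStair_eq_zero hr.1 hr.2 (i := 0)
  · right; simp
  · push_cast; linarith [hr.2]

theorem code_upperStair_zero (h0 : 0 ≤ q) (h1 : q < 1 / 2) : code (upperStair q) 0 = 1 := by
  have hs := isStaircase_upperStair (ρ := (q : ℝ)) (by exact_mod_cast h0) (cast_lt_half h1).le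
  have := hs.mono 1
  rw [code, if_neg]
  rw [hs.zero]
  rw [hs.one] at this
  change 0 ≤ upperStair q (0 + 2) at this
  omega

theorem periodic_code_upperStair (h0 : 0 < q) (h1 : q < 1 / 2) :
    Periodic (code (upperStair q)) q.den := by
  intro j
  rcases j with _ | j
  · rw [code_upperStair_zero h0.le h1, zero_add]
    have h2 := upperStair_add_den (q := q) 1
    have h3 : upperStair q q.den = lowerStair q q.den := by
      have hd := three_le_den h0 h1
      obtain ⟨d, hd'⟩ : ∃ d, q.den = d + 1 := ⟨q.den - 1, by omega⟩
      rw [hd']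
      exact upperStair_eq_lowerStair fun h => by have := Nat.le_of_dvd (by omega) h; omega
    have hs := isStaircase_upperStair (ρ := (q : ℝ)) (by exact_mod_cast h0.le)
      (cast_lt_half h1).le
    have h4 := hs.mono 1
    rw [hs.one] at h4
    rw [code, if_neg]
    rw [show q.den + 2 = 1 + 1 + q.den by ring, h2, h3, lowerStair_den h0 h1]
    omega
  · rw [code, code, show j + 1 + q.den + 2 = (j + 2) + 1 + q.den by ring, upperStair_add_den,
      upperStair_add_den]
    simp

theorem code_lowerStair_add_den {j : ℕ} (hj : 2 ≤ j) :
    code (lowerStair q) (j + q.den) = code (lowerStair q) j := by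
  obtain ⟨k, rfl⟩ := Nat.exists_eq_add_of_le' hj
  rw [code, code, show k + 2 + q.den + 2 = (k + 2) + 2 + q.den by ring, lowerStair_add_den,
    lowerStair_add_den]
  simp

/-- The symmetry of the line `y = q x` under the half-turn about its midpoint between two
consecutive lattice points. -/
theorem code_lowerStair_reflect (h0 : 0 < q) (h1 : q < 1 / 2) {i j : ℕ} (hj : 2 ≤ j)
    (hij : i + j = q.den) : code (lowerStair q) j = code (upperStair q) i := by
  rcases i with _ | i
  · rw [code_upperStair_zero h0.le h1, show j = q.den by omega, code_lowerStair_den h0 h1]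
  · obtain ⟨k, rfl⟩ := Nat.exists_eq_add_of_le' hj
    have hmn := num_eq_mul_den q
    rw [← hij] at hmn
    push_cast at hmn
    have hf : ∀ x y : ℝ, x = (q.num : ℝ) - y → ⌈x⌉ = q.num - ⌊y⌋ := fun x y h => by
      rw [h, sub_eq_add_neg, Int.ceil_intCast_add, Int.ceil_neg]
      ring
    have e1 : ⌈(q : ℝ) * (((k + 2 : ℕ) : ℝ) + 1)⌉ = q.num - ⌊(q : ℝ) * (i : ℝ)⌋ :=
      hf _ _ (by push_cast; linarith)
    have e2 : ⌈(q : ℝ) * ((k : ℝ) + 1)⌉ = q.num - ⌊(q : ℝ) * ((i + 2 : ℕ) : ℝ)⌋ :=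
      hf _ _ (by push_cast; linarith)
    rw [code, code, lowerStair_add_two, lowerStair_add_two, upperStair_succ,
      upperStair_succ, e1, e2]
    congr 1
    apply propext
    omega

theorem BinSeq.rep_eq_of_periodic {s : BinSeq} {n : ℕ} (hn : 0 < n) (hs : Periodic s n) :
    BinSeq.rep ((List.range n).map s) = s := by
  funext i
  have hi : i % n < n := Nat.mod_lt _ hn
  rw [BinSeq.rep, List.length_map, List.length_range,
    List.getD_eq_getElem _ _ (by simpa using hi)]
  simpa using hs.map_mod_nat i

theorem wWord_eq (h0 : 0 < q) (h1 : q ≤ 1 / 2) {d : ℕ} (hd : q.den = d + 1) :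
    wWord q = (List.range d).map (code (lowerStair q)) := by
  rw [wWord, cWord_eq h0 h1, hd, List.range_succ, List.map_append, List.map_singleton,
    List.dropLast_concat, List.range_succ, List.map_append, List.map_singleton,
    List.dropLast_concat]

theorem lhe_eq (h0 : 0 ≤ q) (h1 : q < 1 / 2) : lhe q = code (upperStair q) := by
  rcases h0.eq_or_lt with rfl | h0
  · rw [lhe, if_pos rfl]
    funext j
    rcases j with _ | j
    · rw [code_upperStair_zero le_rfl h1]
      rfl
    · have h2 : upperStair ((0 : ℚ) : ℝ) (j + 1 + 2) = upperStair ((0 : ℚ) : ℝ) (j + 1) := by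
        rw [show j + 1 + 2 = (j + 2) + 1 by ring, upperStair_succ, upperStair_succ]
        simp
      rw [code, if_pos h2]
      simp [BinSeq.prepend, BinSeq.rep, Nat.mod_one]
  · have hd := three_le_den h0 h1
    obtain ⟨d, hd'⟩ : ∃ d, q.den = d + 1 := ⟨q.den - 1, by omega⟩
    rw [lhe, if_neg h0.ne', wWord_eq h0 h1.le hd', ← BinSeq.rep_eq_of_periodic q.den_pos
      (periodic_code_upperStair h0 h1), hd', List.range_succ, List.map_append, List.map_singleton,
      code_upperStair_den_sub_one h0 h1 hd']
    congr 2
    apply List.map_congr_left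
    intro j hj
    rw [List.mem_range] at hj
    exact (code_upperStair_eq_lowerStair (by omega)).symm

/-- From place `2` on, each period of the code of the lower staircase is a period of that of the upper
one read backwards, which accounts for the reversed word in `rhe(q)`. -/
theorem rhe_eq (h0 : 0 < q) (h1 : q < 1 / 2) : rhe q = code (lowerStair q) := by
  have hd := three_le_den h0 h1
  obtain ⟨d, hd'⟩ : ∃ d, q.den = d + 1 := ⟨q.den - 1, by omega⟩
  have hword : (wWord q).reverse ++ [1]
      = (List.range q.den).map fun j => code (lowerStair q) (j + 2) := by
    rw [wWord_eq h0 h1.le hd', hd', List.range_succ, List.map_append, List.map_singleton]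
    congr 1
    · apply List.ext_getElem
      · simp
      · intro i hi1 hi2
        simp only [List.length_reverse, List.length_map, List.length_range] at hi1
        simp only [List.getElem_reverse, List.getElem_map, List.getElem_range, List.length_map,
          List.length_range]
        rw [code_lowerStair_reflect h0 h1 (i := d - 1 - i) (j := i + 2) (by omega) (by omega)]
        exact (code_upperStair_eq_lowerStair (by omega)).symm
    · rw [show d + 2 = q.den + 1 by omega, code_lowerStair_den_add_one h0 h1]
  rw [rhe, hword, BinSeq.rep_eq_of_periodic q.den_pos fun j => ?_]
  · funext j
    rcases j with _ | _ | j
    · simp [BinSeq.prepend, code_lowerStair_zero (cast_pos_half h0 h1.le).1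
        (cast_pos_half h0 h1.le).2]
    · simp [BinSeq.prepend, code_lowerStair_one h0 h1.le]
    · simp [BinSeq.prepend]
  · have := code_lowerStair_add_den (q := q) (j := j + 2) (by omega)
    rw [← this]
    congr 1
    ring

theorem length_cWord_append (h0 : 0 < q) (h1 : q ≤ 1 / 2) :
    (cWord q ++ [(0 : Fin 2)]).length = q.den + 2 := by
  rw [cWord_eq h0 h1]; simp

theorem rep_cWord_append_of_le (h0 : 0 < q) (h1 : q ≤ 1 / 2) {j : ℕ} (hj : j ≤ q.den) :
    BinSeq.rep (cWord q ++ [0]) j = code (lowerStair q) j := by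
  rw [BinSeq.rep, length_cWord_append h0 h1, Nat.mod_eq_of_lt (by omega), cWord_eq h0 h1,
    List.getD_append _ _ _ _ (by simp; omega), List.getD_eq_getElem _ _ (by simp; omega)]
  simp

theorem rep_cWord_append_den_add_one (h0 : 0 < q) (h1 : q ≤ 1 / 2) :
    BinSeq.rep (cWord q ++ [0]) (q.den + 1) = 0 := by
  rw [BinSeq.rep, length_cWord_append h0 h1, Nat.mod_eq_of_lt (by omega), cWord_eq h0 h1,
    List.getD_append_right _ _ _ _ (by simp)]
  simp

/-- The sequences `c_q0 c_q0 ⋯` and `rhe(q)` first differ at the symbol `0` following `c_q`. -/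
theorem rep_cWord_lt_lowerStair (h0 : 0 < q) (h1 : q < 1 / 2) :
    BinSeq.Lt (BinSeq.rep (cWord q ++ [0])) (code (lowerStair q)) := by
  have hs := isStaircase_lowerStair (cast_pos_half h0 h1.le).1 (cast_pos_half h0 h1.le).2
  refine ⟨q.den + 1, fun j hj => rep_cWord_append_of_le h0 h1.le (by omega), ?_, ?_⟩
  · rw [rep_cWord_append_den_add_one h0 h1.le, code_lowerStair_den_add_one h0 h1]
    decide
  · rw [Finset.sum_range_succ, rep_cWord_append_den_add_one h0 h1.le,
      BinSeq.sum_congr_prefix fun j hj => rep_cWord_append_of_le h0 h1.le (by omega),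
      ← Int.even_coe_nat]
    have := hs.sum_code (q.den + 1)
    rw [lowerStair_den_add_one, show q.den + 1 + 1 = q.den + 2 by ring,
      lowerStair_den_add_two h0 h1] at this
    simp only [Fin.val_zero, add_zero]
    rw [this]
    exact ⟨q.num, by ring⟩

/-- The sequences `lhe(q)` and `c_q0 c_q0 ⋯` first differ at place `n - 1`, the first one
whose symbol depends on the staircase at a lattice point. -/
theorem upperStair_lt_rep_cWord (h0 : 0 < q) (h1 : q < 1 / 2) :
    BinSeq.Lt (code (upperStair q)) (BinSeq.rep (cWord q ++ [0])) := by
  have hs := isStaircase_upperStair (cast_pos_half h0 h1.le).1.le (cast_pos_half h0 h1.le).2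
  have hd := three_le_den h0 h1
  obtain ⟨d, hd'⟩ : ∃ d, q.den = d + 1 := ⟨q.den - 1, by omega⟩
  refine ⟨d, fun j hj => ?_, ?_, ?_⟩
  · rw [rep_cWord_append_of_le h0 h1.le (by omega)]
    exact code_upperStair_eq_lowerStair (by omega)
  · rw [rep_cWord_append_of_le h0 h1.le (by omega), code_lowerStair_den_sub_one h0 h1 hd',
      code_upperStair_den_sub_one h0 h1 hd']
    decide
  · have := hs.sum_code (d + 1)
    have h2 : upperStair q (d + 1) = q.num - 1 := by
      rw [upperStair_eq_lowerStair fun h => by have := Nat.le_of_dvd (by omega) h; omega, ← hd',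
        lowerStair_den h0 h1]
    rw [show d + 1 + 1 = q.den + 1 by omega, upperStair_den_add_one, h2] at this
    rw [← Int.even_coe_nat, this]
    exact ⟨q.num, by ring⟩

/-- The right endpoint sequence is not periodic: its symbol `0` at place `1` is never repeated at
the later places `1 + k n`. -/
theorem not_isPeriodic_rhe (h0 : 0 < q) (h1 : q < 1 / 2) : ¬ BinSeq.IsPeriodic (rhe q) := by
  rintro ⟨p, hp, hper⟩
  rw [rhe_eq h0 h1] at hper
  have hP : Periodic (code (lowerStair q)) p := fun j => congrFun hper j
  have h2 : ∀ k, code (lowerStair q) (q.den + 1 + k * q.den) = 1 := by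
    intro k
    induction k with
    | zero => simpa using code_lowerStair_den_add_one h0 h1
    | succ k ih =>
      rw [Nat.succ_mul, ← add_assoc, code_lowerStair_add_den (by have := q.den_pos; omega), ih]
  have h3 := h2 (p - 1)
  rw [show q.den + 1 + (p - 1) * q.den = 1 + q.den * p by
    obtain ⟨p', rfl⟩ : ∃ p', p = p' + 1 := ⟨p - 1, by omega⟩
    simp; ring] at h3
  have h4 := hP.nat_mul q.den 1
  simp only [Nat.cast_id] at h4
  rw [h3, code_lowerStair_one h0 h1.le] at h4
  exact absurd h4 (by decide)

end Endpoints

/-- The sequence `10(1)^∞` is coded by the lower staircase of the half-turn. -/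
theorem code_lowerStair_half :
    code (lowerStair (1 / 2)) = BinSeq.prepend [1, 0] (BinSeq.rep [1]) := by
  funext j
  have hh : (0 : ℝ) < 1 / 2 := by norm_num
  rcases j with _ | _ | j
  · rw [code_lowerStair_zero hh le_rfl]; rfl
  · rw [code_lowerStair_eq_zero hh le_rfl (i := 0) (by right; simp) (by norm_num)]; rfl
  · have h : ⌈(1 / 2 : ℝ) * (((j + 2 : ℕ) : ℝ) + 1)⌉ = ⌈(1 / 2 : ℝ) * ((j : ℝ) + 1)⌉ + 1 := by
      rw [← Int.ceil_add_one]
      congr 1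
      push_cast
      ring
    have : code (lowerStair (1 / 2)) (j + 2) = 1 := by
      rw [code, lowerStair_add_two, lowerStair_add_two, h, if_neg (by omega)]
    rw [this]
    simp [BinSeq.prepend, BinSeq.rep, Nat.mod_one]

/-! ### The lift of the outside map -/

namespace UnimodalMap

variable (f : UnimodalMap)

/-- The affine coordinate on `[a, b]`, with values in `[0, 1/2]`. -/
noncomputable def scale (x : ℝ) : ℝ := (x - f.a) / (2 * (f.b - f.a))

/-- The inverse of the affine coordinate on `[a, b]`. -/
noncomputable def unsc (u : ℝ) : ℝ := f.a + 2 * (f.b - f.a) * u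

/-- The unimodal map in the affine coordinate. -/
noncomputable def phi (u : ℝ) : ℝ := f.scale (f (f.unsc u))

/-- The coordinate of the turning point. -/
noncomputable def tc : ℝ := f.scale f.c

/-- The coordinate of the point `â_u` of the circle: the interval `γ` is `[g, 1]`. -/
noncomputable def g : ℝ := 1 - f.scale f.re

theorem two_mul_pos : 0 < 2 * (f.b - f.a) := by linarith [f.a_lt_b]

theorem unsc_scale (x : ℝ) : f.unsc (f.scale x) = x := f.unscale x

theorem scale_unsc (u : ℝ) : f.scale (f.unsc u) = u := by
  rw [scale, unsc, add_sub_cancel_left, mul_div_cancel_left₀ _ f.two_mul_pos.ne']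

theorem scale_strictMono : StrictMono f.scale := fun x y h => by
  have := f.two_mul_pos
  exact div_lt_div_of_pos_right (by linarith) this

theorem unsc_strictMono : StrictMono f.unsc := fun x y h => by
  have := mul_lt_mul_of_pos_left h f.two_mul_pos
  simp only [unsc]
  linarith

theorem scale_a : f.scale f.a = 0 := by simp [scale]

theorem scale_b : f.scale f.b = 1 / 2 := by
  rw [scale, div_eq_div_iff f.two_mul_pos.ne' two_ne_zero]
  ring

theorem unsc_zero : f.unsc 0 = f.a := by simp [unsc]

theorem unsc_half : f.unsc (1 / 2) = f.b := by rw [← f.scale_b, unsc_scale]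

theorem unsc_tc : f.unsc f.tc = f.c := f.unsc_scale _

theorem unsc_one_sub_g : f.unsc (1 - f.g) = f.re := by rw [g, sub_sub_cancel, unsc_scale]

theorem unsc_mem {u : ℝ} (hu : u ∈ Icc (0 : ℝ) (1 / 2)) : f.unsc u ∈ Icc f.a f.b := by
  rw [← f.unsc_zero, ← f.unsc_half]
  exact ⟨f.unsc_strictMono.monotone hu.1, f.unsc_strictMono.monotone hu.2⟩

theorem tc_pos : 0 < f.tc := by
  rw [← f.scale_a]; exact f.scale_strictMono f.a_lt_c

theorem tc_lt_half : f.tc < 1 / 2 := by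
  rw [← f.scale_b]; exact f.scale_strictMono f.c_lt_b

theorem half_le_g : 1 / 2 ≤ f.g := by
  have := f.scale_strictMono.monotone f.re_mem.2
  rw [scale_b] at this
  rw [g]
  linarith

theorem g_lt_one_sub_tc : f.g < 1 - f.tc := by
  have := f.scale_strictMono f.re_mem.1
  rw [g, tc]
  linarith

theorem g_lt_one : f.g < 1 := by linarith [f.g_lt_one_sub_tc, f.tc_pos]

theorem phi_mem {u : ℝ} (hu : u ∈ Icc (0 : ℝ) (1 / 2)) : f.phi u ∈ Icc (0 : ℝ) (1 / 2) := by
  have := f.mapsTo (f.unsc_mem hu)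
  rw [← f.scale_a, ← f.scale_b]
  exact ⟨f.scale_strictMono.monotone this.1, f.scale_strictMono.monotone this.2⟩

theorem phi_tc : f.phi f.tc = 1 / 2 := by rw [phi, unsc_tc, f.map_c, scale_b]

theorem phi_half : f.phi (1 / 2) = 0 := by rw [phi, unsc_half, f.map_b, scale_a]

theorem phi_one_sub_g : f.phi (1 - f.g) = f.phi 0 := by
  rw [phi, unsc_one_sub_g, f.map_re, phi, unsc_zero]

theorem phi_strictMonoOn : StrictMonoOn f.phi (Icc 0 f.tc) := by
  have hm : ∀ x ∈ Icc 0 f.tc, f.unsc x ∈ Icc f.a f.c := fun x hx => by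
    rw [← f.unsc_zero, ← f.unsc_tc]
    exact ⟨f.unsc_strictMono.monotone hx.1, f.unsc_strictMono.monotone hx.2⟩
  exact fun x hx y hy h =>
    f.scale_strictMono (f.strictMonoOn (hm x hx) (hm y hy) (f.unsc_strictMono h))

theorem phi_strictAntiOn : StrictAntiOn f.phi (Icc f.tc (1 / 2)) := by
  have hm : ∀ x ∈ Icc f.tc (1 / 2), f.unsc x ∈ Icc f.c f.b := fun x hx => by
    rw [← f.unsc_half, ← f.unsc_tc]
    exact ⟨f.unsc_strictMono.monotone hx.1, f.unsc_strictMono.monotone hx.2⟩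
  exact fun x hx y hy h =>
    f.scale_strictMono (f.strictAntiOn (hm x hx) (hm y hy) (f.unsc_strictMono h))

theorem phi_zero_lt : f.phi 0 < 1 / 2 := by
  rw [← f.phi_tc]
  exact f.phi_strictMonoOn ⟨le_rfl, f.tc_pos.le⟩ ⟨f.tc_pos.le, le_rfl⟩ f.tc_pos

theorem continuousOn_phi : ContinuousOn f.phi (Icc 0 (1 / 2)) := by
  have h1 : Continuous f.scale := by unfold scale; fun_prop
  have h2 : Continuous f.unsc := by unfold unsc; fun_prop
  exact h1.comp_continuousOn (f.continuousOn.comp h2.continuousOn fun u hu => f.unsc_mem hu)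

/-- The lift on the fundamental domain `[0, 1]`: the sum of the contributions of the lower points
to the left of `c`, the lower points to the right of `c`, and the upper points to the right
of `â`. -/
noncomputable def liftBase (t : ℝ) : ℝ :=
  f.phi (max 0 (min t f.tc)) + (1 / 2 - f.phi (max f.tc (min t (1 / 2))))
    + f.phi (max (1 - f.g) (min (1 - t) (1 / 2)))

theorem clamp_mem {l u : ℝ} (h : l ≤ u) (t : ℝ) : max l (min t u) ∈ Icc l u :=
  ⟨le_max_left _ _, max_le h (min_le_right _ _)⟩

theorem monotone_liftBase : Monotone f.liftBase := by
  intro s t h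
  have h1 := f.tc_pos
  have h2 := f.tc_lt_half
  have h3 := f.half_le_g
  have h4 := f.g_lt_one_sub_tc
  have A := f.phi_strictMonoOn.monotoneOn (clamp_mem h1.le s) (clamp_mem h1.le t)
    (max_le_max le_rfl (min_le_min h le_rfl))
  have B := f.phi_strictAntiOn.antitoneOn (clamp_mem h2.le s) (clamp_mem h2.le t)
    (max_le_max le_rfl (min_le_min h le_rfl))
  have hm : ∀ r, max (1 - f.g) (min (1 - r) (1 / 2)) ∈ Icc f.tc (1 / 2) := fun r => by
    have := clamp_mem (show 1 - f.g ≤ 1 / 2 by linarith) (1 - r)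
    exact ⟨by linarith [this.1], this.2⟩
  have C := f.phi_strictAntiOn.antitoneOn (hm t) (hm s)
    (max_le_max le_rfl (min_le_min (by linarith) le_rfl))
  simp only [liftBase]
  linarith

theorem continuous_liftBase : Continuous f.liftBase := by
  have h1 := f.tc_pos
  have h2 := f.tc_lt_half
  have h3 := f.half_le_g
  have h4 := f.g_lt_one_sub_tc
  have hc := f.continuousOn_phi
  unfold liftBase
  refine ((hc.comp_continuous (by fun_prop) fun t => ?_).add (continuous_const.sub
    (hc.comp_continuous (by fun_prop) fun t => ?_))).add
    (hc.comp_continuous (by fun_prop) fun t => ?_)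
  · have := clamp_mem h1.le t
    exact ⟨this.1, by linarith [this.2]⟩
  · have := clamp_mem h2.le t
    exact ⟨by linarith [this.1], this.2⟩
  · have := clamp_mem (show 1 - f.g ≤ 1 / 2 by linarith) (1 - t)
    exact ⟨by linarith [this.1], this.2⟩

theorem liftBase_left {t : ℝ} (h0 : 0 ≤ t) (h1 : t ≤ f.tc) : f.liftBase t = f.phi t := by
  have h2 := f.tc_lt_half
  have h3 := f.half_le_g
  rw [liftBase, min_eq_left h1, max_eq_right h0, min_eq_left (by linarith), max_eq_left h1,
    min_eq_right (by linarith), max_eq_right (by linarith), phi_tc, phi_half]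
  ring

theorem liftBase_right {t : ℝ} (h0 : f.tc ≤ t) (h1 : t ≤ 1 / 2) :
    f.liftBase t = 1 - f.phi t := by
  have h2 := f.tc_pos
  have h3 := f.half_le_g
  rw [liftBase, min_eq_right h0, max_eq_right h2.le, min_eq_left h1, max_eq_right h0,
    min_eq_right (by linarith), max_eq_right (by linarith), phi_tc, phi_half]
  ring

theorem liftBase_upper {t : ℝ} (h0 : 1 / 2 ≤ t) (h1 : t ≤ f.g) :
    f.liftBase t = 1 + f.phi (1 - t) := by
  have h2 := f.tc_pos
  have h3 := f.tc_lt_half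
  rw [liftBase, min_eq_right (by linarith), max_eq_right h2.le, min_eq_right h0,
    max_eq_right (by linarith), min_eq_left (by linarith), max_eq_right (by linarith), phi_tc,
    phi_half]
  ring

theorem liftBase_flat {t : ℝ} (h0 : f.g ≤ t) : f.liftBase t = 1 + f.phi 0 := by
  have h2 := f.tc_pos
  have h3 := f.tc_lt_half
  have h4 := f.half_le_g
  rw [liftBase, min_eq_right (by linarith), max_eq_right h2.le, min_eq_right (by linarith),
    max_eq_right (by linarith), min_eq_left (by linarith), max_eq_left (by linarith), phi_tc,
    phi_half, phi_one_sub_g]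
  ring

theorem liftBase_zero : f.liftBase 0 = f.phi 0 := f.liftBase_left le_rfl f.tc_pos.le

theorem liftBase_one : f.liftBase 1 = 1 + f.phi 0 := f.liftBase_flat f.g_lt_one.le

/-- The lift of the outside map with `0 ≤ lift 0 < 1`. -/
noncomputable def lift : CircleDeg1Lift where
  toFun z := ⌊z⌋ + f.liftBase (Int.fract z)
  monotone' := by
    intro x y h
    have hfl := Int.floor_le_floor h
    rcases hfl.eq_or_lt with heq | hlt
    · have : Int.fract x ≤ Int.fract y := by rw [Int.fract, Int.fract, heq]; linarith
      have := f.monotone_liftBase this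
      simp only [heq]
      linarith
    · have h1 := f.monotone_liftBase (Int.fract_lt_one x).le
      have h2 := f.monotone_liftBase (Int.fract_nonneg y)
      rw [liftBase_one] at h1
      rw [liftBase_zero] at h2
      have h3 : (⌊x⌋ : ℝ) + 1 ≤ ⌊y⌋ := by exact_mod_cast hlt
      change (⌊x⌋ : ℝ) + f.liftBase (Int.fract x) ≤ ⌊y⌋ + f.liftBase (Int.fract y)
      linarith
  map_add_one' x := by
    simp only [Int.floor_add_one, Int.fract_add_one, Int.cast_add, Int.cast_one]
    ring

theorem lift_apply (z : ℝ) : f.lift z = ⌊z⌋ + f.liftBase (Int.fract z) := rfl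

theorem continuous_lift : Continuous f.lift := by
  have h : Continuous fun z : ℝ => z + (fun t => f.liftBase t - t) (Int.fract z) := by
    refine continuous_id.add (ContinuousOn.comp_fract''
      (f := fun t => f.liftBase t - t) ?_ ?_)
    · exact (f.continuous_liftBase.sub continuous_id).continuousOn
    · simp only [liftBase_zero, liftBase_one]
      ring
  convert h using 2 with z
  have := Int.floor_add_fract z
  simp only
  linarith [f.lift_apply z]

theorem lift_int_add {t : ℝ} (h0 : 0 ≤ t) (h1 : t ≤ 1) (k : ℤ) :
    f.lift (k + t) = k + f.liftBase t := by
  rw [CircleDeg1Lift.map_int_add]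
  congr 1
  rcases h1.eq_or_lt with rfl | h1
  · rw [lift_apply, liftBase_one]
    simp [liftBase_zero]
  · rw [lift_apply, Int.floor_eq_zero_iff.2 ⟨h0, h1⟩, Int.fract_eq_self.2 ⟨h0, h1⟩]
    simp

theorem lift_eq_base {t : ℝ} (h0 : 0 ≤ t) (h1 : t ≤ 1) : f.lift t = f.liftBase t := by
  simpa using f.lift_int_add h0 h1 0

theorem lift_zero : f.lift 0 = f.phi 0 := by
  rw [f.lift_eq_base le_rfl zero_le_one, liftBase_zero]

theorem lift_zero_nonneg : 0 ≤ f.lift 0 := by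
  rw [lift_zero]; exact (f.phi_mem ⟨le_rfl, by norm_num⟩).1

theorem lift_zero_lt_half : f.lift 0 < 1 / 2 := by rw [lift_zero]; exact f.phi_zero_lt

theorem lift_int (k : ℤ) : f.lift k = f.lift 0 + k := f.lift.map_int_of_map_zero k

theorem lift_tc (k : ℤ) : f.lift (k + f.tc) = k + 1 / 2 := by
  rw [f.lift_int_add f.tc_pos.le (by linarith [f.tc_lt_half]), f.liftBase_left f.tc_pos.le le_rfl,
    phi_tc]

theorem lift_half (k : ℤ) : f.lift (k + 1 / 2) = k + 1 := by
  rw [f.lift_int_add (by norm_num) (by norm_num), f.liftBase_right f.tc_lt_half.le le_rfl,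
    phi_half]
  ring

theorem lift_flat {z : ℝ} {k : ℤ} (h0 : f.g + k ≤ z) (h1 : z ≤ 1 + k) :
    f.lift z = f.lift 0 + k + 1 := by
  have h := f.lift_int_add (t := z - k) (by linarith [f.half_le_g]) (by linarith) k
  rw [f.liftBase_flat (by linarith)] at h
  rw [add_sub_cancel] at h
  rw [h, lift_zero]
  ring

theorem liftBase_strictMonoOn : StrictMonoOn f.liftBase (Icc 0 f.g) := by
  have h1 := f.tc_pos
  have h2 := f.tc_lt_half
  have h3 := f.half_le_g
  have h4 := f.g_lt_one_sub_tc
  have A : StrictMonoOn f.liftBase (Icc 0 f.tc) :=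
    f.phi_strictMonoOn.congr fun t ht => (f.liftBase_left ht.1 ht.2).symm
  have B : StrictMonoOn f.liftBase (Icc f.tc (1 / 2)) := fun s hs t ht h => by
    rw [f.liftBase_right hs.1 hs.2, f.liftBase_right ht.1 ht.2]
    linarith [f.phi_strictAntiOn hs ht h]
  have C : StrictMonoOn f.liftBase (Icc (1 / 2) f.g) := fun s hs t ht h => by
    rw [f.liftBase_upper hs.1 hs.2, f.liftBase_upper ht.1 ht.2]
    have := f.phi_strictAntiOn (a := 1 - t) (b := 1 - s) ⟨by linarith [ht.2], by linarith [ht.1]⟩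
      ⟨by linarith [hs.2], by linarith [hs.1]⟩ (by linarith)
    linarith
  have AB := A.union B (isGreatest_Icc h1.le) (isLeast_Icc h2.le)
  rw [Icc_union_Icc_eq_Icc h1.le h2.le] at AB
  have ABC := AB.union C (isGreatest_Icc (by linarith)) (isLeast_Icc h3)
  rwa [Icc_union_Icc_eq_Icc (by linarith) h3] at ABC

theorem lift_strictMonoOn {x y : ℝ} {k : ℤ} (hx : (k : ℝ) ≤ x) (hxy : x < y)
    (hy : y ≤ k + f.g) : f.lift x < f.lift y := by
  have hg := f.g_lt_one
  have h1 := f.lift_int_add (t := x - k) (by linarith) (by linarith) k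
  have h2 := f.lift_int_add (t := y - k) (by linarith) (by linarith) k
  have h3 := f.liftBase_strictMonoOn (a := x - k) (b := y - k) ⟨by linarith, by linarith⟩
    ⟨by linarith, by linarith⟩ (by linarith)
  rw [add_sub_cancel] at h1 h2
  linarith

/-! ### The lift covers the outside map -/

theorem lower_eq (x : ℝ) : f.lower x = (f.scale x : UnitAddCircle) := rfl

theorem upper_eq (x : ℝ) : f.upper x = ((1 - f.scale x : ℝ) : UnitAddCircle) := rfl

theorem coe_add_int (z : ℝ) (k : ℤ) : ((z + k : ℝ) : UnitAddCircle) = (z : UnitAddCircle) := by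
  have h : ((k : ℝ) : UnitAddCircle) = 0 := by
    rw [AddCircle.coe_eq_zero_iff]
    exact ⟨k, by simp⟩
  rw [AddCircle.coe_add, h, add_zero]

theorem coe_int_add (z : ℝ) (k : ℤ) : ((k + z : ℝ) : UnitAddCircle) = (z : UnitAddCircle) := by
  rw [add_comm, coe_add_int]

theorem coe_eq_coe_iff {x y : ℝ} :
    (x : UnitAddCircle) = (y : UnitAddCircle) ↔ ∃ k : ℤ, x = y + k := by
  constructor
  · intro h
    rw [← sub_eq_zero, ← AddCircle.coe_sub, AddCircle.coe_eq_zero_iff] at h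
    obtain ⟨k, hk⟩ := h
    refine ⟨k, ?_⟩
    simp at hk
    linarith
  · rintro ⟨k, rfl⟩
    exact coe_add_int _ _

theorem coe_lift (z : ℝ) : ((f.lift z : ℝ) : UnitAddCircle) = f.outside z := by
  have hz : (z : UnitAddCircle) = ((Int.fract z : ℝ) : UnitAddCircle) := by
    conv_lhs => rw [← Int.floor_add_fract z]
    exact coe_int_add _ _
  rw [lift_apply, coe_int_add, hz]
  have h0 := Int.fract_nonneg z
  have h1 := (Int.fract_lt_one z).le
  generalize Int.fract z = t at h0 h1
  have hm := f.unsc_strictMono.monotone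
  have hl : (t : UnitAddCircle) = f.lower (f.unsc t) := by rw [lower_eq, scale_unsc]
  have hu : (t : UnitAddCircle) = f.upper (f.unsc (1 - t)) := by
    rw [upper_eq, scale_unsc, sub_sub_cancel]
  rcases le_total t f.tc with h | h
  · rw [hl, f.outside_lower_left ⟨by rw [← f.unsc_zero]; exact hm h0, by
      rw [← f.unsc_tc]; exact hm h⟩, f.liftBase_left h0 h]
    rfl
  rcases le_total t (1 / 2) with h' | h'
  · rw [hl, f.outside_lower_right ⟨by rw [← f.unsc_tc]; exact hm h, by
      rw [← f.unsc_half]; exact hm h'⟩, f.liftBase_right h h']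
    rfl
  rcases le_total t f.g with h'' | h''
  · rw [hu, f.outside_upper_right ⟨by rw [← f.unsc_one_sub_g]; exact hm (by linarith), by
      rw [← f.unsc_half]; exact hm (by linarith)⟩, f.liftBase_upper h' h'']
    have := coe_int_add (f.phi (1 - t)) 1
    rw [Int.cast_one] at this
    rw [this]
    rfl
  · rw [hu, f.outside_upper_left ⟨by rw [← f.unsc_zero]; exact hm (by linarith), by
      rw [← f.unsc_one_sub_g]; exact hm (by linarith)⟩, f.liftBase_flat h'']
    have := coe_int_add (f.phi 0) 1
    rw [Int.cast_one] at this
    rw [this, phi, unsc_zero]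
    rfl

theorem coe_lift_iterate (r : ℕ) (z : ℝ) :
    ((f.lift^[r] z : ℝ) : UnitAddCircle) = f.outside^[r] z := by
  induction r generalizing z with
  | zero => rfl
  | succ r ih => rw [iterate_succ_apply, iterate_succ_apply, ih, coe_lift]

theorem mem_gamma {z : ℝ} : (z : UnitAddCircle) ∈ f.gamma ↔ ∃ k : ℤ, f.g + k ≤ z ∧ z ≤ 1 + k := by
  constructor
  · rintro ⟨x, hx, h⟩
    rw [upper_eq, coe_eq_coe_iff] at h
    obtain ⟨k, hk⟩ := h
    refine ⟨-k, ?_⟩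
    have h1 := f.scale_strictMono.monotone hx.1
    have h2 := f.scale_strictMono.monotone hx.2
    rw [scale_a] at h1
    push_cast
    rw [g]
    constructor <;> linarith
  · rintro ⟨k, h1, h2⟩
    refine ⟨f.unsc (1 - (z - k)), ⟨?_, ?_⟩, ?_⟩
    · rw [← f.unsc_zero]
      exact f.unsc_strictMono.monotone (by linarith)
    · rw [← f.unsc_one_sub_g]
      exact f.unsc_strictMono.monotone (by linarith)
    · rw [upper_eq, scale_unsc, coe_eq_coe_iff]
      exact ⟨-k, by push_cast; ring⟩

/-! ### The projection to the interval -/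

/-- The projection of the circle to `[a, b]`, as a function on the line. -/
noncomputable def tau (z : ℝ) : ℝ := f.unsc (min (Int.fract z) (1 - Int.fract z))

theorem tau_mem (z : ℝ) : f.tau z ∈ Icc f.a f.b := by
  apply f.unsc_mem
  have h0 := Int.fract_nonneg z
  have h1 := Int.fract_lt_one z
  refine ⟨le_min h0 (by linarith), ?_⟩
  rcases le_total (Int.fract z) (1 / 2) with h | h
  · exact (min_le_left _ _).trans h
  · exact (min_le_right _ _).trans (by linarith)

theorem tau_lower {z : ℝ} {k : ℤ} (h0 : (k : ℝ) ≤ z) (h1 : z ≤ k + 1 / 2) :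
    f.tau z = f.unsc (z - k) := by
  have hfl : ⌊z⌋ = k := Int.floor_eq_iff.2 ⟨h0, by linarith⟩
  rw [tau, Int.fract, hfl, min_eq_left (by linarith)]

theorem tau_upper {z : ℝ} {k : ℤ} (h0 : k + 1 / 2 ≤ z) (h1 : z ≤ k + 1) :
    f.tau z = f.unsc (k + 1 - z) := by
  rcases h1.eq_or_lt with h1 | h1
  · rw [f.tau_lower (k := k + 1) (by push_cast; linarith) (by push_cast; linarith), h1]
    push_cast
    congr 1
  · have hfl : ⌊z⌋ = k := Int.floor_eq_iff.2 ⟨by linarith, by linarith⟩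
    rw [tau, Int.fract, hfl, min_eq_right (by linarith)]
    congr 1
    ring

theorem tau_add_int (z : ℝ) (k : ℤ) : f.tau (z + k) = f.tau z := by
  rw [tau, Int.fract_add_intCast, tau]

theorem tau_int (k : ℤ) : f.tau k = f.a := by
  rw [f.tau_lower (k := k) le_rfl (by linarith), sub_self, unsc_zero]

/-- Off the interior of `γ`, the projection semiconjugates the lift to the unimodal map. -/
theorem tau_lift {z : ℝ} {k : ℤ} (h0 : (k : ℝ) ≤ z) (h1 : z ≤ k + f.g) :
    f.tau (f.lift z) = f (f.tau z) := by
  have e1 := f.tc_pos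
  have e2 := f.tc_lt_half
  have e3 := f.half_le_g
  have e4 := f.g_lt_one_sub_tc
  have hl := f.lift_int_add (t := z - k) (by linarith) (by linarith) k
  rw [add_sub_cancel] at hl
  have hphi : ∀ u, f.unsc (f.phi u) = f (f.unsc u) := fun u => f.unsc_scale _
  rcases le_total (z - k) f.tc with h | h
  · rw [f.liftBase_left (by linarith) h] at hl
    have hm := f.phi_mem (u := z - k) ⟨by linarith, by linarith⟩
    rw [hl, f.tau_lower (k := k) (by linarith [hm.1]) (by linarith [hm.2]), f.tau_lower h0
      (by linarith), ← hphi, add_sub_cancel_left]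
  rcases le_total (z - k) (1 / 2) with h' | h'
  · rw [f.liftBase_right h h'] at hl
    have hm := f.phi_mem (u := z - k) ⟨by linarith, by linarith⟩
    rw [hl, f.tau_upper (k := k) (by linarith [hm.2]) (by linarith [hm.1]), f.tau_lower h0
      (by linarith), ← hphi]
    congr 1
    ring
  · rw [f.liftBase_upper h' (by linarith)] at hl
    have hm := f.phi_mem (u := 1 - (z - k)) ⟨by linarith, by linarith⟩
    rw [hl, f.tau_lower (k := k + 1) (by push_cast; linarith [hm.1])
      (by push_cast; linarith [hm.2]), f.tau_upper (k := k) (by linarith) (by linarith)]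
    rw [show (k : ℝ) + 1 - z = 1 - (z - k) by ring, ← hphi]
    congr 1
    push_cast
    ring

end UnimodalMap

namespace UnimodalMap

variable (f : UnimodalMap)

/-! ### Reading itineraries off the circle -/

theorem lift_le {z : ℝ} {k : ℤ} (h : (k : ℝ) ≤ z) : (k : ℝ) ≤ f.lift z := by
  have h1 := f.lift.monotone h
  rw [lift_int] at h1
  linarith [f.lift_zero_nonneg]

theorem lift_lt_half {z : ℝ} {k : ℤ} (h0 : (k : ℝ) ≤ z) (h : z < k + f.tc) :
    f.lift z < k + 1 / 2 := by
  rw [← f.lift_tc]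
  exact f.lift_strictMonoOn h0 h (by linarith [f.tc_lt_half, f.half_le_g])

theorem half_le_lift {z : ℝ} {k : ℤ} (h : k + f.tc ≤ z) : k + 1 / 2 ≤ f.lift z := by
  rw [← f.lift_tc]
  exact f.lift.monotone h

theorem lift_lt_one {z : ℝ} {k : ℤ} (h0 : (k : ℝ) ≤ z) (h : z < k + 1 / 2) :
    f.lift z < k + 1 := by
  rw [← f.lift_half]
  exact f.lift_strictMonoOn h0 h (by linarith [f.half_le_g])

theorem one_le_lift {z : ℝ} {k : ℤ} (h : k + 1 / 2 ≤ z) : (k : ℝ) + 1 ≤ f.lift z := by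
  rw [← f.lift_half]
  exact f.lift.monotone h

theorem lift_lt_three_halves {z : ℝ} {k : ℤ} (h : z ≤ k + 1) : f.lift z < k + 1 + 1 / 2 := by
  have h1 := f.lift.monotone h
  have h2 := f.lift_int (k + 1)
  push_cast at h2
  linarith [f.lift_zero_lt_half]

theorem lift_lift_lt_two {z : ℝ} {k : ℤ} (h : z ≤ k + 1) : f.lift (f.lift z) < k + 2 := by
  have h1 := f.lift_lt_three_halves h
  rcases le_total ((k : ℝ) + 1) (f.lift z) with h2 | h2
  · have := f.lift_lt_one (z := f.lift z) (k := k + 1) (by push_cast; linarith)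
      (by push_cast; linarith)
    push_cast at this
    linarith
  · have := f.lift_lt_three_halves h2
    linarith

/-- The sequence of symbols read off the orbit of a point of the circle under the outside map: the
symbol is `0` on the arc from `a` to `c_ℓ`, and `1` elsewhere, including `c_ℓ` itself. -/
noncomputable def circleCode (x : ℝ) : BinSeq := code fun j => ⌊f.lift^[j] x⌋

theorem circleCode_apply (x : ℝ) (j : ℕ) : f.circleCode x j =
    if ⌊f.lift (f.lift (f.lift^[j] x))⌋ = ⌊f.lift^[j] x⌋ then 0 else 1 := by
  rw [circleCode, code, iterate_succ_apply', iterate_succ_apply']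

theorem circleCode_eq_zero {x : ℝ} {j : ℕ} {k : ℤ} (h0 : (k : ℝ) ≤ f.lift^[j] x)
    (h1 : f.lift^[j] x < k + f.tc) : f.circleCode x j = 0 := by
  have h2 := f.tc_lt_half
  have h3 := f.lift_lt_half h0 h1
  have h4 := f.lift_le h0
  have h5 := f.lift_le h4
  have h6 := f.lift_lt_one h4 h3
  rw [circleCode_apply, if_pos]
  rw [Int.floor_eq_iff.2 ⟨h5, h6⟩, Int.floor_eq_iff.2 ⟨h0, by linarith⟩]

theorem circleCode_eq_one {x : ℝ} {j : ℕ} {k : ℤ} (h0 : k + f.tc ≤ f.lift^[j] x)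
    (h1 : f.lift^[j] x < k + 1) : f.circleCode x j = 1 := by
  have h2 := f.tc_pos
  have h3 := f.one_le_lift (f.half_le_lift h0)
  rw [circleCode_apply, if_neg]
  rw [Int.floor_eq_iff.2 ⟨by linarith, h1⟩]
  have : k + 1 ≤ ⌊f.lift (f.lift (f.lift^[j] x))⌋ := Int.le_floor.2 (by push_cast; exact h3)
  omega

theorem circleCode_iterate (x : ℝ) (r : ℕ) :
    f.circleCode (f.lift^[r] x) = BinSeq.shift r (f.circleCode x) := by
  funext j
  simp only [circleCode_apply, BinSeq.shift, iterate_add_apply]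

theorem neg_half_eq : (-1 / 2 : ℝ) = ((-1 : ℤ) : ℝ) + 1 / 2 := by norm_num

theorem lift_neg_half : f.lift (-1 / 2) = 0 := by
  rw [neg_half_eq, lift_half]; norm_num

theorem iterate_succ_neg_half (j : ℕ) : f.lift^[j + 1] (-1 / 2) = f.lift^[j] 0 := by
  rw [iterate_succ_apply, lift_neg_half]

theorem tau_neg_half : f.tau (-1 / 2) = f.b := by
  rw [neg_half_eq, f.tau_upper (k := -1) le_rfl (by norm_num), ← f.unsc_half]
  congr 1
  norm_num

/-- The integer parts along the orbit of the point `b` of the circle, lifted to `-1/2` so that the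
next point of the orbit is `0`. -/
noncomputable def orbitStair (j : ℕ) : ℤ := ⌊f.lift^[j] (-1 / 2)⌋

theorem circleCode_neg_half : f.circleCode (-1 / 2) = code f.orbitStair := rfl

theorem orbitStair_succ (j : ℕ) : f.orbitStair (j + 1) = ⌊f.lift^[j] 0⌋ := by
  rw [orbitStair, iterate_succ_neg_half]

theorem isStaircase_orbitStair : IsStaircase f.orbitStair where
  zero := by
    rw [orbitStair, iterate_zero_apply, Int.floor_eq_iff]; norm_num
  one := by rw [orbitStair_succ]; simp
  mono j := by
    rw [orbitStair, orbitStair, iterate_succ_apply']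
    exact Int.le_floor.2 (f.lift_le (Int.floor_le _))
  le_add j := by
    rw [orbitStair, orbitStair, iterate_succ_apply', iterate_succ_apply']
    have := f.lift_lift_lt_two (Int.lt_floor_add_one (f.lift^[j] (-1 / 2))).le
    have h2 : ⌊f.lift (f.lift (f.lift^[j] (-1 / 2)))⌋ < ⌊f.lift^[j] (-1 / 2)⌋ + 2 :=
      Int.floor_lt.2 (by push_cast; exact this)
    omega

/-! ### Rotation number -/

/-- The translation number of the lift. -/
noncomputable def rho : ℝ := f.lift.translationNumber

theorem mul_rho_le {x : ℝ} {j : ℕ} {k : ℤ} (h : f.lift^[j] x ≤ x + k) : j * f.rho ≤ k := by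
  rw [rho, ← CircleDeg1Lift.translationNumber_pow]
  exact CircleDeg1Lift.translationNumber_le_of_le_add_int _ (by rwa [CircleDeg1Lift.coe_pow])

theorem le_mul_rho {x : ℝ} {j : ℕ} {k : ℤ} (h : x + k ≤ f.lift^[j] x) : k ≤ j * f.rho := by
  rw [rho, ← CircleDeg1Lift.translationNumber_pow]
  exact CircleDeg1Lift.le_translationNumber_of_add_int_le _ (by rwa [CircleDeg1Lift.coe_pow])

theorem rho_nonneg : 0 ≤ f.rho := by
  simpa using f.le_mul_rho (x := 0) (j := 1) (k := 0) (by simpa using f.lift_zero_nonneg)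

theorem rho_le_half : f.rho ≤ 1 / 2 := by
  have h1 := f.lift_lt_three_halves (z := 0) (k := -1) (by norm_num)
  have h2 := f.lift_lift_lt_two (z := 0) (k := -1) (by norm_num)
  have := f.mul_rho_le (x := 0) (j := 2) (k := 1) (by
    simp only [iterate_succ_apply', iterate_zero_apply]
    push_cast at h2 ⊢
    linarith)
  push_cast at this
  linarith

theorem orbitStair_le_upperStair (j : ℕ) : f.orbitStair j ≤ upperStair f.rho j := by
  rcases j with _ | j
  · rw [f.isStaircase_orbitStair.zero, upperStair_zero]
  · rw [orbitStair_succ, upperStair_succ, Int.le_floor, mul_comm]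
    exact f.le_mul_rho (x := 0) (by rw [zero_add]; exact Int.floor_le _)

theorem lowerStair_le_orbitStair (j : ℕ) :
    lowerStair f.rho j ≤ f.orbitStair j := by
  rcases j with _ | _ | j
  · rw [f.isStaircase_orbitStair.zero, lowerStair_zero]
  · rw [f.isStaircase_orbitStair.one, lowerStair_one]
  · rw [orbitStair_succ, lowerStair_add_two, Int.le_floor]
    by_contra hlt
    push Not at hlt
    have := f.mul_rho_le (x := 0) (j := j + 1) (k := ⌈f.rho * ((j : ℝ) + 1)⌉ - 1)
      (by rw [zero_add]; exact hlt.le)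
    have h2 := Int.ceil_lt_add_one (f.rho * ((j : ℝ) + 1))
    have h3 : ⌈f.rho * ((j : ℝ) + 1)⌉ ≤ ⌈f.rho * ((j : ℝ) + 1)⌉ - 1 :=
      Int.ceil_le.2 (by push_cast at this ⊢; linarith)
    omega

/-! ### The kneading sequence and the circle code of `b` -/

theorem kneading_isItinerary : f.IsItinerary f.b f.kneading :=
  (Classical.choose_spec f.exists_least_itinerary).1

theorem kneading_le {t : BinSeq} (h : f.IsItinerary f.b t) : BinSeq.Le f.kneading t :=
  (Classical.choose_spec f.exists_least_itinerary).2 t h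

theorem b_mem : f.b ∈ Icc f.a f.b := ⟨f.a_lt_b.le, le_rfl⟩

theorem a_mem : f.a ∈ Icc f.a f.b := ⟨le_rfl, f.a_lt_b.le⟩

/-- The minimality of the kneading sequence fixes the symbols of passages through the turning
point. -/
theorem kneading_eq_one_of_odd {r : ℕ} (h : f^[r] f.b = f.c)
    (hodd : Odd (∑ i ∈ Finset.range r, (f.kneading i : ℕ))) : f.kneading r = 1 := by
  by_contra hne
  have h0 : f.kneading r = 0 := by omega
  have hit : f.IsItinerary f.b (update f.kneading r 1) := by
    intro i
    rcases eq_or_ne i r with rfl | hi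
    · rw [h]
      exact ⟨fun _ => ⟨f.a_lt_c.le, le_rfl⟩, fun _ => ⟨le_rfl, f.c_lt_b.le⟩⟩
    · rw [update_of_ne hi]
      exact f.kneading_isItinerary i
  rcases f.kneading_le hit with heq | ⟨s, h1, h2, h3⟩
  · have := congrFun heq r
    rw [update_self] at this
    exact hne this
  · have hs : s = r := by
      by_contra hsr
      rw [update_of_ne hsr] at h2
      exact h2 rfl
    subst hs
    rw [Finset.sum_range_succ, h0] at h3
    simp only [Fin.val_zero, add_zero] at h3
    exact Nat.not_even_iff_odd.2 hodd h3

theorem unsc_le_c {u : ℝ} (h : u ≤ f.tc) : f.unsc u ≤ f.c := by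
  rw [← unsc_tc]; exact f.unsc_strictMono.monotone h

theorem c_le_unsc {u : ℝ} (h : f.tc ≤ u) : f.c ≤ f.unsc u := by
  rw [← unsc_tc]; exact f.unsc_strictMono.monotone h

theorem tau_zero : f.tau 0 = f.a := by simpa using f.tau_int 0

theorem tau_lift_zero : f.tau (f.lift 0) = f f.a := by
  rw [f.tau_lift (k := 0) (by simp) (by simp; linarith [f.half_le_g]), tau_zero]

/-- The projection is exact as long as the orbit on the circle avoids the interior of `γ`. -/
theorem tau_iterate {x : ℝ} {j : ℕ}
    (h : ∀ i < j, f.lift^[i] x ≤ ⌊f.lift^[i] x⌋ + f.g) : f^[j] (f.tau x) = f.tau (f.lift^[j] x) := by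
  induction j with
  | zero => rfl
  | succ j ih =>
    rw [iterate_succ_apply', iterate_succ_apply', ih fun i hi => h i (by omega),
      f.tau_lift (Int.floor_le _) (h j (by omega))]

/-- As long as the kneading sequence agrees with the circle code of `b`, the orbit of `b` under the
unimodal map stays to the right of the projected circle orbit when the latter is at lower points,
and to its left when it is at upper points. -/
theorem iterate_b_compare {r : ℕ}
    (hr : ∀ i < r, f.kneading i = f.circleCode (-1 / 2) i) :
    (f.lift^[r] (-1 / 2) < f.orbitStair r + 1 / 2 →
      f.tau (f.lift^[r] (-1 / 2)) ≤ f^[r] f.b) ∧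
    (f.orbitStair r + 1 / 2 ≤ f.lift^[r] (-1 / 2) →
      f^[r] f.b ≤ f.tau (f.lift^[r] (-1 / 2))) := by
  have e1 := f.tc_pos
  have e2 := f.tc_lt_half
  have e3 := f.half_le_g
  have e4 := f.g_lt_one_sub_tc
  induction r with
  | zero => simp [tau_neg_half]
  | succ r ih =>
    have IH := ih fun i hi => hr i (by omega)
    have hK := hr r (by omega)
    have hit := f.kneading_isItinerary r
    have hmem := f.iterate_mem f.b_mem r
    rw [orbitStair, iterate_succ_apply', iterate_succ_apply']
    rw [orbitStair] at IH
    have hk0 := Int.floor_le (f.lift^[r] (-1 / 2))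
    have hk1 := Int.lt_floor_add_one (f.lift^[r] (-1 / 2))
    have hC0 := f.circleCode_eq_zero hk0
    have hC1 := fun h => f.circleCode_eq_one (x := -1 / 2) (j := r) h hk1
    rw [← hK] at hC0 hC1
    generalize ⌊f.lift^[r] (-1 / 2)⌋ = k at *
    generalize f.lift^[r] (-1 / 2) = z at *
    generalize f^[r] f.b = y at *
    have hm := f.unsc_strictMono.monotone
    -- according to the position of the circle orbit: left of `c_ℓ`, between `c_ℓ` and `b`, upper
    rcases lt_or_ge z (k + f.tc) with h | h
    · have h1 := f.lift_lt_half hk0 h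
      have h2 := f.lift_le hk0
      rw [Int.floor_eq_iff.2 ⟨h2, by linarith⟩, f.tau_lift hk0 (by linarith)]
      refine ⟨fun _ => ?_, fun h' => absurd h' (by linarith)⟩
      have hy := hit.1 (hC0 h)
      have ht := f.tau_lower hk0 (by linarith)
      exact f.strictMonoOn.monotoneOn ⟨(f.tau_mem z).1, by rw [ht]; exact f.unsc_le_c (by linarith)⟩
        hy (IH.1 (by linarith))
    have hy := hit.2 (hC1 h)
    rcases lt_or_ge z (k + 1 / 2) with h' | h'
    · have h1 := f.lift_lt_one hk0 h'
      have h2 := f.half_le_lift h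
      rw [Int.floor_eq_iff.2 ⟨by linarith, h1⟩, f.tau_lift hk0 (by linarith)]
      refine ⟨fun h' => absurd h' (by linarith), fun _ => ?_⟩
      have ht := f.tau_lower hk0 (by linarith)
      exact f.strictAntiOn.antitoneOn ⟨by rw [ht]; exact f.c_le_unsc (by linarith),
        (f.tau_mem z).2⟩ hy (IH.1 h')
    · have h1 := f.one_le_lift h'
      have h2 := f.lift_lt_three_halves hk1.le
      rw [Int.floor_eq_iff (z := k + 1) |>.2 ⟨by push_cast; exact h1, by push_cast; linarith⟩]
      refine ⟨fun _ => ?_, fun h' => absurd h' (by push_cast; linarith)⟩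
      have hyz := IH.2 h'
      have ht := f.tau_upper h' (by linarith)
      rcases le_total z (k + f.g) with h'' | h''
      · rw [f.tau_lift hk0 h'']
        exact f.strictAntiOn.antitoneOn hy ⟨hy.1.trans hyz, (f.tau_mem z).2⟩ hyz
      · -- in `γ` the circle orbit continues like that of `â`, which is to the right of its projection
        rw [f.lift_flat (k := k) (by linarith) (by linarith), add_assoc]
        have := f.tau_add_int (f.lift 0) (k + 1)
        push_cast at this
        rw [this, tau_lift_zero, ← f.map_re]
        refine f.strictAntiOn.antitoneOn hy ⟨f.re_mem.1.le, f.re_mem.2⟩ (hyz.trans ?_)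
        rw [ht, ← f.unsc_one_sub_g]
        exact hm (by linarith)

theorem orbitStair_succ_of_lt {r : ℕ} (h : f.lift^[r] (-1 / 2) < f.orbitStair r + 1 / 2) :
    f.orbitStair (r + 1) = f.orbitStair r := by
  have h0 := Int.floor_le (f.lift^[r] (-1 / 2))
  rw [orbitStair] at h ⊢
  rw [orbitStair, iterate_succ_apply']
  exact Int.floor_eq_iff.2 ⟨f.lift_le h0, f.lift_lt_one h0 h⟩

theorem orbitStair_succ_of_ge {r : ℕ} (h : f.orbitStair r + 1 / 2 ≤ f.lift^[r] (-1 / 2)) :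
    f.orbitStair (r + 1) = f.orbitStair r + 1 := by
  have h0 := Int.lt_floor_add_one (f.lift^[r] (-1 / 2))
  rw [orbitStair] at h ⊢
  rw [orbitStair, iterate_succ_apply']
  have := f.lift_lt_three_halves h0.le
  exact Int.floor_eq_iff.2 ⟨by push_cast; exact f.one_le_lift h, by push_cast; linarith⟩

/-- Points of `γ` are treated by the outside map as if they were `â`, which can only increase the
itinerary of `b`. -/
theorem kneading_le_circleCode : BinSeq.Le f.kneading (f.circleCode (-1 / 2)) := by
  by_cases hc : f.kneading = f.circleCode (-1 / 2)
  · exact Or.inl hc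
  obtain ⟨r, hr, hd⟩ := BinSeq.exists_first_diff hc
  refine Or.inr ⟨r, hr, hd, ?_⟩
  have hinv := f.iterate_b_compare hr
  have hsum := f.isStaircase_orbitStair.sum_code r
  rw [← circleCode_neg_half, ← BinSeq.sum_congr_prefix hr] at hsum
  have e2 := f.tc_lt_half
  have hk0 : (f.orbitStair r : ℝ) ≤ f.lift^[r] (-1 / 2) := Int.floor_le _
  have hk1 : f.lift^[r] (-1 / 2) < f.orbitStair r + 1 := Int.lt_floor_add_one _
  rw [Finset.sum_range_succ, ← Int.even_coe_nat, Nat.cast_add, hsum]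
  rcases lt_or_ge (f.lift^[r] (-1 / 2)) (f.orbitStair r + f.tc) with h | h
  · rw [f.circleCode_eq_zero hk0 h] at hd
    rw [BinSeq.eq_one_of_ne_zero hd, f.orbitStair_succ_of_lt (by linarith)]
    exact ⟨f.orbitStair r + 1, by simp; ring⟩
  have hK := f.circleCode_eq_one h hk1
  rw [hK] at hd
  have hκ : f.kneading r = 0 := by omega
  rcases lt_or_ge (f.lift^[r] (-1 / 2)) (f.orbitStair r + 1 / 2) with h' | h'
  · have hy := (f.kneading_isItinerary r).1 hκ
    have hle := hinv.1 h'
    rw [f.tau_lower hk0 h'.le] at hle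
    have hc : f^[r] f.b = f.c := le_antisymm hy.2 ((f.c_le_unsc (by linarith)).trans hle)
    refine absurd (f.kneading_eq_one_of_odd hc ?_) hd
    rw [← Int.odd_coe_nat, hsum, f.orbitStair_succ_of_lt h']
    exact ⟨f.orbitStair r, by ring⟩
  · rw [hκ, f.orbitStair_succ_of_ge h']
    exact ⟨f.orbitStair r + 1, by simp; ring⟩

/-- As long as the orbit of `b` on the circle avoids the interior of `γ`, the kneading sequence can be
read off it. -/
theorem kneading_eq_circleCode {r : ℕ}
    (h : ∀ i ≤ r, f.lift^[i] (-1 / 2) ≤ f.orbitStair i + f.g) :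
    f.kneading r = f.circleCode (-1 / 2) r := by
  induction r using Nat.strong_induction_on with
  | _ r ih =>
    have hr : ∀ i < r, f.kneading i = f.circleCode (-1 / 2) i := fun i hi =>
      ih i hi fun l hl => h l (by omega)
    have hτ := f.tau_iterate (x := -1 / 2) (j := r) fun i hi => h i hi.le
    rw [tau_neg_half] at hτ
    have hsum := f.isStaircase_orbitStair.sum_code r
    rw [← circleCode_neg_half, ← BinSeq.sum_congr_prefix hr] at hsum
    have e2 := f.tc_lt_half
    have e4 := f.g_lt_one_sub_tc
    have hk0 : (f.orbitStair r : ℝ) ≤ f.lift^[r] (-1 / 2) := Int.floor_le _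
    have hk1 : f.lift^[r] (-1 / 2) < f.orbitStair r + 1 := Int.lt_floor_add_one _
    have hg := h r le_rfl
    have hit := f.kneading_isItinerary r
    have hs := f.unsc_strictMono
    rcases lt_trichotomy (f.lift^[r] (-1 / 2)) (f.orbitStair r + f.tc) with h1 | h1 | h1
    · rw [f.circleCode_eq_zero hk0 h1]
      by_contra hne
      have h2 := (hit.2 (BinSeq.eq_one_of_ne_zero hne)).1
      rw [hτ, f.tau_lower hk0 (by linarith), ← f.unsc_tc, hs.le_iff_le] at h2
      linarith
    · rw [f.circleCode_eq_one h1.ge hk1]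
      apply f.kneading_eq_one_of_odd
      · rw [hτ, f.tau_lower hk0 (by linarith), h1, add_sub_cancel_left, unsc_tc]
      · rw [← Int.odd_coe_nat, hsum, f.orbitStair_succ_of_lt (by linarith)]
        exact ⟨f.orbitStair r, by ring⟩
    · rw [f.circleCode_eq_one h1.le hk1]
      refine BinSeq.eq_one_of_ne_zero fun h0 => ?_
      have h2 := (hit.1 h0).2
      rw [hτ] at h2
      rcases le_total (f.lift^[r] (-1 / 2)) (f.orbitStair r + 1 / 2) with h3 | h3
      · rw [f.tau_lower hk0 h3, ← f.unsc_tc, hs.le_iff_le] at h2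
        linarith
      · rw [f.tau_upper h3 hk1.le, ← f.unsc_tc, hs.le_iff_le] at h2
        linarith

end UnimodalMap

namespace UnimodalMap

variable (f : UnimodalMap)

theorem iterate_add_int (j : ℕ) (x : ℝ) (k : ℤ) : f.lift^[j] (x + k) = f.lift^[j] x + k :=
  (f.lift.commute_add_int k).iterate_left j x

theorem iterate_sub_int (j : ℕ) (x : ℝ) (k : ℤ) : f.lift^[j] (x - k) = f.lift^[j] x - k := by
  have := f.iterate_add_int j x (-k)
  push_cast at this
  rw [sub_eq_add_neg, this, sub_eq_add_neg]

theorem monotone_iterate (j : ℕ) : Monotone f.lift^[j] := f.lift.monotone.iterate j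

theorem continuous_iterate (j : ℕ) : Continuous f.lift^[j] := f.continuous_lift.iterate j

/-- A return of `a` to `γ` makes the returning point periodic. -/
theorem iterate_return {r : ℕ} {k : ℤ} (hr : 0 < r) (h0 : f.g + k ≤ f.lift^[r] 0)
    (h1 : f.lift^[r] 0 ≤ 1 + k) : f.lift^[r] (f.lift^[r] 0) = f.lift^[r] 0 + (k + 1 : ℤ) := by
  obtain ⟨j, rfl⟩ : ∃ j, r = j + 1 := ⟨r - 1, by omega⟩
  rw [iterate_succ_apply f.lift j (f.lift^[j + 1] 0), f.lift_flat h0 h1, add_assoc]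
  have := f.iterate_add_int j (f.lift 0) (k + 1)
  push_cast at this
  rw [this, iterate_succ_apply]
  push_cast
  ring

theorem mul_rho_of_eq {x : ℝ} {j : ℕ} {k : ℤ} (h : f.lift^[j] x = x + k) : j * f.rho = k :=
  le_antisymm (f.mul_rho_le h.le) (f.le_mul_rho h.ge)

theorem mul_rho_of_return {r : ℕ} {k : ℤ} (hr : 0 < r) (h0 : f.g + k ≤ f.lift^[r] 0)
    (h1 : f.lift^[r] 0 ≤ 1 + k) : r * f.rho = (k + 1 : ℤ) :=
  f.mul_rho_of_eq (f.iterate_return hr h0 h1)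

/-! ### The height is the rotation number -/

/-- Before its first return to the interior of `γ` the orbit of `a` is coded faithfully, and at that
time its integer part lags behind the upper staircase. -/
theorem upperStair_le_kneading : BinSeq.Le (code (upperStair f.rho)) f.kneading := by
  have hs := isStaircase_upperStair f.rho_nonneg f.rho_le_half
  have hle := hs.code_le_code f.isStaircase_orbitStair f.orbitStair_le_upperStair
  rw [← circleCode_neg_half] at hle
  by_cases h : ∀ i, f.lift^[i] (-1 / 2) ≤ f.orbitStair i + f.g
  · rwa [show f.kneading = f.circleCode (-1 / 2) from
      funext fun r => f.kneading_eq_circleCode fun i _ => h i]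
  · push Not at h
    classical
    have hr := Nat.find_spec h
    have hmin := fun i (hi : i < Nat.find h) => not_lt.1 (Nat.find_min h hi)
    generalize Nat.find h = r at hr hmin
    have hg := f.half_le_g
    rcases r with _ | _ | j
    · rw [f.isStaircase_orbitStair.zero] at hr
      norm_num at hr
      linarith
    · rw [f.isStaircase_orbitStair.one, iterate_succ_neg_half] at hr
      norm_num at hr
      linarith
    · have hκ : ∀ i < j + 2, f.kneading i = f.circleCode (-1 / 2) i := fun i hi =>
        f.kneading_eq_circleCode fun l hl => hmin l (by omega)
      rw [iterate_succ_neg_half, orbitStair_succ] at hr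
      have hρ := f.mul_rho_of_return (k := ⌊f.lift^[j + 1] 0⌋) (r := j + 1) (by omega)
        (by linarith) (by linarith [Int.lt_floor_add_one (f.lift^[j + 1] 0)])
      have hne : ¬ ∀ i < j + 1, code (upperStair f.rho) i = f.circleCode (-1 / 2) i := fun hall => by
        have := hs.eq_of_code_eq f.isStaircase_orbitStair hall (j + 2) (by omega)
        rw [orbitStair_succ, upperStair_succ, mul_comm, hρ, Int.floor_intCast] at this
        omega
      rcases hle with heq | ⟨s, h1, h2, h3⟩
      · exact absurd (fun i _ => congrFun heq i) hne
      · have hsj : s < j + 2 := by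
          by_contra hsj
          exact hne fun i hi => h1 i (by omega)
        exact Or.inr ⟨s, fun i hi => (h1 i hi).trans (hκ i (by omega)).symm, by rwa [hκ s hsj], h3⟩

theorem circleCode_le_lowerStair (h : 0 < f.rho) :
    BinSeq.Le (f.circleCode (-1 / 2)) (code (lowerStair f.rho)) :=
  f.isStaircase_orbitStair.code_le_code (isStaircase_lowerStair h f.rho_le_half)
    f.lowerStair_le_orbitStair

/-- The kneading sequence lies between the codes of the two staircases of the rotation by `ρ`, and
`c_q0 c_q0 ⋯` between those of the rotation by `q`. -/
theorem height_eq_rho : f.height = f.rho := by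
  rw [height, heightOf]
  refine IsGLB.csInf_eq ⟨?_, ?_⟩ ⟨1 / 2, Or.inr rfl⟩
  · rintro x (⟨q, h0, h1, hlt, rfl⟩ | rfl)
    · by_contra hq
      push Not at hq
      have hq2 : q < 1 / 2 := by
        have : (q : ℝ) < ((1 / 2 : ℚ) : ℝ) := by
          push_cast; exact hq.trans_le f.rho_le_half
        exact_mod_cast this
      have hr := cast_pos_half h0 h1
      have hle : BinSeq.Le (f.circleCode (-1 / 2)) (code (upperStair q)) :=
        f.isStaircase_orbitStair.code_le_code (isStaircase_upperStair hr.1.le hr.2)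
          fun j => (upperStair_le_lowerStair hq j).trans (f.lowerStair_le_orbitStair j)
      exact (f.kneading_le_circleCode.trans
        (hle.trans (Or.inr (upperStair_lt_rep_cWord h0 hq2)))).not_lt hlt
    · exact f.rho_le_half
  · intro y hy
    by_contra hlt
    push Not at hlt
    have hhalf : y ≤ 1 / 2 := hy (Or.inr rfl)
    obtain ⟨q, hq1, hq2⟩ := exists_rat_btwn hlt
    have h0 : 0 < q := by exact_mod_cast f.rho_nonneg.trans_lt hq1
    have h1 : q < 1 / 2 := by
      have : (q : ℝ) < ((1 / 2 : ℚ) : ℝ) := by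
        push_cast; exact hq2.trans_le hhalf
      exact_mod_cast this
    have hr := cast_pos_half h0 h1.le
    have hle : BinSeq.Le (code (lowerStair q)) (code (upperStair f.rho)) :=
      (isStaircase_lowerStair hr.1 hr.2).code_le_code
        (isStaircase_upperStair f.rho_nonneg f.rho_le_half) (upperStair_le_lowerStair hq1)
    have := (rep_cWord_lt_lowerStair h0 h1).trans_le (hle.trans f.upperStair_le_kneading)
    exact absurd (hy (Or.inl ⟨q, h0, h1.le, this, rfl⟩)) (not_le.2 hq2)

theorem rho_lt_half (hf : f.Standing) : f.rho < 1 / 2 := by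
  refine lt_of_le_of_ne f.rho_le_half fun h => ?_
  have h1 := f.circleCode_le_lowerStair (by rw [h]; norm_num)
  rw [h, code_lowerStair_half] at h1
  exact (f.kneading_le_circleCode.trans h1).not_lt hf.not_renormalizable

theorem isCircleLift_lift : IsCircleLift f.lift f.outside := ⟨f.continuous_lift, f.coe_lift⟩

theorem hasRotationNumber_outside : HasRotationNumber f.outside f.height := by
  rw [height_eq_rho]
  refine ⟨⟨f.rho_nonneg, by linarith [f.rho_le_half]⟩, ⟨f.lift, f.isCircleLift_lift⟩, ?_⟩
  rintro F ⟨hF, hFB⟩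
  have hint : ∀ x, ∃ k : ℤ, F x - f.lift x = k := fun x => by
    have h : ((F x : ℝ) : UnitAddCircle) = ((f.lift x : ℝ) : UnitAddCircle) := by
      rw [hFB, f.coe_lift]
    obtain ⟨k, hk⟩ := coe_eq_coe_iff.1 h
    exact ⟨k, by rw [hk]; ring⟩
  -- Two continuous lifts differ by a constant: their difference is integer-valued.
  have hfl : Continuous fun x => round (F x - f.lift x) := by
    have hc : Continuous fun x => F x - f.lift x := hF.sub f.continuous_lift
    rw [Metric.continuous_iff] at hc ⊢
    intro x ε hε
    obtain ⟨δ, hδ, h⟩ := hc x 1 one_pos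
    refine ⟨δ, hδ, fun y hy => ?_⟩
    have h1 := h y hy
    obtain ⟨k, hk⟩ := hint x
    obtain ⟨l, hl⟩ := hint y
    simp only [hk, hl, round_intCast] at h1 ⊢
    rw [Int.dist_cast_real] at h1
    have : l = k := by
      rw [Int.dist_eq'] at h1
      have h2 : |l - k| < 1 := by exact_mod_cast h1
      rw [Int.abs_lt_one_iff] at h2
      omega
    rw [this, dist_self]
    exact hε
  obtain ⟨k, hk⟩ := hint 0
  refine ⟨k, ?_⟩
  have hconst : ∀ x, F x = k + f.lift x := fun x => by
    obtain ⟨l, hl⟩ := hint x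
    have : round (F x - f.lift x) = round (F 0 - f.lift 0) :=
      PreconnectedSpace.constant inferInstance hfl
    rw [hk, hl, round_intCast, round_intCast] at this
    rw [← this]
    linarith
  have hmul : F = CircleDeg1Lift.translate (Multiplicative.ofAdd (k : ℝ)) * f.lift := by
    ext x
    simp [hconst x]
  rw [hmul, CircleDeg1Lift.translationNumber_mul_of_commute,
    CircleDeg1Lift.translationNumber_translate, add_comm]
  · rfl
  · rw [CircleDeg1Lift.commute_iff_commute]
    intro x
    simp

end UnimodalMap

namespace UnimodalMap

variable (f : UnimodalMap)

/-! ### Rational rotation number: the return map -/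

/-- The lift of the `n`-th iterate of the outside map which has fixed points when the rotation
number is `q = m / n`. -/
noncomputable def ret (q : ℚ) (x : ℝ) : ℝ := f.lift^[q.den] x - q.num

variable {f} {q : ℚ}

theorem lift_iterate_den (x : ℝ) : f.lift^[q.den] x = f.ret q x + q.num := by
  rw [ret, sub_add_cancel]

theorem monotone_ret : Monotone (f.ret q) := fun _ _ h =>
  sub_le_sub_right (f.monotone_iterate q.den h) _

theorem continuous_ret : Continuous (f.ret q) := (f.continuous_iterate q.den).sub continuous_const

theorem ret_add_int (x : ℝ) (k : ℤ) : f.ret q (x + k) = f.ret q x + k := by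
  rw [ret, ret, iterate_add_int]; ring

theorem ret_iterate_comm (j : ℕ) (x : ℝ) : f.ret q (f.lift^[j] x) = f.lift^[j] (f.ret q x) := by
  rw [ret, ret, iterate_sub_int, ← iterate_add_apply, ← iterate_add_apply, add_comm]

theorem ret_iterate (i : ℕ) (x : ℝ) :
    (f.ret q)^[i] x = f.lift^[q.den * i] x - (q.num * i : ℤ) := by
  induction i with
  | zero => simp
  | succ i ih =>
    rw [iterate_succ_apply', ih, ret, iterate_sub_int, ← iterate_add_apply, mul_add, mul_one,
      add_comm q.den]
    push_cast
    ring

theorem lift_iterate_mul (i : ℕ) (x : ℝ) :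
    f.lift^[q.den * i] x = (f.ret q)^[i] x + (q.num * i : ℤ) := by
  rw [ret_iterate, sub_add_cancel]

theorem exists_eq_mul_of_mul_rho (hq : f.rho = q) {r : ℕ} {k : ℤ} (h : r * f.rho = k) :
    ∃ i : ℕ, r = q.den * i ∧ k = q.num * i := by
  rw [hq, mul_comm] at h
  obtain ⟨i, rfl⟩ := den_dvd_of_mul_eq_int h
  refine ⟨i, rfl, ?_⟩
  have : (k : ℝ) = q.num * i := by rw [← h, num_eq_mul_den]; push_cast; ring
  exact_mod_cast this

/-- The return map is constant on `γ`. -/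
theorem ret_of_mem_gamma {z : ℝ} {k : ℤ} (h0 : f.g + k ≤ z) (h1 : z ≤ 1 + k) :
    f.ret q z = f.ret q 0 + (k + 1 : ℤ) := by
  obtain ⟨d, hd⟩ : ∃ d, q.den = d + 1 := ⟨q.den - 1, by have := q.den_pos; omega⟩
  have := f.iterate_add_int d (f.lift 0) (k + 1)
  rw [ret, ret, hd, iterate_succ_apply, iterate_succ_apply, f.lift_flat h0 h1, add_assoc]
  push_cast at this ⊢
  rw [this]
  ring

/-- The orbit of `a` can return to `γ` only at multiples of `n`. -/
theorem exists_of_return (hq : f.rho = q) {r : ℕ} {k : ℤ} (hr : 0 < r)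
    (h0 : f.g + k ≤ f.lift^[r] 0) (h1 : f.lift^[r] 0 ≤ 1 + k) :
    ∃ i : ℕ, 0 < i ∧ r = q.den * i ∧ (f.ret q)^[i] 0 = f.lift^[r] 0 - (k + 1) := by
  obtain ⟨i, rfl, hk⟩ := exists_eq_mul_of_mul_rho hq (f.mul_rho_of_return hr h0 h1)
  refine ⟨i, Nat.pos_of_ne_zero fun h => by simp [h] at hr, rfl, ?_⟩
  rw [ret_iterate, ← hk]
  push_cast
  ring

theorem neg_half_le_floor : (-1 / 2 : ℝ) ≤ f.orbitStair 0 + f.g := by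
  have := f.half_le_g
  rw [f.isStaircase_orbitStair.zero]
  push_cast
  linarith

theorem le_floor_of_le_den (hq : f.rho = q) {i : ℕ} (hi : i ≤ q.den) :
    f.lift^[i] (-1 / 2) ≤ f.orbitStair i + f.g := by
  have hg := f.half_le_g
  rcases i with _ | _ | j
  · exact neg_half_le_floor
  · rw [f.isStaircase_orbitStair.one, iterate_succ_neg_half]
    norm_num
    linarith
  · rw [iterate_succ_neg_half, orbitStair_succ]
    by_contra h
    push Not at h
    obtain ⟨i, h1, h2, -⟩ := exists_of_return hq (k := ⌊f.lift^[j + 1] 0⌋) (r := j + 1)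
      (by omega) (by linarith) (by linarith [Int.lt_floor_add_one (f.lift^[j + 1] 0)])
    have : q.den * 1 ≤ q.den * i := Nat.mul_le_mul_left _ h1
    omega

theorem ret_iterate_nonneg (h : 0 ≤ f.ret q 0) (i : ℕ) : 0 ≤ (f.ret q)^[i] 0 := by
  induction i with
  | zero => exact le_rfl
  | succ i ih =>
    rw [iterate_succ_apply']
    exact h.trans (monotone_ret ih)

theorem ret_iterate_le (h : f.ret q 0 ≤ f.g - 1) {i : ℕ} (hi : 0 < i) :
    (f.ret q)^[i] 0 ≤ f.g - 1 := by
  induction i with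
  | zero => omega
  | succ i ih =>
    rw [iterate_succ_apply']
    rcases i.eq_zero_or_pos with rfl | hi
    · exact h
    · refine (monotone_ret (ih hi)).trans ?_
      rw [ret_of_mem_gamma (z := f.g - 1) (k := -1) (by push_cast; linarith)
        (by push_cast; linarith [f.g_lt_one])]
      simpa using h

theorem le_floor_of_not_mem (hq : f.rho = q) (h : ¬ (f.g - 1 < f.ret q 0 ∧ f.ret q 0 < 0))
    (i : ℕ) : f.lift^[i] (-1 / 2) ≤ f.orbitStair i + f.g := by
  have hg := f.half_le_g
  rcases i with _ | _ | j
  · exact neg_half_le_floor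
  · rw [f.isStaircase_orbitStair.one, iterate_succ_neg_half]
    norm_num
    linarith
  · rw [iterate_succ_neg_half, orbitStair_succ]
    by_contra hlt
    push Not at hlt
    have hfl := Int.lt_floor_add_one (f.lift^[j + 1] 0)
    obtain ⟨i, h1, h2, h3⟩ := exists_of_return hq (k := ⌊f.lift^[j + 1] 0⌋) (r := j + 1)
      (by omega) (by linarith) (by linarith)
    rcases le_or_gt 0 (f.ret q 0) with h0 | h0
    · have := ret_iterate_nonneg h0 i
      linarith
    · have := ret_iterate_le (not_lt.1 fun hlt => h ⟨hlt, h0⟩) h1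
      linarith

/-- The kneading sequence can be read off the circle unless `B^n(a)` is in the interior of `γ`. -/
theorem kneading_eq_of_not_mem (hq : f.rho = q)
    (h : ¬ (f.g - 1 < f.ret q 0 ∧ f.ret q 0 < 0)) : f.kneading = f.circleCode (-1 / 2) :=
  funext fun _ => f.kneading_eq_circleCode fun i _ => le_floor_of_not_mem hq h i

theorem kneading_eq_of_le_den (hq : f.rho = q) {j : ℕ} (hj : j ≤ q.den) :
    f.kneading j = f.circleCode (-1 / 2) j :=
  f.kneading_eq_circleCode fun _ hi => le_floor_of_le_den hq (hi.trans hj)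

/-- The orbit of `a` can be behind that of the rotation by `q` only at lattice points, that is at
multiples of `n`, and there it is not when `0 ≤ B^n(a)`. -/
theorem circleCode_eq_lhe (hq : f.rho = q) (h0 : 0 ≤ q) (h1 : q < 1 / 2)
    (h : 0 ≤ f.ret q 0) : f.circleCode (-1 / 2) = lhe q := by
  rw [lhe_eq h0 h1, circleCode_neg_half]
  congr 1
  funext j
  refine le_antisymm (by rw [← hq]; exact f.orbitStair_le_upperStair j) ?_
  rcases j with _ | j
  · rw [f.isStaircase_orbitStair.zero, upperStair_zero]
  rw [orbitStair_succ, upperStair_succ, Int.le_floor]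
  by_contra hlt
  push Not at hlt
  have h2 := f.mul_rho_le (x := 0) (k := ⌊(q : ℝ) * j⌋) (by rw [zero_add]; exact hlt.le)
  have h3 : j * f.rho = ⌊(q : ℝ) * j⌋ :=
    le_antisymm h2 (by rw [hq, mul_comm]; exact Int.floor_le _)
  obtain ⟨i, rfl, hk⟩ := exists_eq_mul_of_mul_rho hq h3
  rw [hk, lift_iterate_mul] at hlt
  linarith [ret_iterate_nonneg h i]

theorem ret_iterate_neg (h : f.ret q 0 < 0) {i : ℕ} (hi : 0 < i) : (f.ret q)^[i] 0 < 0 := by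
  induction i with
  | zero => omega
  | succ i ih =>
    rw [iterate_succ_apply']
    rcases i.eq_zero_or_pos with rfl | hi
    · exact h
    · exact (monotone_ret (ih hi).le).trans_lt h

theorem orbitStair_eq_lowerStair (hq : f.rho = q) (h : f.ret q 0 < 0) :
    f.orbitStair = lowerStair q := by
  funext j
  refine le_antisymm ?_ (by rw [← hq]; exact f.lowerStair_le_orbitStair j)
  rcases j with _ | _ | j
  · rw [f.isStaircase_orbitStair.zero, lowerStair_zero]
  · rw [f.isStaircase_orbitStair.one, lowerStair_one]
  rw [orbitStair_succ, lowerStair_add_two]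
  by_contra hlt
  have hle : ⌈(q : ℝ) * ((j : ℝ) + 1)⌉ ≤ ⌊f.lift^[j + 1] 0⌋ := by omega
  rw [Int.le_floor] at hle
  have h2 := f.le_mul_rho (x := 0) (k := ⌈(q : ℝ) * ((j : ℝ) + 1)⌉) (by rw [zero_add]; exact hle)
  have h3 : ((j + 1 : ℕ) : ℝ) * f.rho = ⌈(q : ℝ) * ((j : ℝ) + 1)⌉ :=
    le_antisymm (by rw [hq, mul_comm]; push_cast; exact Int.le_ceil _) h2
  obtain ⟨i, hj, hk⟩ := exists_eq_mul_of_mul_rho hq h3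
  rw [hk, hj, lift_iterate_mul] at hle
  linarith [ret_iterate_neg h (i := i) (Nat.pos_of_ne_zero fun h => by simp [h] at hj)]

theorem circleCode_eq_rhe (hq : f.rho = q) (h0 : 0 < q) (h1 : q < 1 / 2)
    (h : f.ret q 0 < 0) : f.circleCode (-1 / 2) = rhe q := by
  rw [rhe_eq h0 h1, circleCode_neg_half, orbitStair_eq_lowerStair hq h]

theorem kneading_eq_lhe_iff (hq : f.rho = q) (h0 : 0 < q) (h1 : q < 1 / 2) :
    f.kneading = lhe q ↔ 0 ≤ f.ret q 0 := by
  obtain ⟨d, hd⟩ : ∃ d, q.den = d + 1 := ⟨q.den - 1, by have := q.den_pos; omega⟩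
  constructor
  · intro hκ
    by_contra h
    have h2 := kneading_eq_of_le_den hq (j := d) (by omega)
    rw [circleCode_eq_rhe hq h0 h1 (not_le.1 h), hκ, rhe_eq h0 h1, lhe_eq h0.le h1,
      code_upperStair_den_sub_one h0 h1 hd, code_lowerStair_den_sub_one h0 h1 hd] at h2
    exact absurd h2 (by decide)
  · intro h
    rw [kneading_eq_of_not_mem hq (fun h' => absurd h (not_le.2 h'.2)),
      circleCode_eq_lhe hq h0.le h1 h]

theorem iterate_den_a (hq : f.rho = q) : f^[q.den] f.a = f.tau (f.ret q 0) := by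
  have h := f.tau_iterate (x := 0) (j := q.den) fun i hi => by
    have := le_floor_of_le_den hq (i := i + 1) (by omega)
    rwa [iterate_succ_neg_half, orbitStair_succ] at this
  rw [tau_zero] at h
  rw [h, lift_iterate_den, tau_add_int]

theorem ret_lt_one (hq : f.rho = q) : f.ret q 0 < 1 := by
  have h1 := f.orbitStair_le_upperStair (q.den + 1)
  rw [hq, upperStair_den_add_one, orbitStair_succ] at h1
  have h2 : ⌊f.lift^[q.den] 0⌋ < q.num + 1 := by omega
  rw [Int.floor_lt] at h2
  push_cast at h2
  rw [ret]
  linarith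

theorem neg_half_le_ret (hq : f.rho = q) (h0 : 0 < q) (h1 : q < 1 / 2) (h : f.ret q 0 < 0) :
    -1 / 2 ≤ f.ret q 0 := by
  have h2 := f.orbitStair_succ q.den
  have h3 := f.orbitStair_succ (q.den + 1)
  rw [orbitStair_eq_lowerStair hq h] at h2 h3
  rw [lowerStair_den_add_one] at h2
  rw [show q.den + 1 + 1 = q.den + 2 by ring, lowerStair_den_add_two h0 h1, iterate_succ_apply']
    at h3
  have h4 := Int.floor_le (f.lift^[q.den] 0)
  have h5 := Int.floor_le (f.lift (f.lift^[q.den] 0))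
  rw [← h2] at h4
  rw [← h3] at h5
  rw [ret]
  by_contra hlt
  have := f.lift_lt_one h4 (by push_cast; linarith)
  push_cast at this
  linarith

theorem tau_eq_a_iff {z : ℝ} (h0 : 0 ≤ z) (h1 : z < 1) : f.tau z = f.a ↔ z = 0 := by
  constructor
  · intro h
    rw [← f.unsc_zero] at h
    rcases le_total z (1 / 2) with h' | h'
    · rw [f.tau_lower (k := 0) (by simpa using h0) (by simpa using h'),
        f.unsc_strictMono.injective.eq_iff] at h
      simpa using h
    · rw [f.tau_upper (k := 0) (by simpa using h') (by simpa using h1.le),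
        f.unsc_strictMono.injective.eq_iff] at h
      simp at h
      linarith
  · rintro rfl
    exact f.tau_zero

theorem IsItinerary.shift {x : ℝ} {s : BinSeq} (h : f.IsItinerary x s) (r : ℕ) :
    f.IsItinerary (f^[r] x) (BinSeq.shift r s) := fun i => by
  rw [← iterate_add_apply]
  exact h (i + r)

theorem IsItinerary.of_right {x : ℝ} {s : BinSeq} (hx : x ∈ Icc f.c f.b) (h0 : s 0 = 1)
    (h : f.IsItinerary (f x) (BinSeq.shift 1 s)) : f.IsItinerary x s := by
  intro r
  rcases r with _ | r
  · rw [h0]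
    exact ⟨fun h => absurd h (by decide), fun _ => hx⟩
  · exact h r

/-- If `κ(f) = rhe(q)` then `B^n(a) = â_u`: otherwise the points `â` and `f^n(a)` would be distinct
points with a common itinerary. -/
theorem ret_eq_of_kneading_eq_rhe (hf : f.Standing) (hq : f.rho = q) (h0 : 0 < q)
    (h1 : q < 1 / 2) (hκ : f.kneading = rhe q) : f.ret q 0 = f.g - 1 := by
  obtain ⟨d, hd⟩ : ∃ d, q.den = d + 1 := ⟨q.den - 1, by have := q.den_pos; omega⟩
  have hneg : f.ret q 0 < 0 := by
    by_contra h
    have h2 := kneading_eq_of_le_den hq (j := d) (by omega)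
    rw [circleCode_eq_lhe hq h0.le h1 (not_lt.1 h), hκ, rhe_eq h0 h1, lhe_eq h0.le h1,
      code_upperStair_den_sub_one h0 h1 hd, code_lowerStair_den_sub_one h0 h1 hd] at h2
    exact absurd h2 (by decide)
  have hit := f.kneading_isItinerary
  rw [hκ] at hit
  have hA := hit.shift (q.den + 1)
  rw [iterate_succ_apply, f.map_b, iterate_den_a hq] at hA
  have hB : f.IsItinerary f.re (BinSeq.shift (q.den + 1) (rhe q)) := by
    refine IsItinerary.of_right ⟨f.re_mem.1.le, f.re_mem.2⟩ ?_ ?_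
    · rw [rhe_eq h0 h1, BinSeq.shift, zero_add, code_lowerStair_den_add_one h0 h1]
    · have h2 := hit.shift 2
      rw [iterate_succ_apply, f.map_b, iterate_one] at h2
      rw [f.map_re, BinSeq.shift_shift]
      convert h2 using 1
      funext i
      rw [BinSeq.shift, BinSeq.shift, rhe_eq h0 h1,
        ← code_lowerStair_add_den (q := q) (j := i + 2) (by omega)]
      congr 1
      ring
  have heq := hf.itinerary_injective (by rw [hκ]; exact not_isPeriodic_rhe h0 h1) _ (f.tau_mem _)
    _ ⟨(f.a_lt_c.trans f.re_mem.1).le, f.re_mem.2⟩ _ hA hB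
  have hlow := neg_half_le_ret hq h0 h1 hneg
  rw [f.tau_upper (k := -1) (by push_cast; linarith) (by push_cast; linarith),
    ← f.unsc_one_sub_g, f.unsc_strictMono.injective.eq_iff] at heq
  push_cast at heq
  linarith

theorem kneading_eq_rhe_iff (hf : f.Standing) (hq : f.rho = q) (h0 : 0 < q) (h1 : q < 1 / 2) :
    f.kneading = rhe q ↔ f.ret q 0 = f.g - 1 := by
  refine ⟨ret_eq_of_kneading_eq_rhe hf hq h0 h1, fun h => ?_⟩
  rw [kneading_eq_of_not_mem hq (fun h' => by linarith [h'.1]),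
    circleCode_eq_rhe hq h0 h1 (by linarith [f.g_lt_one])]

/-- The point `B^n(a)` does not lie strictly before `â_u`: the kneading sequence would be `rhe(q)`,
which only happens when `B^n(a) = â_u`. -/
theorem g_sub_one_le_ret (hf : f.Standing) (hq : f.rho = q) (h0 : 0 < q) (h1 : q < 1 / 2) :
    f.g - 1 ≤ f.ret q 0 := by
  by_contra h
  push Not at h
  have hκ : f.kneading = rhe q := by
    rw [kneading_eq_of_not_mem hq (fun h' => by linarith [h'.1]),
      circleCode_eq_rhe hq h0 h1 (by linarith [f.g_lt_one])]
  linarith [ret_eq_of_kneading_eq_rhe hf hq h0 h1 hκ]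

theorem lhe_zero_succ (j : ℕ) : lhe 0 (j + 1) = 0 := by
  rw [lhe, if_pos rfl]
  simp [BinSeq.prepend, BinSeq.rep, Nat.mod_one]

theorem not_isPeriodic_lhe_zero : ¬ BinSeq.IsPeriodic (lhe 0) := by
  rintro ⟨p, hp, h⟩
  obtain ⟨p, rfl⟩ : ∃ p', p = p' + 1 := ⟨p - 1, by omega⟩
  have := congrFun h 0
  rw [BinSeq.shift, zero_add, lhe_zero_succ] at this
  rw [lhe, if_pos rfl] at this
  simp [BinSeq.prepend] at this

theorem ret_zero_zero : f.ret 0 0 = f.lift 0 := by simp [ret]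

theorem kneading_eq_lhe_zero (hq : f.rho = (0 : ℚ)) : f.kneading = lhe 0 := by
  have h : 0 ≤ f.ret 0 0 := by rw [ret_zero_zero]; exact f.lift_zero_nonneg
  rw [kneading_eq_of_not_mem hq (fun h' => absurd h (not_le.2 h'.2)),
    circleCode_eq_lhe hq le_rfl (by norm_num) h]

/-- At height zero the points `a` and `f(a)` have the common itinerary `0^∞`, hence coincide. -/
theorem ret_zero_eq_zero (hf : f.Standing) (hq : f.rho = (0 : ℚ)) : f.ret 0 0 = 0 := by
  have hκ := kneading_eq_lhe_zero hq
  have hit := f.kneading_isItinerary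
  rw [hκ] at hit
  have h1 := hit.shift 1
  have h2 := hit.shift 2
  rw [iterate_one, f.map_b] at h1
  rw [iterate_succ_apply, f.map_b, iterate_one] at h2
  have hs : BinSeq.shift 2 (lhe 0) = BinSeq.shift 1 (lhe 0) := by
    funext i
    rw [BinSeq.shift, BinSeq.shift, lhe_zero_succ, lhe_zero_succ]
  rw [hs] at h2
  have h3 := hf.itinerary_injective (by rw [hκ]; exact not_isPeriodic_lhe_zero) _ f.a_mem _
    (f.mapsTo f.a_mem) _ h1 h2
  rw [ret_zero_zero, lift_zero, phi, unsc_zero, ← h3, scale_a]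

theorem isEarly_iff (hq : f.rho = q) (h0 : 0 < q) (h1 : q < 1 / 2) :
    f.IsEarly q ↔ 0 < f.ret q 0 := by
  rw [IsEarly, kneading_eq_lhe_iff hq h0 h1, iterate_den_a hq]
  constructor
  · rintro ⟨-, h2, h3⟩
    exact lt_of_le_of_ne h2 fun h => h3 (by rw [← h, tau_zero])
  · intro h
    refine ⟨h0, h.le, fun h2 => ?_⟩
    rw [tau_eq_a_iff h.le (ret_lt_one hq)] at h2
    exact h.ne' h2

/-! ### The first entry time -/

theorem iterate_aPt (r : ℕ) : f.outside^[r] f.aPt = ((f.lift^[r] 0 : ℝ) : UnitAddCircle) := by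
  rw [coe_lift_iterate, aPt, lower_a]
  rfl

theorem firstEntry_eq_top (h : ∀ r : ℕ, 0 < r → ∀ k : ℤ,
    f.g + k ≤ f.lift^[r] 0 → f.lift^[r] 0 ≤ 1 + k → False) : f.firstEntry = ⊤ := by
  rw [firstEntry, sInf_eq_top]
  rintro x ⟨r, hr, hm, -⟩
  rw [iterate_aPt, mem_gamma] at hm
  obtain ⟨k, h0, h1⟩ := hm
  exact (h r hr k h0 h1).elim

theorem firstEntry_eq_den (hq : f.rho = q) (h0 : f.g - 1 ≤ f.ret q 0) (h1 : f.ret q 0 ≤ 0) :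
    f.firstEntry = q.den := by
  apply le_antisymm
  · refine sInf_le ⟨q.den, q.den_pos, ?_, rfl⟩
    rw [iterate_aPt, mem_gamma]
    refine ⟨q.num - 1, ?_⟩
    rw [lift_iterate_den]
    push_cast
    constructor <;> linarith
  · refine le_sInf ?_
    rintro x ⟨r, hr, hm, rfl⟩
    rw [iterate_aPt, mem_gamma] at hm
    obtain ⟨k, h2, h3⟩ := hm
    obtain ⟨i, hi, rfl, -⟩ := exists_of_return hq hr h2 h3
    exact_mod_cast Nat.le_mul_of_pos_right _ hi

theorem not_return_of_pos (hq : f.rho = q) (h : 0 < f.ret q 0) (r : ℕ) (hr : 0 < r) (k : ℤ)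
    (h0 : f.g + k ≤ f.lift^[r] 0) (h1 : f.lift^[r] 0 ≤ 1 + k) : False := by
  obtain ⟨i, hi, -, h3⟩ := exists_of_return hq hr h0 h1
  obtain ⟨i, rfl⟩ : ∃ i', i = i' + 1 := ⟨i - 1, by omega⟩
  have := monotone_ret (f := f) (q := q) (ret_iterate_nonneg h.le i)
  rw [← iterate_succ_apply' (f.ret q), h3] at this
  linarith

end UnimodalMap

namespace UnimodalMap

variable (f : UnimodalMap)

/-! ### Arcs whose orbits avoid the interior of `γ` -/

/-- The images of the interval `[x, y]` under the iterates of the lift do not overlap any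
translate of the interior of `γ`. -/
def ArcAvoids (x y : ℝ) : Prop :=
  ∀ (s : ℕ) (k : ℤ), f.lift^[s] x < 1 + k → f.lift^[s] y ≤ f.g + k

namespace ArcAvoids

variable {f} {x y : ℝ}

theorem le_floor (h : f.ArcAvoids x y) (s : ℕ) :
    f.lift^[s] y ≤ ⌊f.lift^[s] x⌋ + f.g := by
  rw [add_comm]
  exact h s _ (by linarith [Int.lt_floor_add_one (f.lift^[s] x)])

theorem iterate_lt (h : f.ArcAvoids x y) (hxy : x < y) (s : ℕ) :
    f.lift^[s] x < f.lift^[s] y := by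
  induction s with
  | zero => exact hxy
  | succ s ih =>
    rw [iterate_succ_apply', iterate_succ_apply']
    exact f.lift_strictMonoOn (Int.floor_le _) ih (h.le_floor s)

theorem not_between (h : f.ArcAvoids x y) {s : ℕ} {k : ℤ} (h1 : f.lift^[s] x < k)
    (h2 : k < f.lift^[s] y) : False := by
  have := h s (k - 1) (by push_cast; linarith)
  push_cast at this
  linarith [f.g_lt_one]

theorem not_between_half (h : f.ArcAvoids x y) {s : ℕ} {k : ℤ}
    (h0 : (k : ℝ) ≤ f.lift^[s] x) (h1 : f.lift^[s] x < k + 1 / 2)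
    (h2 : k + 1 / 2 < f.lift^[s] y) (h3 : f.lift^[s] y ≤ k + f.g) : False := by
  apply h.not_between (s := s + 1) (k := k + 1) <;> rw [iterate_succ_apply'] <;> push_cast <;>
    rw [← f.lift_half]
  · exact f.lift_strictMonoOn h0 h1 (by linarith [f.half_le_g])
  · exact f.lift_strictMonoOn (by linarith) h2 h3

theorem not_between_tc (h : f.ArcAvoids x y) {s : ℕ} {k : ℤ}
    (h0 : (k : ℝ) ≤ f.lift^[s] x) (h1 : f.lift^[s] x < k + f.tc)
    (h2 : k + f.tc < f.lift^[s] y) (h3 : f.lift^[s] y ≤ k + f.g) : False := by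
  have e1 := f.tc_pos
  have e2 := f.tc_lt_half
  have e3 := f.half_le_g
  have hle : f.lift^[s + 1] y ≤ k + f.g := by
    have := h.le_floor (s + 1)
    rw [iterate_succ_apply' f.lift s x] at this
    rwa [Int.floor_eq_iff.2 ⟨f.lift_le h0, f.lift_lt_one h0 (by linarith)⟩] at this
  refine h.not_between_half (s := s + 1) (k := k) ?_ ?_ ?_ hle <;> rw [iterate_succ_apply']
  · exact f.lift_le h0
  · exact f.lift_lt_half h0 h1
  · rw [← f.lift_tc]
    exact f.lift_strictMonoOn (by linarith) h2 h3

theorem tau_iterate_left (h : f.ArcAvoids x y) (hxy : x < y) (s : ℕ) :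
    f^[s] (f.tau x) = f.tau (f.lift^[s] x) :=
  f.tau_iterate fun i _ => (h.iterate_lt hxy i).le.trans (h.le_floor i)

theorem tau_iterate_right (h : f.ArcAvoids x y) (hxy : x < y) (s : ℕ) :
    f^[s] (f.tau y) = f.tau (f.lift^[s] y) := by
  induction s with
  | zero => rfl
  | succ s ih =>
    rw [iterate_succ_apply', iterate_succ_apply', ih,
      f.tau_lift ((Int.floor_le _).trans (h.iterate_lt hxy s).le) (h.le_floor s)]

/-- The endpoints of an arc which avoids the interior of `γ` project to points with a common
itinerary. -/
theorem isItinerary (h : f.ArcAvoids x y) (hxy : x < y) :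
    f.IsItinerary (f.tau x) (f.circleCode x) ∧ f.IsItinerary (f.tau y) (f.circleCode x) := by
  have e1 := f.tc_pos
  have e2 := f.tc_lt_half
  have e3 := f.half_le_g
  have e4 := f.g_lt_one_sub_tc
  have hl : ∀ z : ℝ, ∀ k : ℤ, (k : ℝ) ≤ z → z ≤ k + f.tc → f.tau z ∈ Icc f.a f.c := by
    intro z k h0 h1
    refine ⟨(f.tau_mem z).1, ?_⟩
    rw [f.tau_lower h0 (by linarith)]
    exact f.unsc_le_c (by linarith)
  have hr : ∀ z : ℝ, ∀ k : ℤ, k + f.tc ≤ z → z ≤ k + f.g → f.tau z ∈ Icc f.c f.b := by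
    intro z k h0 h1
    refine ⟨?_, (f.tau_mem z).2⟩
    rcases le_total z (k + 1 / 2) with h2 | h2
    · rw [f.tau_lower (by linarith) h2]
      exact f.c_le_unsc (by linarith)
    · rw [f.tau_upper h2 (by linarith)]
      exact f.c_le_unsc (by linarith)
  have key : ∀ s, (f.circleCode x s = 0 → f.tau (f.lift^[s] x) ∈ Icc f.a f.c ∧
      f.tau (f.lift^[s] y) ∈ Icc f.a f.c) ∧ (f.circleCode x s = 1 →
      f.tau (f.lift^[s] x) ∈ Icc f.c f.b ∧ f.tau (f.lift^[s] y) ∈ Icc f.c f.b) := by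
    intro s
    have h0 := Int.floor_le (f.lift^[s] x)
    have h1 := Int.lt_floor_add_one (f.lift^[s] x)
    have h2 := (h.iterate_lt hxy s).le
    have h3 := h.le_floor s
    rcases lt_or_ge (f.lift^[s] x) (⌊f.lift^[s] x⌋ + f.tc) with h4 | h4
    · rw [f.circleCode_eq_zero h0 h4]
      refine ⟨fun _ => ⟨hl _ _ h0 h4.le, hl _ _ (h0.trans h2) ?_⟩, fun h => absurd h (by decide)⟩
      by_contra h5
      exact h.not_between_tc h0 h4 (not_le.1 h5) h3
    · rw [f.circleCode_eq_one h4 h1]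
      exact ⟨fun h => absurd h (by decide), fun _ => ⟨hr _ _ h4 (h2.trans h3),
        hr _ _ (h4.trans h2) h3⟩⟩
  constructor
  · intro s
    rw [h.tau_iterate_left hxy]
    exact ⟨fun hs => ((key s).1 hs).1, fun hs => ((key s).2 hs).1⟩
  · intro s
    rw [h.tau_iterate_right hxy]
    exact ⟨fun hs => ((key s).1 hs).2, fun hs => ((key s).2 hs).2⟩

theorem tau_ne (h : f.ArcAvoids x y) (hxy : x < y) : f.tau x ≠ f.tau y := by
  have hg := f.g_lt_one
  have h0 := Int.floor_le x
  have h3 := h.le_floor 0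
  simp only [iterate_zero, id] at h3
  intro heq
  rcases lt_or_ge x (⌊x⌋ + 1 / 2) with h4 | h4
  · have h5 : y ≤ ⌊x⌋ + 1 / 2 := by
      by_contra h5
      exact h.not_between_half (s := 0) h0 h4 (not_le.1 h5) h3
    rw [f.tau_lower h0 h4.le, f.tau_lower (h0.trans hxy.le) h5,
      f.unsc_strictMono.injective.eq_iff] at heq
    linarith
  · rw [f.tau_upper h4 (by linarith), f.tau_upper (h4.trans hxy.le) (by linarith),
      f.unsc_strictMono.injective.eq_iff] at heq
    linarith

end ArcAvoids

/-! ### Points falling into `γ` -/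

/-- The orbit of the point of the circle over `x` meets `γ`. -/
def Falls (x : ℝ) : Prop := ∃ (j : ℕ) (k : ℤ), f.g + k ≤ f.lift^[j] x ∧ f.lift^[j] x ≤ 1 + k

variable {f} {q : ℚ} {x y p P : ℝ}

theorem coe_mem_falls : (x : UnitAddCircle) ∈ f.falls ↔ f.Falls x := by
  rw [falls, mem_iUnion]
  refine exists_congr fun j => ?_
  rw [mem_preimage, ← coe_lift_iterate, mem_gamma]

theorem Falls.of_iterate {j : ℕ} (h : f.Falls (f.lift^[j] x)) : f.Falls x := by
  obtain ⟨i, k, h⟩ := h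
  rw [← iterate_add_apply] at h
  exact ⟨i + j, k, h⟩

theorem falls_add_int {k : ℤ} : f.Falls (x + k) ↔ f.Falls x := by
  rw [← coe_mem_falls, coe_add_int, coe_mem_falls]

theorem lt_of_not_falls (h : ¬ f.Falls x) {s : ℕ} {k : ℤ} (h1 : f.lift^[s] x ≤ 1 + k) :
    f.lift^[s] x < f.g + k := by
  by_contra h2
  exact h ⟨s, k, not_lt.1 h2, h1⟩

theorem gt_of_not_falls (h : ¬ f.Falls x) {s : ℕ} {k : ℤ} (h1 : f.g + k ≤ f.lift^[s] x) :
    1 + k < f.lift^[s] x := by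
  by_contra h2
  exact h ⟨s, k, h1, not_lt.1 h2⟩

/-! ### The cyclic order of the period `n` orbits -/

theorem exists_bezout (q : ℚ) : ∃ (r : ℕ) (k : ℤ), (r : ℤ) * q.num - k * q.den = 1 := by
  have hc : IsCoprime q.num (q.den : ℤ) := by
    rw [Int.isCoprime_iff_nat_coprime]
    simpa using q.reduced
  obtain ⟨u, v, h⟩ := hc
  have hd : 0 < (q.den : ℤ) := by exact_mod_cast q.den_pos
  refine ⟨(u % q.den).toNat, -v - u / q.den * q.num, ?_⟩
  rw [Int.toNat_of_nonneg (Int.emod_nonneg _ hd.ne')]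
  have := Int.emod_add_mul_ediv u q.den
  linear_combination h + q.num * this

/-- An exponent `r` with `r m ≡ 1` modulo `n`. -/
noncomputable def bezoutExp (q : ℚ) : ℕ := (exists_bezout q).choose

/-- The integer `k` with `r m - k n = 1` for the exponent `r` of `bezoutExp`. -/
noncomputable def bezoutInt (q : ℚ) : ℤ := (exists_bezout q).choose_spec.choose

theorem bezout_spec (q : ℚ) : (bezoutExp q : ℤ) * q.num - bezoutInt q * q.den = 1 :=
  (exists_bezout q).choose_spec.choose_spec

variable (f) in
/-- The lift of an iterate of the outside map which moves each point of a period `n` orbit to the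
next point of that orbit in the positive direction. -/
noncomputable def next (q : ℚ) (x : ℝ) : ℝ := f.lift^[bezoutExp q] x - bezoutInt q

theorem monotone_next : Monotone (f.next q) := fun _ _ h =>
  sub_le_sub_right (f.monotone_iterate _ h) _

theorem continuous_next : Continuous (f.next q) := (f.continuous_iterate _).sub continuous_const

theorem next_add_int (x : ℝ) (k : ℤ) : f.next q (x + k) = f.next q x + k := by
  rw [next, next, iterate_add_int]; ring

theorem next_iterate_add_int (i : ℕ) (x : ℝ) (k : ℤ) :
    (f.next q)^[i] (x + k) = (f.next q)^[i] x + k := by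
  induction i generalizing x with
  | zero => rfl
  | succ i ih => rw [iterate_succ_apply, iterate_succ_apply, next_add_int, ih]

theorem next_iterate_comm (j : ℕ) (x : ℝ) : f.next q (f.lift^[j] x) = f.lift^[j] (f.next q x) := by
  rw [next, next, iterate_sub_int, ← iterate_add_apply, ← iterate_add_apply, add_comm]

theorem ret_next_comm (x : ℝ) : f.ret q (f.next q x) = f.next q (f.ret q x) := by
  rw [ret, ret, ← next_iterate_comm, sub_eq_add_neg, sub_eq_add_neg, ← Int.cast_neg, next_add_int]

theorem ret_next_iterate_comm (i : ℕ) (x : ℝ) :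
    f.ret q ((f.next q)^[i] x) = (f.next q)^[i] (f.ret q x) := by
  induction i with
  | zero => rfl
  | succ i ih => rw [iterate_succ_apply', iterate_succ_apply', ret_next_comm, ih]

theorem next_iterate (i : ℕ) (x : ℝ) :
    (f.next q)^[i] x = f.lift^[bezoutExp q * i] x - (bezoutInt q * i : ℤ) := by
  induction i with
  | zero => simp
  | succ i ih =>
    rw [iterate_succ_apply', ih, next, iterate_sub_int, ← iterate_add_apply, mul_add, mul_one,
      add_comm (bezoutExp q)]
    push_cast
    ring

theorem next_iterate_den (hx : f.ret q x = x) : (f.next q)^[q.den] x = x + 1 := by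
  rw [next_iterate, mul_comm, lift_iterate_mul, iterate_fixed hx]
  have := bezout_spec q
  have h : ((bezoutExp q : ℤ) * q.num - bezoutInt q * q.den : ℝ) = 1 := by exact_mod_cast this
  push_cast at h ⊢
  linarith

theorem ret_next_of_fixed (hx : f.ret q x = x) : f.ret q (f.next q x) = f.next q x := by
  rw [ret_next_comm, hx]

theorem ret_next_iterate_of_fixed (hx : f.ret q x = x) (i : ℕ) :
    f.ret q ((f.next q)^[i] x) = (f.next q)^[i] x := by
  rw [ret_next_iterate_comm, hx]

theorem ret_iterate_of_fixed (hx : f.ret q x = x) (j : ℕ) :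
    f.ret q (f.lift^[j] x) = f.lift^[j] x := by
  rw [ret_iterate_comm, hx]

theorem lt_next (hx : f.ret q x = x) : x < f.next q x := by
  by_contra h
  push Not at h
  have hi : ∀ i, (f.next q)^[i] x ≤ x := fun i => by
    induction i with
    | zero => exact le_rfl
    | succ i ih =>
      rw [iterate_succ_apply']
      exact (monotone_next ih).trans h
  have := hi q.den
  rw [next_iterate_den hx] at this
  linarith

theorem iterate_lt_of_fixed (hx : f.ret q x = x) (hy : f.ret q y = y) (h : x < y) (j : ℕ) :
    f.lift^[j] x < f.lift^[j] y := by
  refine lt_of_le_of_ne (f.monotone_iterate j h.le) fun heq => ?_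
  have hd : q.den * j = (q.den - 1) * j + j := by
    obtain ⟨d, hd⟩ : ∃ d, q.den = d + 1 := ⟨q.den - 1, by have := q.den_pos; omega⟩
    rw [hd]; simp; ring
  have h1 := lift_iterate_mul (f := f) (q := q) j x
  have h2 := lift_iterate_mul (f := f) (q := q) j y
  rw [hd, iterate_add_apply, iterate_fixed hx] at h1
  rw [hd, iterate_add_apply, iterate_fixed hy, ← heq, h1] at h2
  linarith

theorem next_iterate_lt_of_fixed (hx : f.ret q x = x) (hy : f.ret q y = y) (h : x < y) (i : ℕ) :
    (f.next q)^[i] x < (f.next q)^[i] y := by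
  rw [next_iterate, next_iterate]
  exact sub_lt_sub_right (iterate_lt_of_fixed hx hy h _) _

/-! ### The periodic orbit through `γ` -/

variable (f) in
/-- The points of the line over the orbit of `B^n(a)`. When the orbit of `a` returns to `γ`, this
is the periodic orbit passing through `γ`. -/
def OnOrbit (q : ℚ) (z : ℝ) : Prop := ∃ (t : ℕ) (l : ℤ), z = f.lift^[t] (f.ret q 0) + l

theorem OnOrbit.iterate (h : f.OnOrbit q P) (j : ℕ) : f.OnOrbit q (f.lift^[j] P) := by
  obtain ⟨t, l, rfl⟩ := h
  exact ⟨j + t, l, by rw [iterate_add_int, iterate_add_apply]⟩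

theorem OnOrbit.next (h : f.OnOrbit q P) : f.OnOrbit q (f.next q P) := by
  obtain ⟨t, l, h⟩ := h.iterate (bezoutExp q)
  exact ⟨t, l - bezoutInt q, by rw [UnimodalMap.next, h]; push_cast; ring⟩

theorem OnOrbit.next_iterate (h : f.OnOrbit q P) (i : ℕ) : f.OnOrbit q ((f.next q)^[i] P) := by
  induction i with
  | zero => exact h
  | succ i ih => rw [iterate_succ_apply']; exact ih.next

theorem OnOrbit.add_int (h : f.OnOrbit q P) (k : ℤ) : f.OnOrbit q (P + k) := by
  obtain ⟨t, l, rfl⟩ := h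
  exact ⟨t, l + k, by push_cast; ring⟩

theorem onOrbit_ret : f.OnOrbit q (f.ret q 0) := ⟨0, 0, by simp⟩

variable (f) in
/-- The rotation number is `q = m / n` and `B^n(a)` lies in `γ`. -/
structure ReturnsToGamma (q : ℚ) : Prop where
  rho_eq : f.rho = q
  g_le : f.g - 1 ≤ f.ret q 0
  le_zero : f.ret q 0 ≤ 0

namespace ReturnsToGamma

theorem ret_ret (h : f.ReturnsToGamma q) : f.ret q (f.ret q 0) = f.ret q 0 := by
  have := ret_of_mem_gamma (f := f) (q := q) (z := f.ret q 0) (k := -1)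
    (by push_cast; linarith [h.g_le]) (by push_cast; linarith [h.le_zero])
  simpa using this

theorem ret_of_onOrbit (h : f.ReturnsToGamma q) (hP : f.OnOrbit q P) : f.ret q P = P := by
  obtain ⟨t, l, rfl⟩ := hP
  rw [ret_add_int, ret_iterate_comm, h.ret_ret]

theorem falls_of_onOrbit (h : f.ReturnsToGamma q) (hP : f.OnOrbit q P) : f.Falls P := by
  obtain ⟨t, l, rfl⟩ := hP
  rw [falls_add_int]
  have hd : q.den * t = (q.den - 1) * t + t := by
    obtain ⟨d, hd⟩ : ∃ d, q.den = d + 1 := ⟨q.den - 1, by have := q.den_pos; omega⟩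
    rw [hd]; simp; ring
  refine ⟨(q.den - 1) * t, q.num * t - 1, ?_⟩
  rw [← iterate_add_apply, ← hd, lift_iterate_mul, iterate_fixed h.ret_ret]
  have h1 := h.g_le
  have h2 := h.le_zero
  push_cast
  constructor <;> linarith

/-- There is no translate of `B^n(a)` strictly between two consecutive points of its orbit. -/
theorem not_between (h : f.ReturnsToGamma q) (hP : f.OnOrbit q P) {l : ℤ}
    (h1 : P < f.ret q 0 + l) (h2 : f.ret q 0 + l < f.next q P) : False := by
  obtain ⟨t, l', rfl⟩ := hP
  rw [next_add_int, UnimodalMap.next, ← iterate_add_apply] at h2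
  have e1 := f.mul_rho_le (x := f.ret q 0) (j := t) (k := l - l') (by push_cast; linarith)
  have e2 := f.le_mul_rho (x := f.ret q 0) (j := bezoutExp q + t) (k := l - l' + bezoutInt q)
    (by push_cast; linarith)
  have hb := bezout_spec q
  have hn : (0 : ℝ) < q.den := by exact_mod_cast q.den_pos
  have hm := num_eq_mul_den q
  rw [← h.rho_eq] at hm
  have e1' : (t : ℤ) * q.num ≤ (l - l') * q.den := by
    have : (t : ℝ) * q.num ≤ ((l - l' : ℤ) : ℝ) * q.den := by rw [hm]; nlinarith
    exact_mod_cast this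
  have e2' : (l - l' + bezoutInt q) * q.den ≤ ((bezoutExp q + t : ℕ) : ℤ) * q.num := by
    have : ((l - l' + bezoutInt q : ℤ) : ℝ) * q.den ≤ ((bezoutExp q + t : ℕ) : ℝ) * q.num := by
      rw [hm]; nlinarith
    exact_mod_cast this
  push_cast at e2'
  have hcase : (l - l') * q.den = t * q.num ∨
      (l - l' + bezoutInt q) * q.den = ((bezoutExp q + t : ℕ) : ℤ) * q.num := by
    push_cast
    have : (l - l') * (q.den : ℤ) ≤ t * q.num + 1 := by linarith
    rcases e1'.eq_or_lt with h | h
    · exact Or.inl h.symm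
    · right
      have : (l - l') * (q.den : ℤ) = t * q.num + 1 := by omega
      linarith
  have hper : ∀ (s : ℕ) (k : ℤ), k * (q.den : ℤ) = s * q.num →
      f.lift^[s] (f.ret q 0) = f.ret q 0 + k := by
    intro s k hk
    have hk' : (s : ℝ) * f.rho = k := by
      have : (k : ℝ) * q.den = s * q.num := by exact_mod_cast hk
      rw [hm] at this
      have h3 : (k : ℝ) * q.den = (s * f.rho) * q.den := by linarith
      exact (mul_right_cancel₀ hn.ne' h3).symm
    obtain ⟨i, rfl, rfl⟩ := exists_eq_mul_of_mul_rho h.rho_eq hk'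
    rw [lift_iterate_mul, iterate_fixed h.ret_ret]
  rcases hcase with hc | hc
  · have := hper t (l - l') hc
    push_cast at this
    linarith
  · have := hper _ _ hc
    push_cast at this
    linarith

theorem not_falls_of_fixed (h : f.ReturnsToGamma q) (hP : f.OnOrbit q P) (hp : f.ret q p = p)
    (h1 : P < p) (h2 : p < f.next q P) : ¬ f.Falls p := by
  rintro ⟨j, k, h3, h4⟩
  have h5 := ret_of_mem_gamma (q := q) h3 h4
  rw [ret_iterate_of_fixed hp] at h5
  have h6 := iterate_lt_of_fixed (h.ret_of_onOrbit hP) hp h1 j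
  have h7 := iterate_lt_of_fixed hp (h.ret_of_onOrbit hP.next) h2 j
  rw [h5] at h6 h7
  rw [← next_iterate_comm] at h7
  exact h.not_between (hP.iterate j) h6 h7

/-- An arc between two consecutive points of the orbit through `γ` avoids the interior of `γ` under
iteration, provided its endpoints are on the correct side of the orbit whenever they enter `γ`. -/
theorem arcAvoids (h : f.ReturnsToGamma q) (hP : f.OnOrbit q P) (hx : P ≤ x)
    (hy : y ≤ f.next q P)
    (hx' : ∀ (s : ℕ) (k : ℤ), f.lift^[s] x < 1 + k → f.lift^[s] x < f.ret q 0 + (k + 1))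
    (hy' : ∀ (s : ℕ) (k : ℤ), f.g + k < f.lift^[s] y → f.ret q 0 + (k + 1) < f.lift^[s] y) :
    f.ArcAvoids x y := by
  intro s k h1
  by_contra h2
  push Not at h2
  have h3 := (f.monotone_iterate s hx).trans_lt (hx' s k h1)
  have h4 := (hy' s k h2).trans_le (f.monotone_iterate s hy)
  rw [← next_iterate_comm] at h4
  exact h.not_between (hP.iterate s) (l := k + 1) (by push_cast; exact h3) (by push_cast; exact h4)

theorem left_of_not_falls (h : f.ReturnsToGamma q) (hx : ¬ f.Falls x) (s : ℕ) (k : ℤ)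
    (h1 : f.lift^[s] x < 1 + k) : f.lift^[s] x < f.ret q 0 + (k + 1) := by
  have := lt_of_not_falls hx h1.le
  linarith [h.g_le]

theorem right_of_not_falls (h : f.ReturnsToGamma q) (hx : ¬ f.Falls x) (s : ℕ) (k : ℤ)
    (h1 : f.g + k < f.lift^[s] x) : f.ret q 0 + (k + 1) < f.lift^[s] x := by
  have := gt_of_not_falls hx h1.le
  linarith [h.le_zero]

theorem arcAvoids_of_not_falls (h : f.ReturnsToGamma q) (hP : f.OnOrbit q P) (hx : P ≤ x)
    (hy : y ≤ f.next q P) (hx' : ¬ f.Falls x) (hy' : ¬ f.Falls y) : f.ArcAvoids x y :=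
  h.arcAvoids hP hx hy (h.left_of_not_falls hx') (h.right_of_not_falls hy')

/-- Every point which does not fall into `γ` lies strictly between two consecutive points of the
orbit through `γ`. -/
theorem exists_between (h : f.ReturnsToGamma q) (hx : ¬ f.Falls x) :
    ∃ i < q.den, ∃ l : ℤ, (f.next q)^[i] (f.ret q 0) + l < x ∧
      x < (f.next q)^[i + 1] (f.ret q 0) + l := by
  classical
  have hne : ∀ i (l : ℤ), x ≠ (f.next q)^[i] (f.ret q 0) + l := fun i l he => hx (by
    rw [he]
    exact h.falls_of_onOrbit ((onOrbit_ret.next_iterate i).add_int l))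
  have h1 := Int.floor_le (x - f.ret q 0)
  have h2 := Int.lt_floor_add_one (x - f.ret q 0)
  have hex : ∃ i, x < (f.next q)^[i] (f.ret q 0) + ⌊x - f.ret q 0⌋ :=
    ⟨q.den, by rw [next_iterate_den h.ret_ret]; linarith⟩
  have hspec := Nat.find_spec hex
  have hle : Nat.find hex ≤ q.den := Nat.find_min' hex (by
    rw [next_iterate_den h.ret_ret]; linarith)
  have hmin := fun i (hi : i < Nat.find hex) => not_lt.1 (Nat.find_min hex hi)
  generalize Nat.find hex = i at hspec hle hmin
  rcases i with _ | i
  · rw [iterate_zero, id] at hspec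
    linarith
  · exact ⟨i, by omega, _, lt_of_le_of_ne (hmin i (by omega)) (hne i _).symm, hspec⟩

end ReturnsToGamma

/-! ### Attraction to the orbit through `γ` -/

theorem falls_of_next_iterate {i j : ℕ} {l : ℤ}
    (h1 : f.g + l ≤ (f.next q)^[j] ((f.ret q)^[i] x))
    (h2 : (f.next q)^[j] ((f.ret q)^[i] x) ≤ 1 + l) : f.Falls x := by
  rw [next_iterate, ret_iterate, iterate_sub_int, ← iterate_add_apply] at h1 h2
  refine ⟨bezoutExp q * j + q.den * i, l + q.num * i + bezoutInt q * j, ?_, ?_⟩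
  · push_cast at h1 ⊢
    linarith
  · push_cast at h2 ⊢
    linarith

theorem sign_ret_sub {Y Z z : ℝ} (hno : ∀ y ∈ Ioo Y Z, f.ret q y ≠ y) (hz : z ∈ Ioo Y Z)
    (hx : x ∈ Ioo Y Z) : (f.ret q z < z ↔ f.ret q x < x) := by
  have key : ∀ u ∈ Ioo Y Z, ∀ v ∈ Ioo Y Z, f.ret q u < u → f.ret q v < v := by
    intro u hu v hv h
    by_contra h2
    obtain ⟨y, hy, hy2⟩ := isPreconnected_Ioo.intermediate_value₂ hu hv
      (continuous_ret (f := f) (q := q)).continuousOn continuousOn_id h.le (not_lt.1 h2)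
    exact hno y hy hy2
  exact ⟨key z hz x hx, key x hx z hz⟩

theorem tendsto_ret_iterate_of_lt {Y Z : ℝ} (hZ : f.ret q Z = Z)
    (hlt : ∀ y ∈ Ioo Y Z, y < f.ret q y) (hx : x ∈ Ioo Y Z) :
    Tendsto (fun i => (f.ret q)^[i] x) atTop (𝓝 Z) := by
  have hle : ∀ i, (f.ret q)^[i] x ≤ Z := fun i => by
    have := (monotone_ret (f := f) (q := q)).iterate i hx.2.le
    rwa [iterate_fixed hZ] at this
  have hmono : Monotone fun i => (f.ret q)^[i] x :=
    monotone_ret.monotone_iterate_of_le_map (hlt x hx).le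
  have hbdd : BddAbove (range fun i => (f.ret q)^[i] x) := ⟨Z, by rintro _ ⟨i, rfl⟩; exact hle i⟩
  have hlim := tendsto_atTop_ciSup hmono hbdd
  have hfix := isFixedPt_of_tendsto_iterate hlim continuous_ret.continuousAt
  have h1 : x ≤ ⨆ i, (f.ret q)^[i] x := le_ciSup hbdd 0
  have h2 : ⨆ i, (f.ret q)^[i] x ≤ Z := ciSup_le hle
  rcases h2.eq_or_lt with h3 | h3
  · rwa [h3] at hlim
  · have := hlt _ ⟨hx.1.trans_le h1, h3⟩
    rw [hfix] at this
    exact absurd this (lt_irrefl _)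

theorem tendsto_ret_iterate_of_gt {Y Z : ℝ} (hY : f.ret q Y = Y)
    (hlt : ∀ y ∈ Ioo Y Z, f.ret q y < y) (hx : x ∈ Ioo Y Z) :
    Tendsto (fun i => (f.ret q)^[i] x) atTop (𝓝 Y) := by
  have hle : ∀ i, Y ≤ (f.ret q)^[i] x := fun i => by
    have := (monotone_ret (f := f) (q := q)).iterate i hx.1.le
    rwa [iterate_fixed hY] at this
  have hmono : Antitone fun i => (f.ret q)^[i] x :=
    monotone_ret.antitone_iterate_of_map_le (hlt x hx).le
  have hbdd : BddBelow (range fun i => (f.ret q)^[i] x) := ⟨Y, by rintro _ ⟨i, rfl⟩; exact hle i⟩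
  have hlim := tendsto_atTop_ciInf hmono hbdd
  have hfix := isFixedPt_of_tendsto_iterate hlim continuous_ret.continuousAt
  have h1 : ⨅ i, (f.ret q)^[i] x ≤ x := ciInf_le hbdd 0
  have h2 : Y ≤ ⨅ i, (f.ret q)^[i] x := le_ciInf hle
  rcases h2.eq_or_lt with h3 | h3
  · rwa [← h3] at hlim
  · have := hlt _ ⟨h3, h1.trans_lt hx.2⟩
    rw [hfix] at this
    exact absurd this (lt_irrefl _)

theorem continuous_next_iterate (j : ℕ) : Continuous (f.next q)^[j] :=
  continuous_next.iterate j

theorem monotone_next_iterate (j : ℕ) : Monotone (f.next q)^[j] :=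
  monotone_next.iterate j

/-- The orbit through `γ` attracts from the left, up to the nearest point of another period `n`
orbit: the return map pushes `â_u` to the right. -/
theorem falls_of_right {Y Z : ℝ} {j : ℕ} {l : ℤ} (hw : f.g - 1 < f.ret q 0)
    (hw' : f.ret q 0 ≤ 0) (hZ : f.ret q Z = Z)
    (hno : ∀ y ∈ Ioo Y Z, f.ret q y ≠ y) (hLZ : (f.next q)^[j] Z = f.ret q 0 + 1 + l)
    (hLY : (f.next q)^[j] Y < f.g + l) (hx : x ∈ Ioo Y Z) : f.Falls x := by
  have hYZ : Y ≤ Z := hx.1.le.trans hx.2.le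
  obtain ⟨z, hz, hLz⟩ := intermediate_value_Icc hYZ
    (continuous_next_iterate (f := f) (q := q) j).continuousOn
    (show f.g + l ∈ Icc _ _ from ⟨hLY.le, by rw [hLZ]; linarith⟩)
  have hret : f.ret q (f.g + l) = f.ret q 0 + (l + 1 : ℤ) :=
    ret_of_mem_gamma le_rfl (by linarith [f.g_lt_one])
  have hzz : z < f.ret q z := by
    by_contra h
    have h2 := monotone_next_iterate (f := f) (q := q) j (not_lt.1 h)
    rw [← ret_next_iterate_comm, hLz, hret] at h2
    push_cast at h2
    linarith
  have hz' : z ∈ Ioo Y Z := by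
    refine ⟨lt_of_le_of_ne hz.1 ?_, lt_of_le_of_ne hz.2 ?_⟩
    · rintro rfl
      exact hLY.ne hLz
    · rintro rfl
      rw [hLZ] at hLz
      linarith
  have hlt : ∀ y ∈ Ioo Y Z, y < f.ret q y := fun y hy => by
    have := (sign_ret_sub hno hz' hy).not
    exact lt_of_le_of_ne (not_lt.1 (this.1 hzz.le.not_gt)) (hno y hy).symm
  have hlim := (continuous_next_iterate (f := f) (q := q) j).continuousAt.tendsto.comp
    (tendsto_ret_iterate_of_lt hZ hlt hx)
  rw [hLZ] at hlim
  obtain ⟨i, hi⟩ := (hlim.eventually (lt_mem_nhds (show f.g + l < f.ret q 0 + 1 + l by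
    linarith))).exists
  refine falls_of_next_iterate (i := i) (j := j) (l := l) (le_of_lt hi) ?_
  have h3 := (monotone_ret (f := f) (q := q)).iterate i hx.2.le
  rw [iterate_fixed hZ] at h3
  have h4 := monotone_next_iterate (f := f) (q := q) j h3
  rw [hLZ] at h4
  linarith

/-- The orbit through `γ` attracts from the right, up to the nearest point of another period `n`
orbit: the return map pushes `a` to the left. -/
theorem falls_of_left {Y Z : ℝ} {j : ℕ} {l : ℤ} (hw : f.g - 1 ≤ f.ret q 0)
    (hw' : f.ret q 0 < 0) (hY : f.ret q Y = Y)
    (hno : ∀ y ∈ Ioo Y Z, f.ret q y ≠ y) (hLY : (f.next q)^[j] Y = f.ret q 0 + 1 + l)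
    (hLZ : 1 + l < (f.next q)^[j] Z) (hx : x ∈ Ioo Y Z) : f.Falls x := by
  have hYZ : Y ≤ Z := hx.1.le.trans hx.2.le
  obtain ⟨z, hz, hLz⟩ := intermediate_value_Icc hYZ
    (continuous_next_iterate (f := f) (q := q) j).continuousOn
    (show (1 : ℝ) + l ∈ Icc _ _ from ⟨by rw [hLY]; linarith, hLZ.le⟩)
  have hret : f.ret q (1 + l) = f.ret q 0 + (l + 1 : ℤ) :=
    ret_of_mem_gamma (by linarith [f.g_lt_one]) le_rfl
  have hzz : f.ret q z < z := by
    by_contra h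
    have h2 := monotone_next_iterate (f := f) (q := q) j (not_lt.1 h)
    rw [← ret_next_iterate_comm, hLz, hret] at h2
    push_cast at h2
    linarith
  have hz' : z ∈ Ioo Y Z := by
    refine ⟨lt_of_le_of_ne hz.1 ?_, lt_of_le_of_ne hz.2 ?_⟩
    · rintro rfl
      rw [hLY] at hLz
      linarith
    · rintro rfl
      exact hLZ.ne hLz.symm
  have hlt : ∀ y ∈ Ioo Y Z, f.ret q y < y := fun y hy => (sign_ret_sub hno hz' hy).1 hzz
  have hlim := (continuous_next_iterate (f := f) (q := q) j).continuousAt.tendsto.comp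
    (tendsto_ret_iterate_of_gt hY hlt hx)
  rw [hLY] at hlim
  obtain ⟨i, hi⟩ := (hlim.eventually (gt_mem_nhds (show f.ret q 0 + 1 + l < 1 + l by
    linarith))).exists
  refine falls_of_next_iterate (i := i) (j := j) (l := l) ?_ (le_of_lt hi)
  have h3 := (monotone_ret (f := f) (q := q)).iterate i hx.1.le
  rw [iterate_fixed hY] at h3
  have h4 := monotone_next_iterate (f := f) (q := q) j h3
  rw [hLY] at h4
  linarith

end UnimodalMap

namespace UnimodalMap

variable {f : UnimodalMap} {q : ℚ} {x y p P : ℝ}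

/-! ### Points with a common itinerary -/

theorem cast_circleCode (x : ℝ) (j : ℕ) :
    ((f.circleCode x j : ℕ) : ℤ) = ⌊f.lift^[j + 2] x⌋ - ⌊f.lift^[j] x⌋ := by
  rw [circleCode_apply, iterate_succ_apply', iterate_succ_apply']
  have h0 := Int.floor_le (f.lift^[j] x)
  have h1 : ⌊f.lift^[j] x⌋ ≤ ⌊f.lift (f.lift (f.lift^[j] x))⌋ :=
    Int.le_floor.2 (f.lift_le (f.lift_le h0))
  have h2 : ⌊f.lift (f.lift (f.lift^[j] x))⌋ < ⌊f.lift^[j] x⌋ + 2 :=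
    Int.floor_lt.2 (by
      push_cast; exact f.lift_lift_lt_two (Int.lt_floor_add_one (f.lift^[j] x)).le)
  split_ifs with h
  · simp [h]
  · simp only [Fin.val_one, Nat.cast_one]
    omega

theorem sum_circleCode (x : ℝ) (r : ℕ) :
    ((∑ i ∈ Finset.range r, (f.circleCode x i : ℕ) : ℕ) : ℤ) =
      ⌊f.lift^[r + 1] x⌋ + ⌊f.lift^[r] x⌋ - ⌊f.lift x⌋ - ⌊x⌋ := by
  induction r with
  | zero => simp
  | succ r ih =>
    rw [Finset.sum_range_succ, Nat.cast_add, ih, cast_circleCode]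
    ring

theorem isPeriodicPt_tau (hp : f.ret q p = p) (h : f^[q.den] (f.tau p) = f.tau (f.lift^[q.den] p)) :
    IsPeriodicPt f q.den (f.tau p) := by
  rw [IsPeriodicPt, IsFixedPt, h, lift_iterate_den, tau_add_int, hp]

theorem circleCode_zero : f.circleCode 0 = BinSeq.shift 1 (f.circleCode (-1 / 2)) := by
  rw [← circleCode_iterate, iterate_one, lift_neg_half]

/-- A point strictly between two points with a common itinerary never reaches `a`. -/
theorem iterate_ne_a_of_between {x y z : ℝ} {s : BinSeq} (hx : x ∈ Icc f.a f.b)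
    (hz : z ∈ Icc f.a f.b) (hxs : f.IsItinerary x s) (hzs : f.IsItinerary z s) (h1 : x < y)
    (h2 : y < z) (i : ℕ) : f^[i] y ≠ f.a := by
  have key : (f^[i] x < f^[i] y ∧ f^[i] y < f^[i] z) ∨
      (f^[i] z < f^[i] y ∧ f^[i] y < f^[i] x) := by
    induction i with
    | zero => exact Or.inl ⟨h1, h2⟩
    | succ i ih =>
      rw [iterate_succ_apply', iterate_succ_apply', iterate_succ_apply']
      by_cases hs : s i = 0
      · have hx := (hxs i).1 hs
        have hz := (hzs i).1 hs
        rcases ih with ⟨h3, h4⟩ | ⟨h3, h4⟩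
        · have hy : f^[i] y ∈ Icc f.a f.c := ⟨hx.1.trans h3.le, h4.le.trans hz.2⟩
          exact Or.inl ⟨f.strictMonoOn hx hy h3, f.strictMonoOn hy hz h4⟩
        · have hy : f^[i] y ∈ Icc f.a f.c := ⟨hz.1.trans h3.le, h4.le.trans hx.2⟩
          exact Or.inr ⟨f.strictMonoOn hz hy h3, f.strictMonoOn hy hx h4⟩
      · have hx := (hxs i).2 (BinSeq.eq_one_of_ne_zero hs)
        have hz := (hzs i).2 (BinSeq.eq_one_of_ne_zero hs)
        rcases ih with ⟨h3, h4⟩ | ⟨h3, h4⟩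
        · have hy : f^[i] y ∈ Icc f.c f.b := ⟨hx.1.trans h3.le, h4.le.trans hz.2⟩
          exact Or.inr ⟨f.strictAntiOn hy hz h4, f.strictAntiOn hx hy h3⟩
        · have hy : f^[i] y ∈ Icc f.c f.b := ⟨hz.1.trans h3.le, h4.le.trans hx.2⟩
          exact Or.inl ⟨f.strictAntiOn hy hx h4, f.strictAntiOn hz hy h3⟩
  have h3 := (f.iterate_mem hx i).1
  have h4 := (f.iterate_mem hz i).1
  rcases key with ⟨h5, -⟩ | ⟨h5, -⟩
  exacts [(h3.trans_lt h5).ne', (h4.trans_lt h5).ne']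

theorem minimalPeriod_coe (hq : f.rho = q) (hp : f.ret q p = p) :
    minimalPeriod f.outside (p : UnitAddCircle) = q.den := by
  have hper : IsPeriodicPt f.outside q.den (p : UnitAddCircle) := by
    rw [IsPeriodicPt, IsFixedPt, ← coe_lift_iterate, lift_iterate_den, coe_add_int, hp]
  apply Nat.dvd_antisymm hper.minimalPeriod_dvd
  have h2 := isPeriodicPt_minimalPeriod f.outside (p : UnitAddCircle)
  rw [IsPeriodicPt, IsFixedPt, ← coe_lift_iterate, coe_eq_coe_iff] at h2
  obtain ⟨k, hk⟩ := h2
  obtain ⟨i, hi, -⟩ := exists_eq_mul_of_mul_rho hq (f.mul_rho_of_eq hk)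
  exact ⟨i, hi⟩

theorem compl_falls_eq_empty (h : ∀ x, f.Falls x) : f.fallsᶜ = ∅ := by
  rw [compl_empty_iff, eq_univ_iff_forall]
  intro z
  obtain ⟨x, rfl⟩ := QuotientAddGroup.mk_surjective z
  exact coe_mem_falls.2 (h x)

theorem next_iterate_eq_add (i j : ℕ) (x : ℝ) (k : ℤ) (hij : j + i = q.den) (hx : f.ret q x = x) :
    (f.next q)^[j] ((f.next q)^[i] x + k) = x + 1 + k := by
  rw [next_iterate_add_int, ← iterate_add_apply, hij, next_iterate_den hx]

namespace ReturnsToGamma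

theorem arcAvoids_of_ret_eq_zero (h : f.ReturnsToGamma q) (hw : f.ret q 0 = 0)
    (hP : f.OnOrbit q P) (hy : y ≤ f.next q P) (hy' : ¬ f.Falls y) : f.ArcAvoids P y :=
  h.arcAvoids hP le_rfl hy (fun s k hs => by rw [hw]; linarith) (h.right_of_not_falls hy')

theorem arcAvoids_of_ret_eq_g (h : f.ReturnsToGamma q) (hw : f.ret q 0 = f.g - 1)
    (hP : f.OnOrbit q P) (hx : P ≤ x) (hx' : ¬ f.Falls x) : f.ArcAvoids x (f.next q P) :=
  h.arcAvoids hP hx le_rfl (h.left_of_not_falls hx') (fun s k hs => by rw [hw]; linarith)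

theorem onOrbit_next_iterate (i : ℕ) (l : ℤ) : f.OnOrbit q ((f.next q)^[i] (f.ret q 0) + l) :=
  (onOrbit_ret.next_iterate i).add_int l

theorem next_onOrbit (i : ℕ) (l : ℤ) (x : ℝ) :
    f.next q ((f.next q)^[i] x + l) = (f.next q)^[i + 1] x + l := by
  rw [next_add_int, iterate_succ_apply']

/-- When distinct points have distinct itineraries and `B^n(a)` is an endpoint of `γ`, every orbit
falls into `γ`: a point which does not would share its itinerary with a point of the orbit of the
corresponding endpoint. -/
theorem falls_of_not_isPeriodic (h : f.ReturnsToGamma q) (hf : f.Standing)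
    (hκ : ¬ BinSeq.IsPeriodic f.kneading) (hw : f.ret q 0 = 0 ∨ f.ret q 0 = f.g - 1) (x : ℝ) :
    f.Falls x := by
  by_contra hx
  obtain ⟨i, -, l, h1, h2⟩ := h.exists_between hx
  have hP := onOrbit_next_iterate (f := f) (q := q) i l
  rw [← next_onOrbit] at h2
  rcases hw with hw | hw
  · have ha := h.arcAvoids_of_ret_eq_zero hw hP h2.le hx
    have hi := ha.isItinerary h1
    exact ha.tau_ne h1 (hf.itinerary_injective hκ _ (f.tau_mem _) _ (f.tau_mem _) _ hi.1 hi.2)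
  · have ha := h.arcAvoids_of_ret_eq_g hw hP h1.le hx
    have hi := ha.isItinerary h2
    exact ha.tau_ne h2 (hf.itinerary_injective hκ _ (f.tau_mem _) _ (f.tau_mem _) _ hi.1 hi.2)

/-- The two fixed points of the return map would project to two periodic points with a common
itinerary, and an even number of symbols `1` in a period; but the first `n` symbols of `κ(f)` contain
an odd number of symbols `1`. -/
theorem fixed_unique_of_neg (h : f.ReturnsToGamma q) (hf : f.Standing) (h0 : 0 < q)
    (h1 : q < 1 / 2) (hw : f.ret q 0 < 0) (hP : f.OnOrbit q P) (hx : f.ret q x = x)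
    (hy : f.ret q y = y) (hPx : P < x) (hxy : x < y) (hyP : y < f.next q P) : False := by
  have hx' := h.not_falls_of_fixed hP hx hPx (hxy.trans hyP)
  have hy' := h.not_falls_of_fixed hP hy (hPx.trans hxy) hyP
  have ha := h.arcAvoids_of_not_falls hP hPx.le hyP.le hx' hy'
  have hi := ha.isItinerary hxy
  have hsub : {f.tau x, f.tau y} ⊆ {z ∈ Icc f.a f.b | IsPeriodicPt f q.den z ∧
      f.IsItinerary z (f.circleCode x)} := by
    rintro z (rfl | rfl)
    · exact ⟨f.tau_mem _, isPeriodicPt_tau hx (ha.tau_iterate_left hxy _), hi.1⟩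
    · exact ⟨f.tau_mem _, isPeriodicPt_tau hy (ha.tau_iterate_right hxy _), hi.2⟩
  have hcard := encard_le_encard hsub
  rw [encard_pair (ha.tau_ne hxy)] at hcard
  obtain ⟨r, hr⟩ := hf.periodic_two q.den q.den_pos _
    (le_antisymm (hf.periodic_le_two q.den q.den_pos _) hcard)
  rw [← circleCode_iterate] at hr
  have hz : f.ret q (f.lift^[r] x) = f.lift^[r] x := ret_iterate_of_fixed hx r
  -- the sum of the symbols over a period is `2m`, but `2m - 1` for the first `n` symbols of `κ(f)`
  have hs1 := sum_circleCode (f := f) (f.lift^[r] x) q.den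
  rw [iterate_succ_apply', lift_iterate_den, hz, f.lift.map_add_int, Int.floor_add_intCast,
    Int.floor_add_intCast, ← hr] at hs1
  have hs2 := f.isStaircase_orbitStair.sum_code q.den
  rw [← circleCode_neg_half, ← BinSeq.sum_congr_prefix (s := f.kneading)
    fun i hi => kneading_eq_of_le_den h.rho_eq hi.le, hs1, orbitStair_eq_lowerStair h.rho_eq hw,
    lowerStair_den_add_one, lowerStair_den h0 h1] at hs2
  omega

/-- Two fixed points of the return map between consecutive points of the orbit of `a` would give three
periodic points with a common itinerary. -/
theorem fixed_unique_of_zero (h : f.ReturnsToGamma q) (hf : f.Standing)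
    (hw : f.ret q 0 = 0) (hP : f.OnOrbit q P) (hx : f.ret q x = x)
    (hy : f.ret q y = y) (hPx : P < x) (hxy : x < y) (hyP : y < f.next q P) : False := by
  have hx' := h.not_falls_of_fixed hP hx hPx (hxy.trans hyP)
  have hy' := h.not_falls_of_fixed hP hy (hPx.trans hxy) hyP
  have hPy := hPx.trans hxy
  have ha := h.arcAvoids_of_not_falls hP hPx.le hyP.le hx' hy'
  have hax := h.arcAvoids_of_ret_eq_zero hw hP (hxy.trans hyP).le hx'
  have hay := h.arcAvoids_of_ret_eq_zero hw hP hyP.le hy'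
  have hsub : {f.tau P, f.tau x, f.tau y} ⊆ {z ∈ Icc f.a f.b | IsPeriodicPt f q.den z ∧
      f.IsItinerary z (f.circleCode P)} := by
    rintro z (rfl | rfl | rfl)
    · exact ⟨f.tau_mem _, isPeriodicPt_tau (h.ret_of_onOrbit hP) (hax.tau_iterate_left hPx _),
        (hax.isItinerary hPx).1⟩
    · exact ⟨f.tau_mem _, isPeriodicPt_tau hx (hax.tau_iterate_right hPx _),
        (hax.isItinerary hPx).2⟩
    · exact ⟨f.tau_mem _, isPeriodicPt_tau hy (hay.tau_iterate_right hPy _),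
        (hay.isItinerary hPy).2⟩
  have hcard := (encard_le_encard hsub).trans (hf.periodic_le_two q.den q.den_pos _)
  rw [encard_eq_three.2 ⟨_, _, _, hax.tau_ne hPx, hay.tau_ne hPy, ha.tau_ne hxy, rfl⟩] at hcard
  exact absurd hcard (by decide)

theorem lt_g_of_onOrbit (h : f.ReturnsToGamma q) (hP : f.OnOrbit q P) (h1 : P < f.ret q 0 + 1) :
    P < f.g := by
  by_contra h2
  have := ret_of_mem_gamma (f := f) (q := q) (z := P) (k := 0) (by push_cast; linarith)
    (by push_cast; linarith [h.le_zero])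
  rw [h.ret_of_onOrbit hP] at this
  push_cast at this
  linarith

theorem pos_of_onOrbit (h : f.ReturnsToGamma q) (hP : f.OnOrbit q P) (h1 : f.ret q 0 < P) :
    0 < P := by
  by_contra h2
  have := ret_of_mem_gamma (f := f) (q := q) (z := P) (k := -1)
    (by push_cast; linarith [h.g_le]) (by push_cast; linarith)
  rw [h.ret_of_onOrbit hP] at this
  push_cast at this
  linarith

theorem strictMono_next_iterate (hx : f.ret q x = x) : StrictMono fun i => (f.next q)^[i] x :=
  strictMono_nat_of_lt_succ fun i => by
    rw [iterate_succ_apply']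
    exact lt_next (ret_next_iterate_of_fixed hx i)

/-- The last point of the orbit through `γ` before `γ + 1`. -/
theorem next_iterate_pred_lt_g (h : f.ReturnsToGamma q) {d : ℕ} (hd : q.den = d + 1) :
    (f.next q)^[d] (f.ret q 0) < f.g := by
  refine h.lt_g_of_onOrbit (onOrbit_ret.next_iterate d) ?_
  rw [← next_iterate_den h.ret_ret, hd]
  exact strictMono_next_iterate h.ret_ret (Nat.lt_succ_self d)

/-! ### The case `B^n(a)` in the interior of `γ` -/

/-- The return map moves `0` to the left, and moves to the right the point between `B^n(a)` and the
next point of its orbit which `n - 1` applications of `next` carry to `â_u`. -/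
theorem exists_fixed (h : f.ReturnsToGamma q) (hw : f.g - 1 < f.ret q 0) (hw' : f.ret q 0 < 0) :
    ∃ p ∈ Ioo (f.ret q 0) (f.next q (f.ret q 0)), f.ret q p = p := by
  obtain ⟨d, hd⟩ : ∃ d, q.den = d + 1 := ⟨q.den - 1, by have := q.den_pos; omega⟩
  have hlt := lt_next h.ret_ret
  have hpos := h.pos_of_onOrbit onOrbit_ret.next hlt
  have hLw := h.next_iterate_pred_lt_g hd
  have hLn : (f.next q)^[d] (f.next q (f.ret q 0)) = f.ret q 0 + 1 := by
    rw [← iterate_succ_apply, ← next_iterate_den h.ret_ret, hd]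
  obtain ⟨z, hz, hLz⟩ := intermediate_value_Icc hlt.le
    (continuous_next_iterate (f := f) (q := q) d).continuousOn
    (show f.g ∈ Icc _ _ from ⟨hLw.le, by rw [hLn]; linarith⟩)
  have hret : f.ret q f.g = f.ret q 0 + 1 := by
    have := ret_of_mem_gamma (f := f) (q := q) (z := f.g) (k := 0) (by simp)
      (by push_cast; linarith [f.g_lt_one])
    simpa using this
  have hzz : z < f.ret q z := by
    by_contra hle
    have h2 := monotone_next_iterate (f := f) (q := q) d (not_lt.1 hle)
    rw [← ret_next_iterate_comm, hLz, hret] at h2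
    linarith
  have hz' : z ∈ Ioo (f.ret q 0) (f.next q (f.ret q 0)) := by
    refine ⟨lt_of_le_of_ne hz.1 ?_, lt_of_le_of_ne hz.2 ?_⟩
    · rintro rfl
      exact hLw.ne hLz
    · rintro rfl
      rw [hLn] at hLz
      linarith
  obtain ⟨y, hy, hy2⟩ := isPreconnected_Ioo.intermediate_value₂ (a := (0 : ℝ)) ⟨hw', hpos⟩ hz'
    (continuous_ret (f := f) (q := q)).continuousOn continuousOn_id hw'.le hzz.le
  exact ⟨y, hy, hy2⟩

/-- The points that do not fall into `γ` are those of the second periodic orbit: the orbit through `γ`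
attracts the points on both of its sides. -/
theorem not_falls_iff_of_mem_interior (h : f.ReturnsToGamma q) (hf : f.Standing) (h0 : 0 < q)
    (h1 : q < 1 / 2) (hw : f.g - 1 < f.ret q 0) (hw' : f.ret q 0 < 0)
    (hp : p ∈ Ioo (f.ret q 0) (f.next q (f.ret q 0))) (hpp : f.ret q p = p) :
    ¬ f.Falls x ↔ ∃ (i : ℕ) (l : ℤ), x = (f.next q)^[i] p + l := by
  have hnot : ∀ (i : ℕ) (l : ℤ), ¬ f.Falls ((f.next q)^[i] p + l) := fun i l => by
    rw [falls_add_int]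
    refine h.not_falls_of_fixed (onOrbit_ret.next_iterate i) (ret_next_iterate_of_fixed hpp i)
      (next_iterate_lt_of_fixed h.ret_ret hpp hp.1 i) ?_
    rw [← iterate_succ_apply' (f.next q), iterate_succ_apply]
    exact next_iterate_lt_of_fixed hpp (ret_next_of_fixed h.ret_ret) hp.2 i
  refine ⟨fun hx => ?_, fun ⟨i, l, he⟩ => he ▸ hnot i l⟩
  obtain ⟨i, hi, l, hl, hr⟩ := h.exists_between hx
  have hP := onOrbit_next_iterate (f := f) (q := q) i l
  have hfix : ∀ z : ℝ, f.ret q z = z →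
      f.ret q ((f.next q)^[i] z + l) = (f.next q)^[i] z + l := fun z hz => by
    rw [ret_add_int, ret_next_iterate_of_fixed hz]
  have hPp : (f.next q)^[i] (f.ret q 0) + l < (f.next q)^[i] p + l := by
    linarith [next_iterate_lt_of_fixed h.ret_ret hpp hp.1 i]
  have hpP : (f.next q)^[i] p + l < (f.next q)^[i + 1] (f.ret q 0) + l := by
    rw [iterate_succ_apply]
    linarith [next_iterate_lt_of_fixed hpp (ret_next_of_fixed h.ret_ret) hp.2 i]
  have hp0 : 0 < p := by
    have := gt_of_not_falls (x := p) (s := 0) (k := -1) (by simpa using hnot 0 0)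
      (by simp; linarith [hp.1])
    simpa using this
  rcases lt_trichotomy x ((f.next q)^[i] p + l) with hlt | heq | hgt
  · refine absurd ?_ hx
    refine falls_of_left (j := q.den - i) (l := l) hw.le hw' (hfix _ h.ret_ret) ?_
      (next_iterate_eq_add i (q.den - i) _ l (by omega) h.ret_ret) ?_ ⟨hl, hlt⟩
    · intro u hu hu2
      refine h.fixed_unique_of_neg hf h0 h1 hw' hP hu2 (hfix p hpp) hu.1 hu.2 ?_
      rwa [next_onOrbit]
    · rw [next_iterate_eq_add i (q.den - i) _ l (by omega) hpp]
      linarith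
  · exact ⟨i, l, heq⟩
  · refine absurd ?_ hx
    refine falls_of_right (j := q.den - (i + 1)) (l := l) hw hw'.le
      (Z := (f.next q)^[i + 1] (f.ret q 0) + l) ?_ ?_
      (next_iterate_eq_add (i + 1) _ _ l (by omega) h.ret_ret) ?_ ⟨hgt, hr⟩
    · rw [ret_add_int, ret_next_iterate_of_fixed h.ret_ret]
    · intro u hu hu2
      refine h.fixed_unique_of_neg hf h0 h1 hw' hP (hfix p hpp) hu2 hPp hu.1 ?_
      rw [next_onOrbit]
      exact hu.2
    · rw [next_iterate_add_int, ← iterate_add_apply, add_lt_add_iff_right]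
      have h2 : (f.next q)^[q.den - (i + 1) + i] p < f.ret q 0 + 1 := by
        rw [← next_iterate_den h.ret_ret]
        obtain ⟨d, hd⟩ : ∃ d, q.den = d + 1 := ⟨q.den - 1, by omega⟩
        rw [show q.den - (i + 1) + i = d by omega, hd, iterate_succ_apply]
        exact next_iterate_lt_of_fixed hpp (ret_next_of_fixed h.ret_ret) hp.2 d
      have := lt_of_not_falls (s := 0) (k := 0) (hnot (q.den - (i + 1) + i) 0)
        (by simp; linarith)
      simpa using this

theorem compl_falls_eq_fwdOrbit (h : f.ReturnsToGamma q) (hf : f.Standing) (h0 : 0 < q)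
    (h1 : q < 1 / 2) (hw : f.g - 1 < f.ret q 0) (hw' : f.ret q 0 < 0) :
    ∃ p : UnitAddCircle, minimalPeriod f.outside p = q.den ∧
      f.fallsᶜ = fwdOrbit f.outside p := by
  obtain ⟨p, hp, hpp⟩ := h.exists_fixed hw hw'
  have hiff := fun x => h.not_falls_iff_of_mem_interior (x := x) hf h0 h1 hw hw' hp hpp
  refine ⟨p, minimalPeriod_coe h.rho_eq hpp, ?_⟩
  ext z
  constructor
  · intro hz
    obtain ⟨x, rfl⟩ := QuotientAddGroup.mk_surjective z
    obtain ⟨i, l, rfl⟩ := (hiff x).1 fun hx => hz (coe_mem_falls.2 hx)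
    refine ⟨bezoutExp q * i, ?_⟩
    simp only
    rw [← coe_lift_iterate, next_iterate]
    refine coe_eq_coe_iff.2 ⟨bezoutInt q * i - l, ?_⟩
    push_cast
    ring
  · rintro ⟨r, rfl⟩
    simp only
    rw [← coe_lift_iterate, mem_compl_iff, coe_mem_falls]
    exact fun hx => (hiff p).2 ⟨0, 0, by simp⟩ hx.of_iterate

end ReturnsToGamma

end UnimodalMap

namespace UnimodalMap

variable {f : UnimodalMap} {q : ℚ} {x y p P : ℝ}

/-! ### The case `B^n(a) = a` -/

theorem ArcAvoids.mono_right (h : f.ArcAvoids P y) (hxy : x ≤ y) : f.ArcAvoids P x :=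
  fun s k hs => (f.monotone_iterate s hxy).trans (h s k hs)

/-- Points of the arc which fell into `γ` would be trapped between images of its endpoints, the second
of which has not passed `â_u`. -/
theorem ArcAvoids.not_falls (h : f.ArcAvoids P y) (hy : ¬ f.Falls y) (hx : P < x) (hxy : x ≤ y) :
    ¬ f.Falls x := by
  rintro ⟨s, k, h1, h2⟩
  have h3 := h s k (((h.mono_right hxy).iterate_lt hx s).trans_le h2)
  have h4 := lt_of_not_falls hy (s := s) (k := k) (by linarith [f.g_lt_one])
  linarith [f.monotone_iterate s hxy]

theorem isItinerary_a : f.IsItinerary f.a (BinSeq.shift 1 f.kneading) := by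
  have := f.kneading_isItinerary.shift 1
  rwa [iterate_one, f.map_b] at this

theorem lhe_one (h0 : 0 < q) (h1 : q < 1 / 2) : lhe q 1 = 0 := by
  rw [lhe_eq h0.le h1, code_upperStair_eq_lowerStair (by have := three_le_den h0 h1; omega),
    code_lowerStair_one h0 h1.le]

theorem lhe_zero_eq_one (h0 : 0 ≤ q) (h1 : q < 1 / 2) : lhe q 0 = 1 := by
  rw [lhe_eq h0 h1, code_upperStair_zero h0 h1]

theorem shift_den_lhe (h0 : 0 < q) (h1 : q < 1 / 2) : BinSeq.shift q.den (lhe q) = lhe q := by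
  rw [lhe_eq h0.le h1]
  exact funext (periodic_code_upperStair h0 h1)

/-- When `B^n(a) = a`, the points between the last fixed point `y` of the return map and the next
point of the orbit of `a` fall into `γ`. -/
theorem falls_of_fixed_le (hw : f.ret q 0 = 0)
    (hyy : f.ret q y = y) (hno : ∀ u ∈ Ioo y (f.next q 0), f.ret q u ≠ u)
    {d : ℕ} (hd : q.den = d + 1) (hg : (f.next q)^[d] y < f.g) {i : ℕ} (hi : i < q.den) {l : ℤ}
    (h1 : (f.next q)^[i] y + l < x) (h2 : x < (f.next q)^[i + 1] 0 + l) : f.Falls x := by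
  have hfix : ∀ z, f.ret q z = z → ∀ (j : ℕ) (l : ℤ),
      f.ret q ((f.next q)^[j] z + l) = (f.next q)^[j] z + l := fun z hz j l => by
    rw [ret_add_int, ret_next_iterate_of_fixed hz]
  refine falls_of_right (j := q.den - (i + 1)) (l := l) (by rw [hw]; linarith [f.g_lt_one]) hw.le
    (hfix 0 hw (i + 1) l) ?_ ?_ ?_ ⟨h1, h2⟩
  · intro u hu huu
    refine hno ((f.next q)^[q.den - i] u + (-1 - l : ℤ)) ⟨?_, ?_⟩ (hfix u huu _ _)
    · have := next_iterate_lt_of_fixed (hfix y hyy i l) huu hu.1 (q.den - i)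
      rw [next_iterate_eq_add i _ y l (by omega) hyy] at this
      push_cast
      linarith
    · have := next_iterate_lt_of_fixed huu (hfix 0 hw (i + 1) l) hu.2 (q.den - i)
      rw [iterate_succ_apply, next_iterate_eq_add i _ _ l (by omega) (ret_next_of_fixed hw)] at this
      push_cast
      linarith
  · rw [next_iterate_eq_add (i + 1) _ 0 l (by omega) hw, hw]
  · rw [next_iterate_add_int, ← iterate_add_apply, show q.den - (i + 1) + i = d by omega]
    linarith

namespace ReturnsToGamma

theorem kneading_eq_lhe (h : f.ReturnsToGamma q) (h0 : 0 < q) (h1 : q < 1 / 2)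
    (hw : f.ret q 0 = 0) : f.kneading = lhe q :=
  (kneading_eq_lhe_iff h.rho_eq h0 h1).2 hw.ge

theorem circleCode_zero_eq (h : f.ReturnsToGamma q) (h0 : 0 < q) (h1 : q < 1 / 2)
    (hw : f.ret q 0 = 0) : f.circleCode 0 = BinSeq.shift 1 (lhe q) := by
  rw [circleCode_zero, circleCode_eq_lhe h.rho_eq h0.le h1 hw.ge]

/-- A second period `n` orbit of the outside map projects to a second periodic orbit of `f` with
the itinerary of `b`. -/
theorem exists_periodic_of_fixed (h : f.ReturnsToGamma q) (h0 : 0 < q) (h1 : q < 1 / 2)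
    (hw : f.ret q 0 = 0) (hy : 0 < y) (hy' : y < f.next q 0) (hyy : f.ret q y = y) :
    ∃ x ∈ Icc f.a f.b, x ≠ f.b ∧ minimalPeriod f x = q.den ∧ f.IsItinerary x (lhe q) := by
  have hP : f.OnOrbit q 0 := hw ▸ onOrbit_ret
  have hn := h.not_falls_of_fixed hP hyy hy hy'
  have ha := h.arcAvoids_of_ret_eq_zero hw hP hy'.le hn
  have hi := (ha.isItinerary hy).2
  rw [h.circleCode_zero_eq h0 h1 hw] at hi
  have hper := isPeriodicPt_tau hyy (ha.tau_iterate_right hy _)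
  obtain ⟨d, hd⟩ : ∃ d, q.den = d + 1 := ⟨q.den - 1, by have := q.den_pos; omega⟩
  refine ⟨f^[d] (f.tau y), f.iterate_mem (f.tau_mem y) d, fun hb => ?_, ?_, ?_⟩
  · have h2 : f (f^[d] (f.tau y)) = f.tau y := by
      rw [← iterate_succ_apply' f, Nat.succ_eq_add_one, ← hd]; exact hper
    rw [hb, f.map_b, ← f.tau_zero] at h2
    exact ha.tau_ne hy h2
  · rw [minimalPeriod_apply_iterate ⟨_, q.den_pos, hper⟩]
    apply Nat.dvd_antisymm hper.minimalPeriod_dvd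
    have h2 := isPeriodicPt_minimalPeriod f (f.tau y)
    generalize minimalPeriod f (f.tau y) = j at h2
    rw [IsPeriodicPt, IsFixedPt, ha.tau_iterate_right hy] at h2
    have e1 := f.tc_pos
    have e2 := f.tc_lt_half
    have e3 := f.half_le_g
    have e4 := f.g_lt_one_sub_tc
    -- `y` is a lower point; its images are never upper points with the same projection
    have hytc : y ≤ f.tc := by
      by_contra hlt
      refine ha.not_between_tc (s := 0) (k := 0) ?_ ?_ ?_ ?_
      · simp
      · simpa using e1
      · simpa using hlt
      · simpa using ha.le_floor 0
    have hk := Int.floor_le (f.lift^[j] y)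
    have hk' := lt_of_not_falls hn (s := j) (k := ⌊f.lift^[j] y⌋)
      (by linarith [Int.lt_floor_add_one (f.lift^[j] y)])
    rw [f.tau_lower (z := y) (k := 0) (by simpa using hy.le) (by push_cast; linarith)] at h2
    rcases le_total (f.lift^[j] y) (⌊f.lift^[j] y⌋ + 1 / 2) with h3 | h3
    · rw [f.tau_lower hk h3] at h2
      have h4 := f.unsc_strictMono.injective h2
      push_cast at h4
      obtain ⟨i, hij, -⟩ := exists_eq_mul_of_mul_rho h.rho_eq
        (f.mul_rho_of_eq (x := y) (j := j) (k := ⌊f.lift^[j] y⌋) (by linarith))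
      exact ⟨i, hij⟩
    · rw [f.tau_upper h3 (by linarith)] at h2
      have h4 := f.unsc_strictMono.injective h2
      push_cast at h4
      linarith
  · have h2 := hi.shift d
    rwa [BinSeq.shift_shift, ← hd, shift_den_lhe h0 h1] at h2

/-- If `b` is the only period `n` point with its itinerary, every orbit falls into `γ`. -/
theorem falls_of_tentLike (h : f.ReturnsToGamma q) (h0 : 0 < q) (h1 : q < 1 / 2)
    (hw : f.ret q 0 = 0)
    (ht : ∀ x ∈ Icc f.a f.b, minimalPeriod f x = q.den → f.IsItinerary x (lhe q) → x = f.b)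
    (x : ℝ) : f.Falls x := by
  by_contra hx
  obtain ⟨i, hi, l, hl, hr⟩ := h.exists_between hx
  obtain ⟨d, hd⟩ : ∃ d, q.den = d + 1 := ⟨q.den - 1, by omega⟩
  have hg := h.next_iterate_pred_lt_g hd
  rw [hw] at hl hr hg
  refine hx (falls_of_fixed_le hw hw ?_ hd hg hi hl hr)
  intro u hu huu
  obtain ⟨z, hz, hzb, hzp, hzi⟩ := h.exists_periodic_of_fixed h0 h1 hw hu.1 hu.2 huu
  exact hzb (ht z hz hzp hzi)

theorem iterate_zero_lt (h : f.ReturnsToGamma q) (hw : f.ret q 0 = 0) (j : ℕ) :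
    f.lift^[j] 0 < ⌊f.lift^[j] 0⌋ + f.g := by
  by_contra hj
  have hlt := Int.lt_floor_add_one (f.lift^[j] 0)
  rcases Nat.eq_zero_or_pos j with rfl | hpos
  · simp at hj
    linarith [f.half_le_g]
  obtain ⟨i, -, -, hi⟩ := exists_of_return h.rho_eq (k := ⌊f.lift^[j] 0⌋) hpos (by linarith)
    (by linarith)
  rw [iterate_fixed hw] at hi
  linarith

/-- A second period `n` point of `f` with the itinerary of `b` comes from a second period `n` orbit
of the outside map. Its image is the projection of a point `t` just after `a` on the circle. As long
as the arc from `a` to `t` has not been pushed over `â_u`, it follows the orbit of `f`, and it is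
never pushed over `â_u`: otherwise `â`, whose orbit contains `a`, would lie strictly between two
points with a common itinerary. -/
theorem exists_fixed_of_periodic (h : f.ReturnsToGamma q) (h0 : 0 < q) (h1 : q < 1 / 2)
    (hw : f.ret q 0 = 0) {x : ℝ} (hx : x ∈ Icc f.a f.b) (hxb : x ≠ f.b)
    (hper : minimalPeriod f x = q.den) (hit : f.IsItinerary x (lhe q)) :
    ∃ y ∈ Ioo 0 (f.next q 0), f.ret q y = y := by
  have e1 := f.tc_pos
  have e2 := f.tc_lt_half
  have e3 := f.half_le_g
  have e4 := f.g_lt_one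
  have hκ := h.kneading_eq_lhe h0 h1 hw
  have hcode := h.circleCode_zero_eq h0 h1 hw
  have hx1 : f.IsItinerary (f x) (BinSeq.shift 1 (lhe q)) := hit.shift 1
  have ha1 : f.IsItinerary f.a (BinSeq.shift 1 (lhe q)) := hκ ▸ isItinerary_a
  have hfna : f^[q.den] f.a = f.a := by rw [iterate_den_a h.rho_eq, hw, tau_zero]
  have hx1c : f x ∈ Icc f.a f.c := (hx1 0).1 (lhe_one h0 h1)
  have hx1a : f.a < f x := by
    refine lt_of_le_of_ne hx1c.1 fun he => hxb ?_
    exact f.strictAntiOn.injOn ((hit 0).2 (lhe_zero_eq_one h0.le h1)) ⟨f.c_lt_b.le, le_rfl⟩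
      (he.symm.trans f.map_b.symm)
  have hxn : f^[q.den] (f x) = f x := by
    rw [← iterate_succ_apply f, iterate_succ_apply' f, ← hper, iterate_minimalPeriod]
  set t := f.scale (f x) with ht
  have ht0 : 0 < t := by rw [← f.scale_a]; exact f.scale_strictMono hx1a
  have httc : t ≤ f.tc := f.scale_strictMono.monotone hx1c.2
  have hta : ∀ j, f^[j] f.a = f.tau (f.lift^[j] 0) := fun j => by
    rw [← f.tau_zero]
    exact f.tau_iterate fun i _ => (h.iterate_zero_lt hw i).le
  have key : ∀ j, f.lift^[j] 0 < f.lift^[j] t ∧ f.tau (f.lift^[j] t) = f^[j] (f x) ∧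
      (f.lift^[j] 0 < ⌊f.lift^[j] 0⌋ + 1 / 2 ∧ f.lift^[j] t ≤ ⌊f.lift^[j] 0⌋ + 1 / 2 ∨
        ⌊f.lift^[j] 0⌋ + 1 / 2 ≤ f.lift^[j] 0 ∧ f.lift^[j] t ≤ ⌊f.lift^[j] 0⌋ + f.g) := by
    intro j
    induction j with
    | zero =>
      simp only [iterate_zero, id, Int.floor_zero, Int.cast_zero, zero_add]
      refine ⟨ht0, ?_, Or.inl ⟨by norm_num, by linarith⟩⟩
      rw [f.tau_lower (k := 0) (by simpa using ht0.le) (by push_cast; linarith), Int.cast_zero,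
        sub_zero, ht, unsc_scale]
    | succ j ih =>
      obtain ⟨hlt, htau, hpos⟩ := ih
      have hk := Int.floor_le (f.lift^[j] 0)
      have hk1 := Int.lt_floor_add_one (f.lift^[j] 0)
      have hnext := h.iterate_zero_lt hw (j + 1)
      generalize hkk : ⌊f.lift^[j] 0⌋ = k at hk hpos hk1
      have hle : f.lift^[j] t ≤ k + f.g := by
        rcases hpos with h2 | h2
        exacts [h2.2.trans (by linarith), h2.2]
      have hlt' : f.lift^[j + 1] 0 < f.lift^[j + 1] t := by
        rw [iterate_succ_apply', iterate_succ_apply']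
        exact f.lift_strictMonoOn hk hlt hle
      have htau' : f.tau (f.lift^[j + 1] t) = f^[j + 1] (f x) := by
        rw [iterate_succ_apply', f.tau_lift (hk.trans hlt.le) hle, htau, iterate_succ_apply' f]
      refine ⟨hlt', htau', ?_⟩
      have e0 : f.lift^[j + 1] 0 = f.lift (f.lift^[j] 0) := iterate_succ_apply' _ _ _
      have et : f.lift^[j + 1] t = f.lift (f.lift^[j] t) := iterate_succ_apply' _ _ _
      rcases hpos with ⟨h2, h3⟩ | ⟨h2, h3⟩
      · have hfl : ⌊f.lift^[j + 1] 0⌋ = k := by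
          rw [Int.floor_eq_iff, e0]
          exact ⟨f.lift_le hk, f.lift_lt_one hk h2⟩
        rw [hfl] at hnext ⊢
        rcases lt_or_ge (f.lift^[j] 0) (k + f.tc) with h4 | h4
        · left
          have hs : BinSeq.shift 1 (lhe q) j = 0 := by
            rw [← hcode]; exact f.circleCode_eq_zero hk h4
          have h5 := ((hx1 j).1 hs).2
          rw [← htau, f.tau_lower (hk.trans hlt.le) h3, ← f.unsc_tc,
            f.unsc_strictMono.le_iff_le] at h5
          refine ⟨e0 ▸ f.lift_lt_half hk h4, ?_⟩
          rw [et, ← f.lift_tc]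
          exact f.lift.monotone (by linarith)
        · right
          have h5 : k + 1 / 2 ≤ f.lift^[j + 1] 0 := e0 ▸ f.half_le_lift h4
          refine ⟨h5, ?_⟩
          by_contra h6
          have h7 : f.lift^[j + 1] t ≤ k + 1 := by
            rw [et, ← f.lift_half]
            exact f.lift.monotone h3
          -- the arc from `a` to `t` has been pushed over `â_u`
          have hre1 : f^[j + 1] (f x) < f.re := by
            rw [← htau', f.tau_upper (h5.trans hlt'.le) h7, ← f.unsc_one_sub_g]
            exact f.unsc_strictMono (by linarith)
          have hre2 : f.re < f^[j + 1] f.a := by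
            rw [hta, f.tau_upper h5 (by linarith), ← f.unsc_one_sub_g]
            exact f.unsc_strictMono (by linarith)
          refine iterate_ne_a_of_between (f.iterate_mem (f.mapsTo hx) _)
            (f.iterate_mem f.a_mem _) (hx1.shift (j + 1)) (ha1.shift (j + 1)) hre1 hre2 q.den ?_
          obtain ⟨d, hd⟩ : ∃ d, q.den = d + 1 := ⟨q.den - 1, by have := q.den_pos; omega⟩
          rw [hd, iterate_succ_apply, f.map_re, ← iterate_succ_apply f, Nat.succ_eq_add_one, ← hd, hfna]
      · left
        have h4 : f.lift^[j + 1] t < k + 1 + 1 / 2 := by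
          rw [et]
          exact f.lift_lt_three_halves (by linarith)
        have hfl : ⌊f.lift^[j + 1] 0⌋ = k + 1 := by
          rw [Int.floor_eq_iff]
          push_cast
          refine ⟨e0 ▸ f.one_le_lift h2, by linarith⟩
        rw [hfl]
        push_cast
        exact ⟨by linarith, h4.le⟩
  have hle : ∀ j, f.lift^[j] t ≤ ⌊f.lift^[j] 0⌋ + f.g := fun j => by
    rcases (key j).2.2 with h2 | h2
    exacts [h2.2.trans (by linarith), h2.2]
  refine ⟨t, ⟨ht0, ?_⟩, ?_⟩
  · -- otherwise `n - 1` applications of `next` carry `a` before, and `t` beyond, the integer `1`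
    by_contra hge
    obtain ⟨d, hd⟩ : ∃ d, q.den = d + 1 := ⟨q.den - 1, by have := q.den_pos; omega⟩
    have h2 := monotone_next_iterate (f := f) (q := q) d (not_lt.1 hge)
    rw [← iterate_succ_apply (f.next q), Nat.succ_eq_add_one, ← hd, next_iterate_den hw,
      next_iterate] at h2
    have h3 := strictMono_next_iterate hw (Nat.lt_succ_self d)
    simp only [Nat.succ_eq_add_one] at h3
    rw [← hd, next_iterate_den hw, next_iterate] at h3
    have h4 := hle (bezoutExp q * d)
    have h5 : ⌊f.lift^[bezoutExp q * d] 0⌋ < 1 + bezoutInt q * d :=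
      Int.floor_lt.2 (by push_cast at h3 ⊢; linarith)
    have h6 : ⌊f.lift^[bezoutExp q * d] 0⌋ ≤ bezoutInt q * d := by omega
    have h7 : (⌊f.lift^[bezoutExp q * d] 0⌋ : ℝ) ≤ (bezoutInt q * d : ℤ) := by exact_mod_cast h6
    linarith
  · obtain ⟨h2, h3, h4⟩ := key q.den
    rw [lift_iterate_den 0, hw, zero_add] at h4 h2
    rw [Int.floor_intCast] at h4
    have h5 : f.lift^[q.den] t ≤ q.num + 1 / 2 := by
      rcases h4 with h4 | h4
      exacts [h4.2, by linarith [h4.1]]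
    rw [f.tau_lower h2.le h5, hxn, ← f.unsc_scale (f x)] at h3
    exact f.unsc_strictMono.injective h3

/-- The points that do not fall into `γ` are those between a point of the orbit of `a` (excluded) and the
next point of the second period `n` orbit (included). -/
theorem isHalfOpenArc_decomposition (h : f.ReturnsToGamma q) (hf : f.Standing)
    (hw : f.ret q 0 = 0) (hy : y ∈ Ioo 0 (f.next q 0)) (hyy : f.ret q y = y) :
    minimalPeriod f.outside (f.outside f.aPt) = q.den ∧
      ∃ p : UnitAddCircle, minimalPeriod f.outside p = q.den ∧
        p ∉ fwdOrbit f.outside (f.outside f.aPt) ∧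
        ∃ A : Fin q.den → Set UnitAddCircle,
          (∀ i, ∃ o ∈ fwdOrbit f.outside (f.outside f.aPt), ∃ e ∈ fwdOrbit f.outside p,
            IsHalfOpenArc (A i) o e) ∧
          (∀ i j, i ≠ j → Disjoint (A i) (A j)) ∧
          f.fallsᶜ = ⋃ i, A i := by
  have haPt : f.aPt = ((0 : ℝ) : UnitAddCircle) := by rw [aPt, lower_a]; rfl
  have hP : ∀ (i : ℕ) (l : ℤ), f.OnOrbit q ((f.next q)^[i] 0 + l) := fun i l => by
    have := onOrbit_next_iterate (f := f) (q := q) i l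
    rwa [hw] at this
  have hyi : ∀ i, (f.next q)^[i] 0 < (f.next q)^[i] y :=
    next_iterate_lt_of_fixed hw hyy hy.1
  have hyi' : ∀ i, (f.next q)^[i] y < (f.next q)^[i + 1] 0 := fun i => by
    rw [iterate_succ_apply]
    exact next_iterate_lt_of_fixed hyy (ret_next_of_fixed hw) hy.2 i
  have hyn : ∀ i, ¬ f.Falls ((f.next q)^[i] y) := fun i => by
    have := hP i 0
    simp only [Int.cast_zero, add_zero] at this
    refine h.not_falls_of_fixed this (ret_next_iterate_of_fixed hyy i) (hyi i) ?_
    rw [← iterate_succ_apply' (f.next q)]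
    exact hyi' i
  have hsm := strictMono_next_iterate hw
  have hle1 : ∀ i < q.den, (f.next q)^[i + 1] 0 ≤ 1 := fun i hi => by
    have := hsm.monotone (show i + 1 ≤ q.den by omega)
    rwa [next_iterate_den hw, zero_add] at this
  have hge0 : ∀ i, 0 ≤ (f.next q)^[i] 0 := fun i => hsm.monotone (Nat.zero_le i)
  -- the half-open intervals lie in the fundamental domain `(0, 1)`, in increasing order
  have hmem : ∀ i < q.den, ∀ u ∈ Ioc ((f.next q)^[i] 0) ((f.next q)^[i] y), 0 < u ∧ u < 1 :=
    fun i hi u hu => ⟨(hge0 i).trans_lt hu.1, hu.2.trans_lt ((hyi' i).trans_le (hle1 i hi))⟩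
  refine ⟨?_, y, minimalPeriod_coe h.rho_eq hyy, ?_,
    fun i => (fun x : ℝ => (x : UnitAddCircle)) '' Ioc ((f.next q)^[i] 0) ((f.next q)^[i] y),
    fun i => ?_, fun i j hij => ?_, ?_⟩
  · rw [haPt, ← coe_lift]
    exact minimalPeriod_coe h.rho_eq (ret_iterate_of_fixed hw 1)
  · rintro ⟨r, hr⟩
    simp only at hr
    rw [haPt, ← iterate_succ_apply f.outside, ← coe_lift_iterate, eq_comm, coe_eq_coe_iff] at hr
    obtain ⟨k, hk⟩ := hr
    exact hyn 0 (h.falls_of_onOrbit ⟨r + 1, k, by rw [hw]; exact hk⟩)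
  · refine ⟨((f.next q)^[i] 0 : ℝ), ⟨bezoutExp q * i + (q.den - 1), ?_⟩, ((f.next q)^[i] y : ℝ),
      ⟨bezoutExp q * i, ?_⟩, _, _, rfl, rfl, Or.inl ⟨hyi i, ?_, rfl⟩⟩
    · simp only
      rw [haPt, ← iterate_succ_apply f.outside,
        show (bezoutExp q * i + (q.den - 1)).succ = bezoutExp q * i + q.den by
          have := q.den_pos; omega, ← coe_lift_iterate, iterate_add_apply, lift_iterate_den, hw,
        iterate_add_int, next_iterate, coe_add_int]
      exact coe_eq_coe_iff.2 ⟨bezoutInt q * i, by push_cast; ring⟩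
    · simp only
      rw [← coe_lift_iterate, next_iterate]
      exact coe_eq_coe_iff.2 ⟨bezoutInt q * i, by push_cast; ring⟩
    · have := (hyi' i).trans_le (hle1 i i.2)
      have := hge0 i
      linarith
  · have hdis : ∀ i j : ℕ, i < j → j < q.den →
        ∀ u ∈ Ioc ((f.next q)^[i] 0) ((f.next q)^[i] y),
        ∀ v ∈ Ioc ((f.next q)^[j] 0) ((f.next q)^[j] y),
        (u : UnitAddCircle) ≠ (v : UnitAddCircle) := by
      intro i j hij hj u hu v hv huv
      obtain ⟨k, hk⟩ := coe_eq_coe_iff.1 huv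
      obtain ⟨hu0, hu1⟩ := hmem i (hij.trans hj) u hu
      obtain ⟨hv0, hv1⟩ := hmem j hj v hv
      have hk1 : (-1 : ℤ) < k := by
        have : (-1 : ℝ) < k := by linarith
        exact_mod_cast this
      have hk2 : k < 1 := by
        have : (k : ℝ) < 1 := by linarith
        exact_mod_cast this
      obtain rfl : k = 0 := by omega
      have h2 := hsm.monotone (show i + 1 ≤ j from hij)
      have h3 := hyi' i
      have h4 := hu.2
      have h5 := hv.1
      push_cast at hk
      linarith
    rw [Set.disjoint_left]
    rintro _ ⟨u, hu, rfl⟩ ⟨v, hv, hvu⟩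
    rcases lt_or_gt_of_ne (Fin.val_ne_of_ne hij) with h2 | h2
    · exact hdis i j h2 j.2 u hu v hv hvu.symm
    · exact hdis j i h2 i.2 v hv u hu hvu
  · obtain ⟨d, hd⟩ : ∃ d, q.den = d + 1 := ⟨q.den - 1, by have := q.den_pos; omega⟩
    ext z
    obtain ⟨x, rfl⟩ := QuotientAddGroup.mk_surjective z
    rw [mem_compl_iff, mem_iUnion]
    constructor
    · intro hx
      have hx' : ¬ f.Falls x := fun h2 => hx (coe_mem_falls.2 h2)
      obtain ⟨i, hi, l, hl, hr⟩ := h.exists_between hx'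
      rw [hw] at hl hr
      refine ⟨⟨i, hi⟩, x - l, ⟨by simp only; linarith, ?_⟩, ?_⟩
      · by_contra h2
        refine hx' (falls_of_fixed_le hw hyy ?_ hd ?_ hi (l := l) ?_ hr)
        · intro u hu huu
          exact h.fixed_unique_of_zero hf hw (hw ▸ onOrbit_ret) hyy huu hy.1 hu.1 hu.2
        · have h3 := lt_of_not_falls (hyn d) (s := 0) (k := 0) (by
            have h4 := (hyi' d).trans_le (hle1 d (by omega))
            simp only [iterate_zero, id, Int.cast_zero, add_zero]
            exact h4.le)
          simpa using h3
        · simp only at h2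
          linarith
      · exact coe_eq_coe_iff.2 ⟨-l, by push_cast; ring⟩
    · rintro ⟨i, u, hu, hux⟩ hx
      rw [← hux] at hx
      have hP0 := hP i 0
      simp only [Int.cast_zero, add_zero] at hP0
      refine (h.arcAvoids_of_ret_eq_zero hw hP0 ?_ (hyn i)).not_falls (hyn i) hu.1 hu.2
        (coe_mem_falls.1 hx)
      rw [← iterate_succ_apply' (f.next q)]
      exact (hyi' i).le

end ReturnsToGamma

end UnimodalMap

namespace UnimodalMap

variable {f : UnimodalMap} {q : ℚ} {x y p P : ℝ}

/-! ### The case of early left endpoint type -/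

theorem dist_coe_le (x y : ℝ) : dist (x : UnitAddCircle) (y : UnitAddCircle) ≤ |x - y| := by
  rw [dist_eq_norm, ← AddCircle.coe_sub, UnitAddCircle.norm_eq]
  simpa using round_le (x - y) 0

theorem exists_ret_eq (hq : f.rho = q) : ∃ x, 0 ≤ x ∧ f.ret q x = x := by
  obtain ⟨x, hx⟩ := (f.lift ^ q.den).exists_eq_add_translationNumber (by
    rw [CircleDeg1Lift.coe_pow]; exact f.continuous_iterate _)
  rw [CircleDeg1Lift.translationNumber_pow, CircleDeg1Lift.coe_pow, ← rho, hq,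
    mul_comm, ← num_eq_mul_den, lift_iterate_den] at hx
  have hx' : f.ret q x = x := by linarith
  refine ⟨x + (-⌊x⌋ : ℤ), ?_, ?_⟩
  · push_cast
    linarith [Int.floor_le x]
  · rw [ret_add_int, hx']

theorem tendsto_ret_iterate_zero (hq : f.rho = q) (hw : 0 < f.ret q 0) :
    ∃ p, f.ret q p = p ∧ Tendsto (fun i => (f.ret q)^[i] 0) atTop (𝓝 p) := by
  obtain ⟨x, hx0, hx⟩ := exists_ret_eq hq
  have hmono : Monotone fun i => (f.ret q)^[i] 0 := monotone_ret.monotone_iterate_of_le_map hw.le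
  have hbdd : BddAbove (range fun i => (f.ret q)^[i] 0) := ⟨x, by
    rintro _ ⟨i, rfl⟩
    have := (monotone_ret (f := f) (q := q)).iterate i hx0
    rwa [iterate_fixed hx] at this⟩
  have hlim := tendsto_atTop_ciSup hmono hbdd
  exact ⟨_, isFixedPt_of_tendsto_iterate hlim continuous_ret.continuousAt, hlim⟩

/-- A periodic orbit meets `γ` only at translates of `B^n(a)`, which is not in `γ`. -/
theorem disjoint_gamma_of_pos (hw : 0 < f.ret q 0) (hp : f.ret q p = p) :
    Disjoint (fwdOrbit f.outside p) f.gamma := by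
  rw [Set.disjoint_left]
  rintro _ ⟨j, rfl⟩ hj
  simp only at hj
  rw [← coe_lift_iterate, mem_gamma] at hj
  obtain ⟨k, h0, h1⟩ := hj
  have := ret_of_mem_gamma (q := q) h0 h1
  rw [ret_iterate_of_fixed hp] at this
  push_cast at this
  linarith

theorem tendsto_infDist_fwdOrbit (hlim : Tendsto (fun i => (f.ret q)^[i] 0) atTop (𝓝 p)) :
    Tendsto (fun r : ℕ => Metric.infDist (f.outside^[r] (f.outside f.aPt))
      (fwdOrbit f.outside p)) atTop (𝓝 0) := by
  -- the `r`-th point of the orbit of `B(a)` is `F^s (H^i 0)` with `r + 1 = n i + s`, `s < n`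
  let D : ℕ → ℝ := fun i => ∑ s ∈ Finset.range q.den, |f.lift^[s] ((f.ret q)^[i] 0) - f.lift^[s] p|
  have hD : Tendsto D atTop (𝓝 0) := by
    have : Tendsto D atTop (𝓝 (∑ s ∈ Finset.range q.den, |f.lift^[s] p - f.lift^[s] p|)) :=
      tendsto_finsetSum _ fun s _ =>
        ((((f.continuous_iterate s).tendsto p).comp hlim).sub_const _).abs
    simpa using this
  have hdiv : Tendsto (fun r : ℕ => (r + 1) / q.den) atTop atTop :=
    (Nat.tendsto_div_const_atTop q.den_pos.ne').comp (tendsto_add_atTop_nat 1)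
  refine squeeze_zero (fun _ => Metric.infDist_nonneg) (fun r => ?_) (hD.comp hdiv)
  have hs : (r + 1) % q.den < q.den := Nat.mod_lt _ q.den_pos
  have hr : f.outside^[r] (f.outside f.aPt) =
      ((f.lift^[(r + 1) % q.den] ((f.ret q)^[(r + 1) / q.den] 0) : ℝ) : UnitAddCircle) := by
    rw [← iterate_succ_apply f.outside, iterate_aPt, Nat.succ_eq_add_one]
    conv_lhs => rw [← Nat.mod_add_div (r + 1) q.den]
    rw [iterate_add_apply, lift_iterate_mul, iterate_add_int, coe_add_int]
  calc Metric.infDist (f.outside^[r] (f.outside f.aPt)) (fwdOrbit f.outside p)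
      ≤ dist (f.outside^[r] (f.outside f.aPt)) ((f.lift^[(r + 1) % q.den] p : ℝ) : UnitAddCircle) :=
        Metric.infDist_le_dist_of_mem ⟨(r + 1) % q.den, (f.coe_lift_iterate _ _).symm⟩
    _ ≤ |f.lift^[(r + 1) % q.den] ((f.ret q)^[(r + 1) / q.den] 0) -
          f.lift^[(r + 1) % q.den] p| := by rw [hr]; exact dist_coe_le _ _
    _ ≤ D ((r + 1) / q.den) := Finset.single_le_sum
        (f := fun s => |f.lift^[s] ((f.ret q)^[(r + 1) / q.den] 0) - f.lift^[s] p|)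
        (fun _ _ => abs_nonneg _) (Finset.mem_range.2 hs)

/-! ### Irrational height -/

/-- The positive multiples of an irrational number are dense modulo one. -/
theorem exists_mul_add_mem_Ioo {ρ : ℝ} (hρ : Irrational ρ) {u v : ℝ} (huv : u < v) :
    ∃ (r : ℕ) (k : ℤ), 0 < r ∧ u < r * ρ + k ∧ r * ρ + k < v := by
  have h1 : DenseRange (· • (ρ : UnitAddCircle) : ℕ → UnitAddCircle) := by
    rw [← denseRange_zsmul_iff_nsmul, AddCircle.denseRange_zsmul_coe_iff]
    simpa using hρ
  have h2 : Dense ((↑) ⁻¹' (range (· • (ρ : UnitAddCircle) : ℕ → UnitAddCircle)) : Set ℝ) :=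
    QuotientAddGroup.dense_preimage_mk.2 h1
  obtain ⟨z, ⟨r, hr⟩, hz1, hz2⟩ := h2.exists_between (show u - ρ < v - ρ by linarith)
  simp only at hr
  rw [← AddCircle.coe_nsmul, eq_comm, coe_eq_coe_iff, nsmul_eq_mul] at hr
  obtain ⟨k, hk⟩ := hr
  refine ⟨r + 1, k, by omega, ?_, ?_⟩ <;> push_cast <;> linarith

theorem not_return_of_irrational (hρ : Irrational f.rho) (r : ℕ) (hr : 0 < r) (k : ℤ)
    (h0 : f.g + k ≤ f.lift^[r] 0) (h1 : f.lift^[r] 0 ≤ 1 + k) : False := by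
  have := f.mul_rho_of_return hr h0 h1
  exact (hρ.natCast_mul hr.ne').ne_int _ this

theorem not_falls_iterate_zero (hρ : Irrational f.rho) (r : ℕ) : ¬ f.Falls (f.lift^[r + 1] 0) := by
  rintro ⟨j, k, h0, h1⟩
  rw [← iterate_add_apply] at h0 h1
  exact not_return_of_irrational hρ _ (by omega) k h0 h1

theorem kneading_eq_of_irrational (hρ : Irrational f.rho) :
    f.kneading = f.circleCode (-1 / 2) := by
  refine funext fun r => f.kneading_eq_circleCode fun i _ => ?_
  have hg := f.half_le_g
  rcases i with _ | _ | i
  · exact neg_half_le_floor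
  · rw [orbitStair_succ, iterate_succ_neg_half]
    simp only [zero_add, iterate_zero, id, Int.floor_zero, Int.cast_zero]
    linarith
  · rw [orbitStair_succ, iterate_succ_neg_half]
    by_contra h
    exact not_return_of_irrational hρ (i + 1) (by omega) ⌊f.lift^[i + 1] 0⌋ (by linarith)
      (by linarith [Int.lt_floor_add_one (f.lift^[i + 1] 0)])

theorem sum_range_mul_of_shift_eq {s : BinSeq} {P : ℕ} (h : BinSeq.shift P s = s) (i : ℕ) :
    ∑ j ∈ Finset.range (i * P), (s j : ℕ) = i * ∑ j ∈ Finset.range P, (s j : ℕ) := by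
  have hs : ∀ i j, s (i * P + j) = s j := fun i => by
    induction i with
    | zero => simp
    | succ i ih =>
      intro j
      rw [← ih j]
      conv_rhs => rw [← h]
      exact congrArg s (by ring)
  induction i with
  | zero => simp
  | succ i ih => rw [add_mul, one_mul, Finset.sum_range_add, ih]; simp only [hs]; ring

/-- The frequency of the symbol `1` in the kneading sequence is `2ρ`, hence irrational. -/
theorem not_isPeriodic_of_irrational (hρ : Irrational f.rho) :
    ¬ BinSeq.IsPeriodic f.kneading := by
  rintro ⟨P, hP, hper⟩
  rw [kneading_eq_of_irrational hρ] at hper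
  set C := ∑ j ∈ Finset.range P, (f.circleCode (-1 / 2) j : ℕ) with hC
  have hlow : ∀ j, (⌊f.lift^[j] 0⌋ : ℝ) ≤ j * f.rho := fun j =>
    f.le_mul_rho (x := 0) (by linarith [Int.floor_le (f.lift^[j] 0)])
  have hup : ∀ j, j * f.rho ≤ ⌊f.lift^[j] 0⌋ + 1 := fun j => by
    have := f.mul_rho_le (x := 0) (j := j) (k := ⌊f.lift^[j] 0⌋ + 1) (by
      push_cast; linarith [Int.lt_floor_add_one (f.lift^[j] 0)])
    push_cast at this
    exact this
  have key : ∀ i : ℕ, |i * ((C : ℝ) - 2 * P * f.rho)| ≤ 3 := by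
    intro i
    have h1 := f.isStaircase_orbitStair.sum_code (i * P)
    rw [← circleCode_neg_half, sum_range_mul_of_shift_eq hper, ← hC] at h1
    rcases Nat.eq_zero_or_pos (i * P) with h0 | h0
    · have : i = 0 := by
        rcases Nat.mul_eq_zero.1 h0 with h | h
        exacts [h, absurd h hP.ne']
      simp [this]
    obtain ⟨j, hj⟩ : ∃ j, i * P = j + 1 := ⟨i * P - 1, by omega⟩
    have hj' : (i : ℝ) * P = j + 1 := by exact_mod_cast hj
    rw [hj, orbitStair_succ, orbitStair_succ] at h1
    have h2 : ((i * C : ℕ) : ℝ) = ⌊f.lift^[j + 1] 0⌋ + ⌊f.lift^[j] 0⌋ + 1 := by exact_mod_cast h1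
    have e1 := hlow j
    have e2 := hlow (j + 1)
    have e3 := hup j
    have e4 := hup (j + 1)
    have e5 := f.rho_nonneg
    have e6 := f.rho_le_half
    push_cast at h2 e2 e4
    have h3 : (i : ℝ) * (C - 2 * P * f.rho) = i * C - 2 * (i * P) * f.rho := by ring
    rw [h3, h2, hj', abs_le]
    constructor <;> linarith
  have hzero : (C : ℝ) - 2 * P * f.rho = 0 := by
    by_contra hne
    obtain ⟨i, hi⟩ := exists_nat_gt (3 / |(C : ℝ) - 2 * P * f.rho|)
    rw [div_lt_iff₀ (abs_pos.2 hne)] at hi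
    have := key i
    rw [abs_mul, Nat.abs_cast] at this
    linarith
  refine (hρ.natCast_mul (show 2 * P ≠ 0 by omega)).ne_nat C ?_
  push_cast
  linarith

theorem not_arcAvoids_of_irrational (hf : f.Standing) (hρ : Irrational f.rho) (hxy : x < y) :
    ¬ f.ArcAvoids x y := fun ha => by
  have hi := ha.isItinerary hxy
  exact ha.tau_ne hxy (hf.itinerary_injective (not_isPeriodic_of_irrational hρ) _ (f.tau_mem _) _
    (f.tau_mem _) _ hi.1 hi.2)

/-- An arc without points that fall into `γ` has no image overlapping the interior of `γ`. -/
theorem exists_falls_mem_Icc (hf : f.Standing) (hρ : Irrational f.rho) (hxy : x < y) :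
    ∃ z ∈ Icc x y, f.Falls z := by
  by_contra hno
  push Not at hno
  refine not_arcAvoids_of_irrational hf hρ hxy fun s k h1 => ?_
  by_contra h2
  rcases le_total (f.lift^[s] x) (f.g + k) with h3 | h3
  · obtain ⟨z, hz, hzs⟩ := intermediate_value_Icc hxy.le (f.continuous_iterate s).continuousOn
      ⟨h3, (not_le.1 h2).le⟩
    exact hno z hz ⟨s, k, hzs.ge, by rw [hzs]; linarith [f.g_lt_one]⟩
  · exact hno x ⟨le_rfl, hxy.le⟩ ⟨s, k, h3, h1.le⟩

theorem dense_falls (hf : f.Standing) (hρ : Irrational f.rho) : Dense f.falls := by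
  rw [← QuotientAddGroup.dense_preimage_mk]
  refine dense_of_exists_between fun x y hxy => ?_
  obtain ⟨u, hxu, huy⟩ := exists_between hxy
  obtain ⟨v, huv, hvy⟩ := exists_between huy
  obtain ⟨z, hz, hfz⟩ := exists_falls_mem_Icc hf hρ huv
  exact ⟨z, coe_mem_falls.2 hfz, hxu.trans_le hz.1, hz.2.trans_lt hvy⟩

/-- Let `x` not fall into `γ`, and let `F^i y ∈ γ + k` for some `y > x` such that the orbit of
`B(a)` does not meet the arc from `x` to `y`. The orbit of `B(a)` is ordered like an orbit of the
rotation by `ρ`, which is dense, so no further image of the arc from `F^i x` to `k + 1` can contain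
an integer. Its endpoints then have images with a common itinerary. -/
theorem exists_iterate_zero_mem_Ioo (hf : f.Standing) (hρ : Irrational f.rho)
    (hx : ¬ f.Falls x) (hy : f.Falls y) (hxy : x < y) :
    ∃ (r : ℕ) (k : ℤ), f.lift^[r + 1] 0 + k ∈ Ioo x y := by
  by_contra hno
  push Not at hno
  obtain ⟨i, k, h0, h1⟩ := hy
  have hX : f.lift^[i] x < f.g + k :=
    lt_of_not_falls hx ((f.monotone_iterate i hxy.le).trans h1)
  have hg := f.half_le_g
  have hlt : f.lift (f.lift^[i] x) < f.lift (1 + k) := by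
    have e1 : f.lift (1 + k) = f.lift (f.g + k) := by
      rw [f.lift_flat (by linarith [f.g_lt_one]) le_rfl,
        f.lift_flat le_rfl (by linarith [f.g_lt_one])]
    rw [e1]
    refine (f.lift.monotone (le_max_left _ (k : ℝ))).trans_lt
      (f.lift_strictMonoOn (le_max_right _ _) (max_lt hX (by linarith)) (by linarith))
  refine not_arcAvoids_of_irrational hf hρ hlt fun s l h2 => ?_
  by_contra h3
  push Not at h3
  have e1 : f.lift^[s] (f.lift (1 + k)) = f.lift^[s + 1] 0 + (k + 1 : ℤ) := by
    rw [← iterate_succ_apply f.lift, ← iterate_add_int]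
    push_cast
    rw [zero_add, add_comm]
  have e2 : f.lift^[s] (f.lift (f.lift^[i] x)) = f.lift^[s + 1 + i] x := by
    rw [← iterate_succ_apply f.lift, iterate_add_apply]
  rw [e1] at h3
  rw [e2] at h2
  -- the `(s + 1)`-st image of the arc from `F^i x` to `k + 1` contains the integer `l + 1`
  have h4 : 1 + (l : ℝ) < f.lift^[s + 1] 0 + (k + 1 : ℤ) := by
    by_contra h5
    refine not_return_of_irrational hρ (s + 1) (by omega) (l - (k + 1)) ?_ ?_ <;> push_cast at * <;>
      linarith
  have h5 : (l : ℝ) < (s + 1 : ℕ) * f.rho + k := by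
    have := f.le_mul_rho (x := 0) (j := s + 1) (k := l - k) (by push_cast at *; linarith)
    have hne := (hρ.natCast_mul (show s + 1 ≠ 0 by omega)).ne_int (l - k)
    have := lt_of_le_of_ne this hne.symm
    push_cast at this ⊢
    linarith
  -- an orbit point of the rotation which is carried by `s + 1 + i` further steps into the gap
  -- between `1 + l` and the position of the image of `k + 1`
  obtain ⟨r, k', hr, h6, h7⟩ := exists_mul_add_mem_Ioo hρ
    (show 1 + (l : ℝ) - (s + 1 + i : ℕ) * f.rho <
      (s + 1 : ℕ) * f.rho + k + 1 - (s + 1 + i : ℕ) * f.rho by linarith)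
  obtain ⟨r, rfl⟩ : ∃ r', r = r' + 1 := ⟨r - 1, by omega⟩
  rcases le_or_gt (f.lift^[r + 1] 0 + k') x with h8 | h8
  · have h9 := f.monotone_iterate (s + 1 + i) h8
    rw [iterate_add_int, ← iterate_add_apply] at h9
    have := f.mul_rho_le (x := 0) (j := s + 1 + i + (r + 1)) (k := 1 + l - k') (by
      push_cast; linarith)
    push_cast at *
    linarith
  · have h9 := f.monotone_iterate i (not_lt.1 fun h => hno r k' ⟨h8, h⟩)
    rw [iterate_add_int, ← iterate_add_apply] at h9
    have h10 : 1 + (k : ℝ) < f.lift^[i + (r + 1)] 0 + k' := by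
      by_contra h11
      refine not_return_of_irrational hρ (i + (r + 1)) (by omega) (k - k') ?_ ?_ <;>
        push_cast at * <;> linarith
    have := f.le_mul_rho (x := 0) (j := i + (r + 1)) (k := 1 + k - k') (by push_cast; linarith)
    push_cast at *
    linarith

theorem compl_falls_subset_closure (hf : f.Standing) (hρ : Irrational f.rho) :
    f.fallsᶜ ⊆ closure (fwdOrbit f.outside (f.outside f.aPt)) := by
  intro z hz
  obtain ⟨x, rfl⟩ := QuotientAddGroup.mk_surjective z
  have hx : ¬ f.Falls x := fun h => hz (coe_mem_falls.2 h)
  by_contra hcl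
  have hopen : IsOpen ((fun x : ℝ => (x : UnitAddCircle)) ⁻¹'
      (closure (fwdOrbit f.outside (f.outside f.aPt)))ᶜ) :=
    isClosed_closure.isOpen_compl.preimage (AddCircle.continuous_mk' 1)
  obtain ⟨ε, hε, hball⟩ := Metric.isOpen_iff.1 hopen x hcl
  obtain ⟨y, hy, hyf⟩ := exists_falls_mem_Icc hf hρ (show x + ε / 3 < x + ε / 2 by linarith)
  obtain ⟨r, k, hr⟩ := exists_iterate_zero_mem_Ioo hf hρ hx hyf (by linarith [hy.1])
  refine hball (a := f.lift^[r + 1] 0 + k) ?_ (subset_closure ⟨r, ?_⟩)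
  · rw [Metric.mem_ball, Real.dist_eq, abs_lt]
    constructor <;> linarith [hr.1, hr.2, hy.2]
  · simp only
    rw [← iterate_succ_apply f.outside, iterate_aPt, coe_add_int]

theorem fwdOrbit_subset_compl_falls (hρ : Irrational f.rho) :
    fwdOrbit f.outside (f.outside f.aPt) ⊆ f.fallsᶜ := by
  rintro _ ⟨r, rfl⟩
  simp only
  rw [← iterate_succ_apply f.outside, iterate_aPt, mem_compl_iff, coe_mem_falls]
  exact not_falls_iterate_zero hρ r

end UnimodalMap

namespace UnimodalMap

variable {f : UnimodalMap} {q : ℚ}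

/-! ### Dynamics of the outside map -/

theorem upper_re : f.upper f.re = (f.g : UnitAddCircle) := by
  rw [upper_eq, ← f.unsc_one_sub_g, scale_unsc, sub_sub_cancel]

theorem outside_iterate_den_aPt : f.outside^[q.den] f.aPt = ((f.ret q 0 : ℝ) : UnitAddCircle) := by
  rw [iterate_aPt, lift_iterate_den, coe_add_int]

namespace ReturnsToGamma

theorem outside_iterate_eq_a_iff (h : f.ReturnsToGamma q) :
    f.outside^[q.den] f.aPt = f.aPt ↔ f.ret q 0 = 0 := by
  have haPt : f.aPt = ((0 : ℝ) : UnitAddCircle) := by rw [aPt, lower_a]; rfl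
  rw [outside_iterate_den_aPt, haPt, coe_eq_coe_iff]
  refine ⟨?_, fun h => ⟨0, by simpa using h⟩⟩
  rintro ⟨k, hk⟩
  have h1 := h.g_le
  have h2 := h.le_zero
  have h3 := f.half_le_g
  have h4 : (-1 : ℤ) < k := by
    have : (-1 : ℝ) < k := by linarith
    exact_mod_cast this
  have h5 : k < 1 := by
    have : (k : ℝ) < 1 := by linarith
    exact_mod_cast this
  obtain rfl : k = 0 := by omega
  simpa using hk

theorem outside_iterate_eq_re_iff (h : f.ReturnsToGamma q) :
    f.outside^[q.den] f.aPt = f.upper f.re ↔ f.ret q 0 = f.g - 1 := by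
  rw [outside_iterate_den_aPt, upper_re, coe_eq_coe_iff]
  refine ⟨?_, fun h => ⟨-1, by rw [h]; push_cast; ring⟩⟩
  rintro ⟨k, hk⟩
  have h1 := h.g_le
  have h2 := h.le_zero
  have h3 := f.half_le_g
  have h3' := f.g_lt_one
  have h4 : (-2 : ℤ) < k := by
    have : (-2 : ℝ) < k := by linarith
    exact_mod_cast this
  have h5 : k < 0 := by
    have : (k : ℝ) < 0 := by linarith
    exact_mod_cast this
  obtain rfl : k = -1 := by omega
  push_cast at hk
  linarith

end ReturnsToGamma

theorem returnsToGamma (hf : f.Standing) (hq : f.rho = q) (h0 : 0 ≤ q) (h1 : q < 1 / 2)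
    (he : ¬ f.IsEarly q) : f.ReturnsToGamma q := by
  rcases h0.eq_or_lt with rfl | h0
  · have hw := ret_zero_eq_zero hf hq
    exact ⟨hq, by rw [hw]; linarith [f.g_lt_one], hw.le⟩
  · exact ⟨hq, g_sub_one_le_ret hf hq h0 h1, not_lt.1 fun h => he ((isEarly_iff hq h0 h1).2 h)⟩

end UnimodalMap

theorem mainTheorem7 (f : UnimodalMap) (hf : f.Standing) :
    -- (a)
    HasRotationNumber f.outside f.height ∧
    -- (b)
    (∀ q : ℚ, f.height = (q : ℝ) → ¬ f.IsEarly q →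
      f.firstEntry = (q.den : ℕ∞) ∧
      (f.outside^[q.den] f.aPt = f.aPt ↔ f.kneading = lhe q) ∧
      (f.outside^[q.den] f.aPt = f.upper f.re ↔ 0 < q ∧ f.kneading = rhe q) ∧
      (f.IsNormal q → f.fallsᶜ = ∅) ∧
      (f.IsQuadraticLike q →
        minimalPeriod f.outside (f.outside f.aPt) = q.den ∧
        ∃ p : UnitAddCircle, minimalPeriod f.outside p = q.den ∧
          p ∉ fwdOrbit f.outside (f.outside f.aPt) ∧
          ∃ A : Fin q.den → Set UnitAddCircle,
            (∀ i, ∃ o ∈ fwdOrbit f.outside (f.outside f.aPt), ∃ e ∈ fwdOrbit f.outside p,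
              IsHalfOpenArc (A i) o e) ∧
            (∀ i j, i ≠ j → Disjoint (A i) (A j)) ∧
            f.fallsᶜ = ⋃ i, A i) ∧
      (¬ f.IsNormal q → ¬ f.IsQuadraticLike q →
        ∃ p : UnitAddCircle, minimalPeriod f.outside p = q.den ∧
          f.fallsᶜ = fwdOrbit f.outside p)) ∧
    -- (c)
    (∀ q : ℚ, f.height = (q : ℝ) → f.IsEarly q →
      f.firstEntry = ⊤ ∧
      ∃ p : UnitAddCircle, minimalPeriod f.outside p = q.den ∧
        Disjoint (fwdOrbit f.outside p) f.gamma ∧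
        Tendsto (fun r : ℕ => Metric.infDist (f.outside^[r] (f.outside f.aPt))
          (fwdOrbit f.outside p)) atTop (𝓝 0)) ∧
    -- (d)
    (Irrational f.height →
      f.firstEntry = ⊤ ∧
      Dense f.falls ∧
      fwdOrbit f.outside (f.outside f.aPt) ⊆ f.fallsᶜ ∧
      f.fallsᶜ ⊆ closure (fwdOrbit f.outside (f.outside f.aPt))) := by
  open UnimodalMap in
  have hlt := f.rho_lt_half hf
  have hq0 : ∀ q : ℚ, f.rho = q → 0 ≤ q := fun q hq => by
    have := f.rho_nonneg
    rw [hq] at this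
    exact_mod_cast this
  have hq1 : ∀ q : ℚ, f.rho = q → q < 1 / 2 := fun q hq => by
    rw [hq] at hlt
    have : (q : ℝ) < ((1 / 2 : ℚ) : ℝ) := by push_cast; exact hlt
    exact_mod_cast this
  refine ⟨f.hasRotationNumber_outside, ?_, ?_, ?_⟩ <;> rw [f.height_eq_rho]
  · intro q hq he
    have h0 := hq0 q hq
    have h1 := hq1 q hq
    have h := returnsToGamma hf hq h0 h1 he
    have hlhe : f.kneading = lhe q ↔ f.ret q 0 = 0 := by
      rcases h0.eq_or_lt with rfl | h0
      · exact iff_of_true (kneading_eq_lhe_zero hq) (ret_zero_eq_zero hf hq)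
      · rw [kneading_eq_lhe_iff hq h0 h1]
        exact ⟨fun h' => le_antisymm h.le_zero h', fun h' => h'.ge⟩
    have hrhe : (0 < q ∧ f.kneading = rhe q) ↔ f.ret q 0 = f.g - 1 := by
      rcases h0.eq_or_lt with rfl | h0
      · refine iff_of_false (fun h' => lt_irrefl _ h'.1) ?_
        rw [ret_zero_eq_zero hf hq]
        linarith [f.g_lt_one]
      · rw [← kneading_eq_rhe_iff hf hq h0 h1]
        exact and_iff_right h0
    refine ⟨firstEntry_eq_den hq h.g_le h.le_zero, h.outside_iterate_eq_a_iff.trans hlhe.symm,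
      h.outside_iterate_eq_re_iff.trans hrhe.symm, fun hn => compl_falls_eq_empty ?_,
      fun ⟨h0, hκ, _, x, hx, hxb, hper, hit⟩ => ?_, fun hn hnq => ?_⟩
    · rcases hn with hr | rfl | ⟨h0, hκ, _, ht⟩
      · refine h.falls_of_not_isPeriodic hf ?_ (Or.inr (hrhe.1 hr))
        rw [hr.2]
        exact not_isPeriodic_rhe hr.1 h1
      · refine h.falls_of_not_isPeriodic hf ?_ (Or.inl (ret_zero_eq_zero hf hq))
        rw [kneading_eq_lhe_zero hq]
        exact not_isPeriodic_lhe_zero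
      · exact h.falls_of_tentLike h0 h1 (hlhe.1 hκ) ht
    · have hw := hlhe.1 hκ
      obtain ⟨y, hy, hyy⟩ := h.exists_fixed_of_periodic h0 h1 hw hx hxb hper hit
      exact h.isHalfOpenArc_decomposition hf hw hy hyy
    · rcases h0.eq_or_lt with rfl | h0
      · exact absurd (Or.inr (Or.inl rfl)) hn
      refine h.compl_falls_eq_fwdOrbit hf h0 h1 (lt_of_le_of_ne h.g_le fun hw => ?_)
        (lt_of_le_of_ne h.le_zero fun hw => ?_)
      · exact hn (Or.inl (hrhe.2 hw.symm))
      · have hκ := hlhe.2 hw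
        have hfa : f^[q.den] f.a = f.a := by rw [iterate_den_a hq, hw, tau_zero]
        refine hn (Or.inr (Or.inr ⟨h0, hκ, hfa, fun x hx hper hit => ?_⟩))
        by_contra hxb
        exact hnq ⟨h0, hκ, hfa, x, hx, hxb, hper, hit⟩
  · intro q hq he
    have hw := (isEarly_iff hq he.1 (hq1 q hq)).1 he
    obtain ⟨p, hp, hlim⟩ := tendsto_ret_iterate_zero hq hw
    exact ⟨firstEntry_eq_top (not_return_of_pos hq hw), p, minimalPeriod_coe hq hp,
      disjoint_gamma_of_pos hw hp, tendsto_infDist_fwdOrbit hlim⟩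
  · intro hρ
    exact ⟨firstEntry_eq_top (not_return_of_irrational hρ), dense_falls hf hρ,
      fwdOrbit_subset_compl_falls hρ, compl_falls_subset_closure hf hρ⟩
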